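/- For $u>0$ let $\mathcal S^{\mathrm{PI}}(u)$ be the Painlevé I spectral curve $x(z)=z^2-2u$, $y(z)=z^3-3uz$, $\omega_{0,2}(z_1,z_2)=\frac{dz_1\,dz_2}{(z_1-z_2)^2}$. Put $\theta(z)=\frac{-2}{(y(z)-y(-z))\,dx(z)}=\bigl(\sum_{m\ge0}\theta_m z^{2m-2}\bigr)\frac1{dz}$, $e_i(z)=\frac{z^{2i+1}}{(2i+1)!!}$, $\xi^i(z)=\operatorname{Res}_{w=0}\bigl(\int_0^w\omega_{0,2}(z,\cdot)\bigr)\frac{(2i+1)!!\,dw}{w^{2i+2}}$, and $$A_{i,j,k}=\operatorname*{Res}_{z=0}\theta\,e_i\,de_j\,de_k,\quad B_{i,j}^{k}=\operatorname*{Res}_{z=0}\theta\,e_i\,de_j\,\xi^k,\quad C_i^{j,k}=\operatorname*{Res}_{z=0}\theta\,e_i\,\xi^j\,\xi^k,\quad D_i=\delta_{i,0}\tfrac{\theta_1}{8}+\delta_{i,1}\tfrac{\theta_0}{24}.$$ For $n\ge1$ and $k_1,\dots,k_n\ge0$ the amplitudes $F^{\mathrm{PI}}_{g;k_1,\dots,k_n}(u)$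 are defined by $F_{0;i}=F_{0;i,j}=0$, $F_{0;i,j,k}=A_{i,j,k}$, $F_{1;i}=D_i$ and, for all other $(g,n)$ with $2g-2+n>0$, $$F_{g;k_1,\dots,k_n}=\sum_{m=2}^n\sum_{\mu\ge0}B_{k_1,k_m}^{\mu}F_{g;\mu,k_2,\dots,\widehat{k_m},\dots,k_n}+\frac12\sum_{\mu,\nu\ge0}C_{k_1}^{\mu,\nu}\Bigl(F_{g-1;\mu,\nu,k_2,\dots,k_n}+\sum_{\substack{g_1+g_2=g\\ I_1\sqcup I_2=\{k_2,\dots,k_n\}}}F_{g_1;\mu,I_1}F_{g_2;\nu,I_2}\Bigr),$$ where $F_{g-1;\dots}$ is read as $0$ if $g=0$; for $n=0$ and $g\ge2$, $F^{\mathrm{PI}}_g(u)=\frac1{2-2g}\operatorname{Res}_{z=0}\bigl(\int_0^z y\,dx\bigr)\sum_{k\ge0}F^{\mathrm{PI}}_{g;k}(u)\,\xi^k(z)$. Finally let $$P(u)=\begin{cases}\dfrac{2}{5u^2}&\text{if }u<\tfrac25,\\[2mm]\dfrac{5}{10u-2}&\text{if }u\ge\tfrac25.\end{cases}$$ **Proposition.**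 There exists a function $S:(0,\infty)\to(0,\infty)$ such that the following two bounds hold for every $u>0$ and all integers $g,n\ge0$ with $2g-2+n>0$. 1. For all $k_1,\dots,k_n\ge0$, $$F^{\mathrm{PI}}_{g;k_1,\dots,k_n}(u)\prod_{i=1}^n(2k_i+1)!!\le S(u)\Bigl(\frac{2u}{27}\Bigr)^gP(u)^{3g-3+n}\,\frac{(3g-3+n)!}{g!}.$$ 2. With the same function $S$, for every $v>0$ the following series converges absolutely and, writing $|k|=k_1+\cdots+k_n$, $$\sum_{k_1,\dots,k_n\ge0}v^{-|k|}F^{\mathrm{PI}}_{g;k_1,\dots,k_n}(u)\prod_{i=1}^n(2k_i+1)!!\le\frac{S(u/v)}{v}\Bigl(\frac{2u}{27}\Bigr)^g\Bigl(\frac{P(u/v)}{v^2}\Bigr)^{3g-3+n}\frac{(3g-3+2n)!}{g!\,n!}.$$ -/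

import Mathlib

namespace TopRec

noncomputable section

/-- A local spectral curve with exactly one ramification point, at the origin of a
coordinate `z` with `x = x₀ + z²` and with real expansion coefficients.
It records the constant `x₀`, the expansion of `y`, and the coefficients of
the regular part of the bidifferential
`ω₀₂(z, w) = (1 / (z - w)² + ∑ reg m n zᵐ wⁿ) dz dw`. -/
structure LocalSpectralCurve where
  x₀ : ℝ
  y : PowerSeries ℝ
  reg : ℕ → ℕ → ℝ
  reg_symm : ∀ m n, reg m n = reg n m

/-- The formal primitive without constant term. -/
def primitive {K : Type*} [Field K] (f : PowerSeries K) : PowerSeries K :=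
  PowerSeries.mk fun n => if n = 0 then 0 else PowerSeries.coeff (n - 1) f / (n : K)

/-- The residue at the origin of the one-form `f(z) dz`. -/
def residue {K : Type*} [Field K] (f : LaurentSeries K) : K :=
  f.coeff (-1)

namespace LocalSpectralCurve

variable (S : LocalSpectralCurve)

/-- The function `x = x₀ + z²`. -/
def x : PowerSeries ℝ :=
  PowerSeries.C S.x₀ + PowerSeries.X ^ 2

/-- The series `f` in `θ(z) = -2 / ((y(z) - y(-z)) dx(z)) = f(z) / dz`. -/
def theta : LaurentSeries ℝ :=
  -2 / (HahnSeries.ofPowerSeries ℤ ℝ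
    ((S.y - PowerSeries.evalNegHom S.y) * PowerSeries.derivative ℝ S.x))

/-- The expansion coefficients `θₘ` in `θ(z) = (∑ θₘ z^(2m-2)) / dz`. -/
def thetaCoeff (m : ℕ) : ℝ :=
  S.theta.coeff (2 * (m : ℤ) - 2)

/-- The expansion coefficients `φ_{m,n}` of the even part of the regular part of `ω₀₂`. -/
def phiCoeff (m n : ℕ) : ℝ :=
  S.reg (2 * m) (2 * n)

/-- The expansion of `ω₀₂(z, w) / (dz dw)` for `w` near `0`, as a power series in `w` whose
coefficients are Laurent series in `z`. -/
def omega02 : PowerSeries (LaurentSeries ℝ) :=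
  ((PowerSeries.C (HahnSeries.single (1 : ℤ) (1 : ℝ)) - PowerSeries.X) ^ 2)⁻¹ +
    PowerSeries.mk fun n =>
      HahnSeries.ofPowerSeries ℤ ℝ (PowerSeries.mk fun m => S.reg m n)

/-- The function `eᵢ(z) = z^(2i+1) / (2i+1)!!`. -/
def e (i : ℕ) : PowerSeries ℝ :=
  PowerSeries.monomial (2 * i + 1) (1 / (Nat.doubleFactorial (2 * i + 1) : ℝ))

/-- The differential `ξⁱ(z) = Res_{w = 0} (∫_0^w ω₀₂(z, ·)) (2i+1)!! dw / w^(2i+2)`,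
divided by `dz`. -/
def xi (i : ℕ) : LaurentSeries ℝ :=
  residue (HahnSeries.ofPowerSeries ℤ (LaurentSeries ℝ) (primitive S.omega02) *
    HahnSeries.single (-(2 * (i : ℤ) + 2))
      (Nat.doubleFactorial (2 * i + 1) : LaurentSeries ℝ))

/-- `A_{i,j,k} = Res θ eᵢ deⱼ deₖ`. -/
def A (i j k : ℕ) : ℝ :=
  residue (S.theta * HahnSeries.ofPowerSeries ℤ ℝ
    (e i * PowerSeries.derivative ℝ (e j) * PowerSeries.derivative ℝ (e k)))

/-- `B i j k` is `B_{i,j}^k = Res θ eᵢ deⱼ ξᵏ`. -/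
def B (i j k : ℕ) : ℝ :=
  residue (S.theta * HahnSeries.ofPowerSeries ℤ ℝ
    (e i * PowerSeries.derivative ℝ (e j)) * S.xi k)

/-- `C i j k` is `C_i^{j,k} = Res θ eᵢ ξʲ ξᵏ`. -/
def C (i j k : ℕ) : ℝ :=
  residue (S.theta * HahnSeries.ofPowerSeries ℤ ℝ (e i) * S.xi j * S.xi k)

/-- `Dᵢ = δ_{i,0} (θ₀ φ_{0,0} / 2 + θ₁ / 8) + δ_{i,1} θ₀ / 24`. -/
def D (i : ℕ) : ℝ :=
  (if i = 0 then S.thetaCoeff 0 / 2 * S.phiCoeff 0 0 + S.thetaCoeff 1 / 8 else 0) +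
    (if i = 1 then S.thetaCoeff 0 / 24 else 0)

end LocalSpectralCurve

/-- The sublist of `L` formed by the entries whose position lies in `I`. -/
def sublistAt (L : List ℕ) (I : Finset (Fin L.length)) : List ℕ :=
  ((List.finRange L.length).filter (fun m => decide (m ∈ I))).map L.get

theorem length_sublistAt (L : List ℕ) (I : Finset (Fin L.length)) :
    (sublistAt L I).length = I.card := by
  have h : ((List.finRange L.length).filter (fun m => decide (m ∈ I))).toFinset = I := by
    ext m; simp
  rw [sublistAt, List.length_map, ← List.toFinset_card_of_nodup
    ((List.nodup_finRange _).filter _), h]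

/-- The amplitudes `F_{g; k₁, …, kₙ}` with `n ≥ 1` of the quantum Airy structure `(A, B, C, D)`
of a local spectral curve, given by the recursion
`F_{g; k₁, …, kₙ} = ∑_{m ≥ 2} ∑_μ B_{k₁,kₘ}^μ F_{g; μ, k₂, …, k̂ₘ, …, kₙ}`
`+ ½ ∑_{μ,ν} C_{k₁}^{μ,ν} (F_{g-1; μ, ν, k₂, …, kₙ} + ∑ F_{g₁; μ, I₁} F_{g₂; ν, I₂})`,
where the last sum runs over `g₁ + g₂ = g` and `I₁ ⊔ I₂ = {k₂, …, kₙ}`, with the initial values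
`F_{0; i} = F_{0; i, j} = 0`, `F_{0; i, j, k} = A_{i,j,k}` and `F_{1; i} = Dᵢ`.
In the last sum only the products with a factor `F_{0; μ}` or `F_{0; ν}` are left out; these
vanish. The value on the empty list is a placeholder. -/
def airyAmplitude (S : LocalSpectralCurve) (g : ℕ) : List ℕ → ℝ
  | [] => 0
  | a :: L =>
    if g = 0 ∧ L.length ≤ 1 then 0
    else if g = 0 ∧ L.length = 2 then S.A a (L.getD 0 0) (L.getD 1 0)
    else if g = 1 ∧ L.length = 0 then S.D a
    else
      (∑ m : Fin L.length, ∑ᶠ μ : ℕ,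
        S.B a (L.get m) μ * airyAmplitude S g (μ :: L.eraseIdx m)) +
      1 / 2 * ∑ᶠ p : ℕ × ℕ, S.C a p.1 p.2 *
        ((if _hg : 1 ≤ g then airyAmplitude S (g - 1) (p.1 :: p.2 :: L) else 0) +
          ∑ g₁ : Fin (g + 1), ∑ I : Finset (Fin L.length),
            if _h : (1 ≤ (g₁ : ℕ) ∨ 1 ≤ I.card) ∧ (1 ≤ g - (g₁ : ℕ) ∨ 1 ≤ Iᶜ.card) then
              airyAmplitude S (g₁ : ℕ) (p.1 :: sublistAt L I) *
                airyAmplitude S (g - (g₁ : ℕ)) (p.2 :: sublistAt L Iᶜ)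
            else 0)
termination_by L => 2 * g + L.length
decreasing_by
  · have := m.isLt
    simp only [List.length_cons, List.length_eraseIdx, this, if_true]
    omega
  · simp only [List.length_cons]
    omega
  all_goals
    have h1 := g₁.isLt
    have h2 := Finset.card_add_card_compl I
    rw [Fintype.card_fin] at h2
    simp only [List.length_cons, length_sublistAt]
    omega

/-- The correlator `ω_{g,1}(z) = ∑_k F_{g; k} ξᵏ(z)`, divided by `dz`. -/
def omega1 (S : LocalSpectralCurve) (g : ℕ) : LaurentSeries ℝ :=
  ∑ᶠ k : ℕ, airyAmplitude S g [k] • S.xi k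

/-- The free energy `F_g = (2 - 2g)⁻¹ Res_{z = 0} (∫_0^z y dx) ω_{g,1}(z)`, for `g ≥ 2`. -/
def freeEnergy (S : LocalSpectralCurve) (g : ℕ) : ℝ :=
  1 / (2 - 2 * (g : ℝ)) *
    residue (HahnSeries.ofPowerSeries ℤ ℝ
      (primitive (S.y * PowerSeries.derivative ℝ S.x)) * omega1 S g)

/-- The amplitude `F_{g; k₁, …, kₙ}`, which for `n = 0` is the free energy `F_g`. -/
def amplitude (S : LocalSpectralCurve) (g : ℕ) {n : ℕ} (k : Fin n → ℕ) : ℝ :=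
  if n = 0 then freeEnergy S g else airyAmplitude S g (List.ofFn k)

/-- The Painlevé I spectral curve `x = z² - 2u`, `y = z³ - 3uz`,
`ω₀₂ = dz₁ dz₂ / (z₁ - z₂)²`. -/
def painleveI (u : ℝ) : LocalSpectralCurve where
  x₀ := -2 * u
  y := PowerSeries.X ^ 3 - PowerSeries.C (3 * u) * PowerSeries.X
  reg := fun _ _ => 0
  reg_symm := fun _ _ => rfl

/-- The function `P(u)`, equal to `2 / (5u²)` for `u < 2/5` and to `5 / (10u - 2)` for
`u ≥ 2/5`. -/
def growthP (u : ℝ) : ℝ :=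
  if u < 2 / 5 then 2 / (5 * u ^ 2) else 5 / (10 * u - 2)

end

end TopRec

/-! Multiplying `F_{g;k₁,…,kₙ}` by `∏ (2kᵢ+1)!!` and `(6u)^(2g-2+n)` gives `normAmp`. Up to the
factor `1/(6u z²)`, `θ` is a geometric series in `z²/(3u)`. Hence the recursion with first index `k`
minus `1/(3u)` times the one with first index `k+1`, each multiplied by its double factorial, keeps
one term of every geometric tail. What remains is the Virasoro recursion of Witten and Kontsevich
with one further term `a v(k+1)`, where `a = 1/(3u)` (`isVirasoro_normAmp`). Its coefficients are
nonnegative, so an explicit majorant can be carried through an induction.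

Write `a = 5q/3` with `q = 1/(5u)`, let `ℓ = 3g-3+n-|k|`, and let `z` be the number of vanishing
indices. For `g ≥ 1` the majorant is `c_g (1+1/g)^min(z,2) 3ⁿ (q^ℓ/ℓ!) (2g-3+n+ℓ)!` with `c_g =
(9/4)^g g³/54` (`le_stableBound`). If no index vanishes, the terms of the recursion weigh `5ℓ`,
`2x+1` for each entry `x` of the tail, and at most `2(k₁-1)` for the quadratic part. By the
dimension constraint these add up to exactly `3(2g-3+n+ℓ)`. The quadratic weight rests on a
convolution inequality for `c_g` (`genusConst_rec`) and on a Beta-integral identity for factorials.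

If an index vanishes, the string equation is used instead, as it has no quadratic part. For a
vanishing first index it is the recursion itself. For a zero elsewhere it is derived from the
commutator of Virasoro operators (`string_eq`), so symmetry of the amplitudes in all indices is
never needed. In genus zero some index always vanishes, and the string equation alone suffices
(`genus_zero_le`).

To reach the stated form, put `M = 2g-3+n` and `N = M+g = 3g-3+n`. A single binomial term gives
`(M+ℓ)! r^ℓ/ℓ! ≤ M! (1-r)^(-M)` with `r = min(q,1/2)`, and powers of `2q` pay for `q > 1/2`. The
threshold `q = 1/2` is `u = 2/5`, whence the two branches of `P`. The growth rate `27/4` of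
`binom(3g,g)` turns `c_g M!` into `3^(-g) N!/g!` up to a polynomial in `g`, which the spare factor
`(1-r)^g` absorbs into a constant depending only on `u`.

Replacing the reference parameter `q` by `q' = vq` gives a bound for every term of the series. Only
indices with `|k| ≤ N` contribute, and there are `binom(N+n,n)` of them. For `n = 0`, the free
energy is a combination of `F_{g;1}` and `F_{g;2}` in which the latter has a negative sign. -/

namespace TopRec

noncomputable section

/-! ### Calculus of functions on multisets -/

/-- The sum of `ψ x (s - x)` over the entries `x` of `s`. -/
def removeSum (ψ : ℕ → Multiset ℕ → ℝ) (s : Multiset ℕ) : ℝ :=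
  (s.map fun x => ψ x (s.erase x)).sum

/-- The convolution over all splittings of a multiset into two parts. -/
def conv (φ ψ : Multiset ℕ → ℝ) (s : Multiset ℕ) : ℝ :=
  (s.antidiagonal.map fun t => φ t.1 * ψ t.2).sum

/-- The index shift `ψ ↦ (2x+1) ψ_{x-1}`. -/
def raise (ψ : ℕ → Multiset ℕ → ℝ) : ℕ → Multiset ℕ → ℝ
  | 0, _ => 0
  | x + 1, s => (2 * x + 3) * ψ x s

/-- The derivation lowering one entry `x` of a multiset by one with weight `2x+1`. -/
def lowerSum (φ : Multiset ℕ → ℝ) (s : Multiset ℕ) : ℝ :=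
  removeSum (raise fun x t => φ (x ::ₘ t)) s

/-- The defect of the string equation with parameter `a`. -/
def stringOp (a : ℝ) (φ : Multiset ℕ → ℝ) (s : Multiset ℕ) : ℝ :=
  φ (0 ::ₘ s) - a * φ (1 ::ₘ s) - lowerSum φ s

@[simp] theorem removeSum_zero (ψ : ℕ → Multiset ℕ → ℝ) : removeSum ψ 0 = 0 := by
  simp [removeSum]

theorem removeSum_cons (ψ : ℕ → Multiset ℕ → ℝ) (y : ℕ) (s : Multiset ℕ) :
    removeSum ψ (y ::ₘ s) = ψ y s + removeSum (fun x t => ψ x (y ::ₘ t)) s := by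
  rw [removeSum, Multiset.map_cons, Multiset.sum_cons, Multiset.erase_cons_head, removeSum]
  congr 2
  refine Multiset.map_congr rfl fun x hx => ?_
  rw [Multiset.erase_cons_tail_of_mem hx]

theorem removeSum_add (ψ χ : ℕ → Multiset ℕ → ℝ) (s : Multiset ℕ) :
    removeSum (fun x t => ψ x t + χ x t) s = removeSum ψ s + removeSum χ s := by
  simp [removeSum, Multiset.sum_map_add]

theorem removeSum_mul (c : ℝ) (ψ : ℕ → Multiset ℕ → ℝ) (s : Multiset ℕ) :
    removeSum (fun x t => c * ψ x t) s = c * removeSum ψ s := by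
  simp [removeSum, Multiset.sum_map_mul_left]

theorem removeSum_congr {ψ χ : ℕ → Multiset ℕ → ℝ} {s : Multiset ℕ}
    (h : ∀ x ∈ s, ψ x (s.erase x) = χ x (s.erase x)) : removeSum ψ s = removeSum χ s := by
  rw [removeSum, Multiset.map_congr rfl h, removeSum]

theorem removeSum_nonneg {ψ : ℕ → Multiset ℕ → ℝ} {s : Multiset ℕ}
    (h : ∀ x ∈ s, 0 ≤ ψ x (s.erase x)) : 0 ≤ removeSum ψ s := by
  refine Multiset.sum_nonneg fun y hy => ?_
  obtain ⟨x, hx, rfl⟩ := Multiset.mem_map.1 hy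
  exact h x hx

theorem removeSum_le {ψ : ℕ → Multiset ℕ → ℝ} {f : ℕ → ℝ} {s : Multiset ℕ}
    (h : ∀ x ∈ s, ψ x (s.erase x) ≤ f x) : removeSum ψ s ≤ (s.map f).sum :=
  Multiset.sum_map_le_sum_map _ _ h

@[simp] theorem conv_zero (φ ψ : Multiset ℕ → ℝ) : conv φ ψ 0 = φ 0 * ψ 0 := by
  simp [conv]

theorem conv_cons (φ ψ : Multiset ℕ → ℝ) (y : ℕ) (s : Multiset ℕ) :
    conv φ ψ (y ::ₘ s) =
      conv (fun t => φ (y ::ₘ t)) ψ s + conv φ (fun t => ψ (y ::ₘ t)) s := by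
  simp [conv, Multiset.antidiagonal_cons, Multiset.map_map, add_comm]

theorem conv_congr {φ ψ φ' ψ' : Multiset ℕ → ℝ} {s : Multiset ℕ}
    (h : ∀ t₁ t₂, t₁ + t₂ = s → φ t₁ * ψ t₂ = φ' t₁ * ψ' t₂) : conv φ ψ s = conv φ' ψ' s := by
  rw [conv, conv]
  congr 1
  exact Multiset.map_congr rfl fun t ht => h _ _ (Multiset.mem_antidiagonal.1 ht)

theorem conv_nonneg {φ ψ : Multiset ℕ → ℝ} {s : Multiset ℕ}
    (h : ∀ t₁ t₂, t₁ + t₂ = s → 0 ≤ φ t₁ * ψ t₂) : 0 ≤ conv φ ψ s := by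
  refine Multiset.sum_nonneg fun y hy => ?_
  obtain ⟨t, ht, rfl⟩ := Multiset.mem_map.1 hy
  exact h _ _ (Multiset.mem_antidiagonal.1 ht)

theorem conv_add_left (φ φ' ψ : Multiset ℕ → ℝ) (s : Multiset ℕ) :
    conv (fun t => φ t + φ' t) ψ s = conv φ ψ s + conv φ' ψ s := by
  simp [conv, add_mul, Multiset.sum_map_add]

theorem conv_add_right (φ ψ ψ' : Multiset ℕ → ℝ) (s : Multiset ℕ) :
    conv φ (fun t => ψ t + ψ' t) s = conv φ ψ s + conv φ ψ' s := by
  simp [conv, mul_add, Multiset.sum_map_add]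

theorem conv_mul_left (c : ℝ) (φ ψ : Multiset ℕ → ℝ) (s : Multiset ℕ) :
    conv (fun t => c * φ t) ψ s = c * conv φ ψ s := by
  simp [conv, mul_assoc, Multiset.sum_map_mul_left]

theorem conv_mul_right (c : ℝ) (φ ψ : Multiset ℕ → ℝ) (s : Multiset ℕ) :
    conv φ (fun t => c * ψ t) s = c * conv φ ψ s := by
  simp [conv, mul_left_comm, Multiset.sum_map_mul_left]

theorem conv_comm (φ ψ : Multiset ℕ → ℝ) (s : Multiset ℕ) : conv φ ψ s = conv ψ φ s := by
  induction s using Multiset.induction generalizing φ ψ with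
  | empty => simp [mul_comm]
  | cons y s ih => rw [conv_cons, conv_cons, ih, ih φ, add_comm]

/-- Convolution with the indicator of the singleton `{0}`. -/
theorem conv_singleton (φ ψ : Multiset ℕ → ℝ) (hφ : ∀ t, φ t = if t = {0} then 1 else 0)
    (s : Multiset ℕ) : conv φ ψ s = removeSum (fun x t => if x = 0 then ψ t else 0) s := by
  have h0 : ∀ (ψ : Multiset ℕ → ℝ) s, conv (fun t => if t = 0 then (1 : ℝ) else 0) ψ s = ψ s := by
    intro ψ s
    induction s using Multiset.induction generalizing ψ with
    | empty => simp
    | cons y s ih => rw [conv_cons, ih]; simp [conv]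
  induction s using Multiset.induction generalizing ψ with
  | empty => simp [hφ]
  | cons y s ih =>
    rw [conv_cons, ih, removeSum_cons]
    congr 1
    by_cases hy : y = 0
    · subst hy
      rw [← h0 ψ s]
      simp only [if_true, h0]
      rw [← h0 ψ s]
      congr 1
      funext t
      rw [hφ, ← Multiset.cons_zero]
      simp only [Multiset.cons_inj_right]
    · have : (fun t => φ (y ::ₘ t)) = fun _ => 0 := by
        funext t
        rw [hφ, if_neg]
        intro h
        have : y ∈ ({0} : Multiset ℕ) := h ▸ Multiset.mem_cons_self y t
        exact hy (by simpa using this)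
      rw [this]
      simp [conv, hy]

theorem lowerSum_cons (φ : Multiset ℕ → ℝ) (y : ℕ) (s : Multiset ℕ) :
    lowerSum φ (y ::ₘ s) =
      raise (fun x t => φ (x ::ₘ t)) y s + lowerSum (fun t => φ (y ::ₘ t)) s := by
  rw [lowerSum, removeSum_cons, lowerSum]
  congr 2
  funext x t
  cases x with
  | zero => rfl
  | succ x => simp only [raise]; rw [Multiset.cons_swap]

@[simp] theorem lowerSum_zero (φ : Multiset ℕ → ℝ) : lowerSum φ 0 = 0 := by
  simp [lowerSum]

theorem raise_add (ψ χ : ℕ → Multiset ℕ → ℝ) (x : ℕ) (s : Multiset ℕ) :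
    raise (fun x t => ψ x t + χ x t) x s = raise ψ x s + raise χ x s := by
  cases x <;> simp [raise, mul_add]

theorem raise_mul (c : ℝ) (ψ : ℕ → Multiset ℕ → ℝ) (x : ℕ) (s : Multiset ℕ) :
    raise (fun x t => c * ψ x t) x s = c * raise ψ x s := by
  cases x <;> simp [raise, mul_left_comm]

theorem lowerSum_add (φ ψ : Multiset ℕ → ℝ) (s : Multiset ℕ) :
    lowerSum (fun t => φ t + ψ t) s = lowerSum φ s + lowerSum ψ s := by
  rw [lowerSum, lowerSum, lowerSum, ← removeSum_add]
  congr 1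
  funext x t
  exact raise_add _ _ _ _

theorem lowerSum_mul (c : ℝ) (φ : Multiset ℕ → ℝ) (s : Multiset ℕ) :
    lowerSum (fun t => c * φ t) s = c * lowerSum φ s := by
  rw [lowerSum, lowerSum, ← removeSum_mul]
  congr 1
  funext x t
  exact raise_mul _ _ _ _

theorem raise_conv_left (φ ψ : Multiset ℕ → ℝ) (y : ℕ) (s : Multiset ℕ) :
    raise (fun x t => conv φ ψ (x ::ₘ t)) y s =
      conv (raise (fun x t => φ (x ::ₘ t)) y) ψ s +
        conv φ (raise (fun x t => ψ (x ::ₘ t)) y) s := by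
  cases y with
  | zero => simp [raise, conv]
  | succ y =>
    have h1 := conv_mul_left (2 * y + 3) (fun t => φ (y ::ₘ t)) ψ s
    have h2 := conv_mul_right (2 * y + 3) φ (fun t => ψ (y ::ₘ t)) s
    have e1 : raise (fun x t => φ (x ::ₘ t)) (y + 1) = fun t => (2 * y + 3) * φ (y ::ₘ t) := rfl
    have e2 : raise (fun x t => ψ (x ::ₘ t)) (y + 1) = fun t => (2 * y + 3) * ψ (y ::ₘ t) := rfl
    rw [e1, e2, h1, h2, raise, conv_cons, mul_add]

/-- Leibniz rule: each entry of the multiset goes to exactly one of the two factors, and so does the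
lowered entry. -/
theorem lowerSum_conv (φ ψ : Multiset ℕ → ℝ) (s : Multiset ℕ) :
    lowerSum (conv φ ψ) s = conv (lowerSum φ) ψ s + conv φ (lowerSum ψ) s := by
  induction s using Multiset.induction generalizing φ ψ with
  | empty => simp
  | cons y s ih =>
    have h1 : (fun t => lowerSum φ (y ::ₘ t)) = fun t =>
        raise (fun x t => φ (x ::ₘ t)) y t + lowerSum (fun t => φ (y ::ₘ t)) t :=
      funext fun t => lowerSum_cons φ y t
    have h2 : (fun t => lowerSum ψ (y ::ₘ t)) = fun t =>
        raise (fun x t => ψ (x ::ₘ t)) y t + lowerSum (fun t => ψ (y ::ₘ t)) t :=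
      funext fun t => lowerSum_cons ψ y t
    have h3 : (fun t => conv φ ψ (y ::ₘ t)) = fun t =>
        conv (fun t => φ (y ::ₘ t)) ψ t + conv φ (fun t => ψ (y ::ₘ t)) t :=
      funext fun t => conv_cons φ ψ y t
    rw [lowerSum_cons, raise_conv_left, h3, lowerSum_add, ih, ih, conv_cons, conv_cons, h1, h2,
      conv_add_left, conv_add_right]
    ring

/-- The second term accounts for the case in which the lowered entry is itself the one removed. -/
theorem lowerSum_removeSum (ψ : ℕ → Multiset ℕ → ℝ) (s : Multiset ℕ) :
    lowerSum (removeSum ψ) s =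
      removeSum (fun x => lowerSum (ψ x)) s + removeSum (raise ψ) s := by
  induction s using Multiset.induction generalizing ψ with
  | empty => simp
  | cons y s ih =>
    have h1 : (fun t => removeSum ψ (y ::ₘ t)) = fun t =>
        ψ y t + removeSum (fun x t => ψ x (y ::ₘ t)) t := funext fun t => removeSum_cons ψ y t
    have h2 : (fun x t => lowerSum (ψ x) (y ::ₘ t)) = fun x t =>
        raise (fun z t => ψ x (z ::ₘ t)) y t + lowerSum (fun t => ψ x (y ::ₘ t)) t :=
      funext fun x => funext fun t => lowerSum_cons (ψ x) y t
    have h3 : raise (fun x t => removeSum ψ (x ::ₘ t)) y s = raise ψ y s +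
        removeSum (fun x t => raise (fun z t => ψ x (z ::ₘ t)) y t) s := by
      cases y with
      | zero => simp [raise, removeSum]
      | succ y =>
        simp only [raise]
        rw [removeSum_cons, removeSum_mul, mul_add]
    have h4 : (fun x t => raise ψ x (y ::ₘ t)) = raise fun x t => ψ x (y ::ₘ t) := by
      funext x t
      cases x <;> rfl
    rw [lowerSum_cons, h1, lowerSum_add, ih, removeSum_cons, removeSum_cons, h2, removeSum_add, h3,
      h4]
    ring

/-! ### The string operator as a derivation -/

section stringOp

variable (a : ℝ)

theorem stringOp_add (φ ψ : Multiset ℕ → ℝ) (s : Multiset ℕ) :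
    stringOp a (fun t => φ t + ψ t) s = stringOp a φ s + stringOp a ψ s := by
  simp only [stringOp, lowerSum_add]
  ring

theorem stringOp_mul (c : ℝ) (φ : Multiset ℕ → ℝ) (s : Multiset ℕ) :
    stringOp a (fun t => c * φ t) s = c * stringOp a φ s := by
  simp only [stringOp, lowerSum_mul]
  ring

theorem stringOp_zero (s : Multiset ℕ) : stringOp a (fun _ => 0) s = 0 := by
  simpa using stringOp_mul a 0 (fun _ => 0) s

theorem stringOp_sum {ι : Type*} (A : Finset ι) (f : ι → Multiset ℕ → ℝ) (s : Multiset ℕ) :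
    stringOp a (fun t => ∑ i ∈ A, f i t) s = ∑ i ∈ A, stringOp a (f i) s := by
  classical
  induction A using Finset.induction_on with
  | empty => simpa using stringOp_zero a s
  | insert i A hi ih =>
    simp only [Finset.sum_insert hi]
    rw [stringOp_add, ih]

/-- The string operator fails to commute with removal exactly where the added entry `0` or `1`, or
the lowered entry, is itself the one removed. -/
theorem stringOp_removeSum (ψ : ℕ → Multiset ℕ → ℝ) (s : Multiset ℕ) :
    stringOp a (removeSum ψ) s = ψ 0 s - a * ψ 1 s +
      removeSum (fun x => stringOp a (ψ x)) s - removeSum (raise ψ) s := by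
  have h : removeSum (fun x => stringOp a (ψ x)) s =
      removeSum (fun x t => ψ x (0 ::ₘ t)) s - a * removeSum (fun x t => ψ x (1 ::ₘ t)) s -
        removeSum (fun x => lowerSum (ψ x)) s := by
    have e : (fun x => stringOp a (ψ x)) = fun x t =>
        ψ x (0 ::ₘ t) + (-a * ψ x (1 ::ₘ t) + -1 * lowerSum (ψ x) t) := by
      funext x t
      simp only [stringOp]
      ring
    rw [e, removeSum_add, removeSum_add, removeSum_mul, removeSum_mul]
    ring
  rw [h, stringOp, lowerSum_removeSum, removeSum_cons, removeSum_cons]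
  ring

theorem stringOp_conv (φ ψ : Multiset ℕ → ℝ) (s : Multiset ℕ) :
    stringOp a (conv φ ψ) s = conv (stringOp a φ) ψ s + conv φ (stringOp a ψ) s := by
  have e : ∀ φ : Multiset ℕ → ℝ, stringOp a φ = fun t =>
      φ (0 ::ₘ t) + (-a * φ (1 ::ₘ t) + -1 * lowerSum φ t) := by
    intro φ
    funext t
    simp only [stringOp]
    ring
  rw [e φ, e ψ, conv_add_left, conv_add_left, conv_mul_left, conv_mul_left, conv_add_right,
    conv_add_right, conv_mul_right, conv_mul_right, stringOp, lowerSum_conv, conv_cons, conv_cons]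
  ring

theorem stringOp_cons (φ : Multiset ℕ → ℝ) (y : ℕ) (s : Multiset ℕ) :
    stringOp a (fun t => φ (y ::ₘ t)) s =
      stringOp a φ (y ::ₘ s) + raise (fun x t => φ (x ::ₘ t)) y s := by
  rw [stringOp, stringOp, lowerSum_cons, Multiset.cons_swap 0, Multiset.cons_swap 1]
  ring

end stringOp

end

end TopRec

namespace TopRec

noncomputable section

open Finset.HasAntidiagonal (antidiagonal)

/-! ### The Virasoro recursion with one shifted time -/

/-- The initial values of the recursion. -/
def virInit (g k : ℕ) (s : Multiset ℕ) : ℝ :=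
  (if g = 0 ∧ k = 0 ∧ s = 0 ::ₘ 0 ::ₘ 0 then 1 else 0) +
    (if g = 1 ∧ k = 1 ∧ s = 0 then 1 / 8 else 0)

/-- The contribution of merging the head `k` with an entry `x`. -/
def virMerge (v : ℕ → ℕ → Multiset ℕ → ℝ) (g k x : ℕ) (s : Multiset ℕ) : ℝ :=
  if k + x = 0 then 0 else (2 * x + 1) * v g (k + x - 1) s

/-- The summand of the quadratic part of the recursion with new indices `p`. -/
def virSplit (v : ℕ → ℕ → Multiset ℕ → ℝ) (g : ℕ) (p : ℕ × ℕ) (s : Multiset ℕ) : ℝ :=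
  (if 1 ≤ g then v (g - 1) p.1 (p.2 ::ₘ s) else 0) +
    ∑ h ∈ antidiagonal g, conv (v h.1 p.1) (v h.2 p.2) s

/-- The quadratic part of the recursion. -/
def virQuad (v : ℕ → ℕ → Multiset ℕ → ℝ) (g : ℕ) : ℕ → Multiset ℕ → ℝ
  | 0, _ => 0
  | 1, _ => 0
  | k + 2, s => 1 / 2 * ∑ p ∈ antidiagonal k, virSplit v g p s

/-- Amplitudes `v g k s` with a distinguished index `k` satisfying the Virasoro recursion
in which one time is shifted by the parameter `a`. -/
structure IsVirasoro (a : ℝ) (v : ℕ → ℕ → Multiset ℕ → ℝ) : Prop where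
  vanish : ∀ g k s, 3 * g + s.card < k + s.sum + 2 → v g k s = 0
  rec_eq : ∀ g k s, v g k s =
    a * v g (k + 1) s + removeSum (virMerge v g k) s + virQuad v g k s + virInit g k s

namespace IsVirasoro

variable {a : ℝ} {v : ℕ → ℕ → Multiset ℕ → ℝ}

theorem zero_of_card_le_one (hv : IsVirasoro a v) (k : ℕ) (s : Multiset ℕ) (hs : s.card ≤ 1) :
    v 0 k s = 0 :=
  hv.vanish _ _ _ (by omega)

/-- The right-hand side of the string equation. -/
def stringRhs (v : ℕ → ℕ → Multiset ℕ → ℝ) (g k : ℕ) (s : Multiset ℕ) : ℝ :=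
  raise (v g) k s + virInit g 0 (k ::ₘ s)

theorem virInit_zero_cons (g k : ℕ) (s : Multiset ℕ) :
    virInit g 0 (k ::ₘ s) = if g = 0 ∧ k = 0 ∧ s = {0} then 1 else 0 := by
  have : k ::ₘ s = 0 ::ₘ 0 ::ₘ 0 ↔ k = 0 ∧ s = {0} := by
    constructor
    · intro h
      have hk : k ∈ (0 ::ₘ 0 ::ₘ 0 : Multiset ℕ) := h ▸ Multiset.mem_cons_self k s
      have hk0 : k = 0 := by simpa using hk
      subst hk0
      exact ⟨rfl, by rw [Multiset.cons_inj_right] at h; simpa using h⟩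
    · rintro ⟨rfl, rfl⟩
      simp
  simp only [virInit, this]
  simp

theorem virInit_add_two (g k : ℕ) (s : Multiset ℕ) : virInit g (k + 2) s = 0 := by
  simp [virInit]

theorem sum_raise_antidiagonal (f : ℕ → ℕ → ℝ) (k : ℕ) :
    ∑ p ∈ antidiagonal (k + 1),
      (raise (fun x _ => f x p.2) p.1 0 + raise (fun x _ => f p.1 x) p.2 0) =
    (2 * k + 6) * ∑ p ∈ antidiagonal k, f p.1 p.2 := by
  rw [Finset.sum_add_distrib, Finset.Nat.sum_antidiagonal_succ, Finset.Nat.sum_antidiagonal_succ']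
  simp only [raise, zero_add]
  rw [← Finset.sum_add_distrib, Finset.mul_sum]
  refine Finset.sum_congr rfl fun p hp => ?_
  have : (p.1 : ℝ) + p.2 = k := by exact_mod_cast Finset.HasAntidiagonal.mem_antidiagonal.1 hp
  rw [← this]
  ring

theorem raise_eq_apply (ψ : ℕ → Multiset ℕ → ℝ) (x : ℕ) (s : Multiset ℕ) :
    raise ψ x s = raise (fun y _ => ψ y s) x 0 := by
  cases x <;> rfl

theorem raise_sum {ι : Type*} (A : Finset ι) (f : ι → ℕ → ℝ) (y : ℕ) (s : Multiset ℕ) :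
    ∑ i ∈ A, raise (fun x _ => f i x) y s = raise (fun x _ => ∑ i ∈ A, f i x) y s := by
  cases y with
  | zero => simp [raise]
  | succ y => simp [raise, Finset.mul_sum]

theorem raise_const_zero (y : ℕ) (s : Multiset ℕ) : raise (fun _ _ => 0) y s = 0 := by
  cases y <;> simp [raise]

theorem conv_raise_left (ψ : ℕ → Multiset ℕ → ℝ) (φ : Multiset ℕ → ℝ) (y : ℕ) (s : Multiset ℕ) :
    conv (raise ψ y) φ s = raise (fun x _ => conv (ψ x) φ s) y 0 := by
  cases y with
  | zero => simp [conv, raise]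
  | succ y => exact conv_mul_left _ _ _ _

theorem removeSum_raise_zero (s : Multiset ℕ) : removeSum (raise fun _ _ => 0) s = 0 := by
  have : (raise fun _ _ => 0) = fun _ _ => 0 := by
    funext x t
    cases x <;> simp [raise]
  simp [this, removeSum]

theorem virMerge_zero (v : ℕ → ℕ → Multiset ℕ → ℝ) (g : ℕ) : virMerge v g 0 = raise (v g) := by
  funext x t
  cases x with
  | zero => simp [virMerge, raise]
  | succ x => simp [virMerge, raise]; left; ring

theorem virMerge_succ (v : ℕ → ℕ → Multiset ℕ → ℝ) (g k x : ℕ) (t : Multiset ℕ) :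
    virMerge v g (k + 1) x t = (2 * x + 1) * v g (k + x) t := by
  rw [virMerge, if_neg (by omega), show k + 1 + x - 1 = k + x by omega]

theorem conv_stringRhs (v : ℕ → ℕ → Multiset ℕ → ℝ) (h k : ℕ) (φ : Multiset ℕ → ℝ)
    (s : Multiset ℕ) : conv (stringRhs v h k) φ s = raise (fun x _ => conv (v h x) φ s) k 0 +
      if h = 0 ∧ k = 0 then removeSum (fun x t => if x = 0 then φ t else 0) s else 0 := by
  have e : stringRhs v h k = fun t => raise (v h) k t + virInit h 0 (k ::ₘ t) := rfl
  rw [e, conv_add_left, conv_raise_left]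
  congr 1
  split_ifs with hk
  · obtain ⟨rfl, rfl⟩ := hk
    exact conv_singleton _ _ (fun t => by simp [virInit_zero_cons]) s
  · have : (fun t => virInit h 0 (k ::ₘ t)) = fun _ => 0 := by
      funext t
      rw [virInit_zero_cons, if_neg (by tauto)]
    rw [this]
    simp [conv]

/-- Both sides live on the tail `{0, 0}` in genus zero, where the factor two counts its two entries.
-/
theorem removeSum_virInit (g : ℕ) (s : Multiset ℕ) :
    2 * virInit g 0 s = removeSum (fun x t => (2 * x + 1) * virInit g 0 (x ::ₘ t)) s := by
  by_cases h : g = 0 ∧ s = 0 ::ₘ 0 ::ₘ 0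
  · obtain ⟨rfl, rfl⟩ := h
    simp [removeSum, virInit]
    norm_num
  · have h0 : virInit g 0 s = 0 := by
      rw [virInit, if_neg (by tauto), if_neg (by omega), add_zero]
    rw [h0, mul_zero]
    refine (Multiset.sum_eq_zero fun y hy => ?_).symm
    obtain ⟨x, hx, rfl⟩ := Multiset.mem_map.1 hy
    change (2 * (x : ℝ) + 1) * virInit g 0 (x ::ₘ s.erase x) = 0
    rw [Multiset.cons_erase hx, h0, mul_zero]

variable (hv : IsVirasoro a v)
include hv

/-- The induction hypothesis covers every splitting except those whose complementary factor has
genus zero and at most two indices, and there that factor vanishes. -/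
theorem conv_stringOp_left {g : ℕ} {s : Multiset ℕ}
    (ih : ∀ g' k' s', 2 * g' + s'.card < 2 * g + s.card →
      stringOp a (v g' k') s' = stringRhs v g' k' s') (h : ℕ × ℕ) (hh : h.1 + h.2 = g) (j k : ℕ) :
    conv (stringOp a (v h.1 j)) (v h.2 k) s = conv (stringRhs v h.1 j) (v h.2 k) s := by
  refine conv_congr fun t₁ t₂ ht => ?_
  have hc : t₁.card + t₂.card = s.card := by rw [← ht, Multiset.card_add]
  by_cases hs : 2 * h.1 + t₁.card < 2 * g + s.card
  · rw [ih _ _ _ hs]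
  · have h2 : h.2 = 0 := by omega
    rw [h2, hv.zero_of_card_le_one k t₂ (by omega)]
    simp

/-- Each new index contributes its raised version. The last three terms come from the unit initial
value in genus zero: once through the lower-genus term, and once through each factor of the
convolution. -/
theorem stringOp_virSplit {g : ℕ} {s : Multiset ℕ}
    (ih : ∀ g' k' s', 2 * g' + s'.card < 2 * g + s.card →
      stringOp a (v g' k') s' = stringRhs v g' k' s') (p : ℕ × ℕ) :
    stringOp a (virSplit v g p) s =
      raise (fun x _ => virSplit v g (x, p.2) s) p.1 0 +
      raise (fun x _ => virSplit v g (p.1, x) s) p.2 0 +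
      (if g = 1 ∧ p.1 = 0 ∧ p.2 = 0 ∧ s = 0 then 1 else 0) +
      (if p.1 = 0 then removeSum (fun x t => if x = 0 then v g p.2 t else 0) s else 0) +
      (if p.2 = 0 then removeSum (fun x t => if x = 0 then v g p.1 t else 0) s else 0) := by
  have e : virSplit v g p = fun t => (if 1 ≤ g then v (g - 1) p.1 (p.2 ::ₘ t) else 0) +
      ∑ h ∈ antidiagonal g, conv (v h.1 p.1) (v h.2 p.2) t := rfl
  have hlow : stringOp a (fun t => if 1 ≤ g then v (g - 1) p.1 (p.2 ::ₘ t) else 0) s =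
      raise (fun x _ => if 1 ≤ g then v (g - 1) x (p.2 ::ₘ s) else 0) p.1 0 +
      raise (fun x _ => if 1 ≤ g then v (g - 1) p.1 (x ::ₘ s) else 0) p.2 0 +
      (if g = 1 ∧ p.1 = 0 ∧ p.2 = 0 ∧ s = 0 then 1 else 0) := by
    by_cases hg : 1 ≤ g
    · simp only [hg, if_true]
      rw [stringOp_cons, ih _ _ _ (by simp only [Multiset.card_cons]; omega), stringRhs,
        virInit_zero_cons, raise_eq_apply, raise_eq_apply (fun x t => v (g - 1) p.1 (x ::ₘ t))]
      have : (g - 1 = 0 ∧ p.1 = 0 ∧ p.2 ::ₘ s = {0}) ↔ (g = 1 ∧ p.1 = 0 ∧ p.2 = 0 ∧ s = 0) := by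
        have h1 : g - 1 = 0 ↔ g = 1 := by omega
        have h2 : p.2 ::ₘ s = {0} ↔ p.2 = 0 ∧ s = 0 := by
          constructor
          · intro h
            have h3 : p.2 = 0 := by
              have : p.2 ∈ ({0} : Multiset ℕ) := h ▸ Multiset.mem_cons_self _ _
              simpa using this
            rw [h3, ← Multiset.cons_zero, Multiset.cons_inj_right] at h
            exact ⟨h3, h⟩
          · rintro ⟨h3, rfl⟩
            rw [h3]; rfl
        rw [h1, h2]
      simp only [this]
      ring
    · have h1 : g ≠ 1 := by omega
      simp only [hg, if_false, h1, false_and, stringOp_zero]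
      simp [raise_const_zero]
  have hconv : ∀ h ∈ antidiagonal g, stringOp a (conv (v h.1 p.1) (v h.2 p.2)) s =
      raise (fun x _ => conv (v h.1 x) (v h.2 p.2) s) p.1 0 +
      raise (fun x _ => conv (v h.1 p.1) (v h.2 x) s) p.2 0 +
      (if h.1 = 0 ∧ p.1 = 0 then
        removeSum (fun x t => if x = 0 then v h.2 p.2 t else 0) s else 0) +
      (if h.2 = 0 ∧ p.2 = 0 then
        removeSum (fun x t => if x = 0 then v h.1 p.1 t else 0) s else 0) := by
    intro h hh
    have hh' := Finset.HasAntidiagonal.mem_antidiagonal.1 hh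
    have hswap := hv.conv_stringOp_left ih (h.2, h.1) ((add_comm _ _).trans hh') p.2 p.1
    rw [stringOp_conv, hv.conv_stringOp_left ih h hh', conv_stringRhs, conv_comm (v h.1 p.1),
      hswap, conv_stringRhs]
    simp only [conv_comm (v h.1 p.1)]
    ring
  have hs1 : ∑ h ∈ antidiagonal g, (if h.1 = 0 ∧ p.1 = 0 then
      removeSum (fun x t => if x = 0 then v h.2 p.2 t else 0) s else 0) =
      if p.1 = 0 then removeSum (fun x t => if x = 0 then v g p.2 t else 0) s else 0 := by
    rw [Finset.sum_eq_single (0, g)]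
    · simp
    · intro h hh hne
      have hh' := Finset.HasAntidiagonal.mem_antidiagonal.1 hh
      rw [if_neg]
      rintro ⟨h0, -⟩
      exact hne (Prod.ext h0 (by simp; omega))
    · intro h; simp at h
  have hs2 : ∑ h ∈ antidiagonal g, (if h.2 = 0 ∧ p.2 = 0 then
      removeSum (fun x t => if x = 0 then v h.1 p.1 t else 0) s else 0) =
      if p.2 = 0 then removeSum (fun x t => if x = 0 then v g p.1 t else 0) s else 0 := by
    rw [Finset.sum_eq_single (g, 0)]
    · simp
    · intro h hh hne
      have hh' := Finset.HasAntidiagonal.mem_antidiagonal.1 hh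
      rw [if_neg]
      rintro ⟨h0, -⟩
      exact hne (Prod.ext (by simp; omega) h0)
    · intro h; simp at h
  rw [e, stringOp_add, hlow, stringOp_sum, Finset.sum_congr rfl hconv, Finset.sum_add_distrib,
    Finset.sum_add_distrib, Finset.sum_add_distrib, hs1, hs2, raise_sum, raise_sum]
  have r1 : raise (fun x _ => virSplit v g (x, p.2) s) p.1 0 =
      raise (fun x _ => if 1 ≤ g then v (g - 1) x (p.2 ::ₘ s) else 0) p.1 0 +
      raise (fun x _ => ∑ h ∈ antidiagonal g, conv (v h.1 x) (v h.2 p.2) s) p.1 0 :=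
    raise_add (fun x _ => if 1 ≤ g then v (g - 1) x (p.2 ::ₘ s) else 0) _ _ _
  have r2 : raise (fun x _ => virSplit v g (p.1, x) s) p.2 0 =
      raise (fun x _ => if 1 ≤ g then v (g - 1) p.1 (x ::ₘ s) else 0) p.2 0 +
      raise (fun x _ => ∑ h ∈ antidiagonal g, conv (v h.1 p.1) (v h.2 x) s) p.2 0 :=
    raise_add (fun x _ => if 1 ≤ g then v (g - 1) p.1 (x ::ₘ s) else 0) _ _ _
  rw [r1, r2]
  ring

/-- The quadratic part of the commutator relation: the string operator sends the quadratic part for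
one head index to a multiple of that for the preceding one. The final `removeSum` is the
contribution of merging with a zero entry that the linear part lacks, and it cancels in `string_eq`.
-/
theorem stringOp_virQuad {g : ℕ} {s : Multiset ℕ}
    (ih : ∀ g' k' s', 2 * g' + s'.card < 2 * g + s.card →
      stringOp a (v g' k') s' = stringRhs v g' k' s') (k : ℕ) :
    stringOp a (virQuad v g (k + 2)) s =
      (2 * k + 4) * (virQuad v g (k + 1) s + virInit g (k + 1) s) +
        removeSum (fun x t => if x = 0 then v g k t else 0) s := by
  have e : virQuad v g (k + 2) = fun t => 1 / 2 * ∑ p ∈ antidiagonal k, virSplit v g p t := rfl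
  rw [e, stringOp_mul, stringOp_sum, Finset.sum_congr rfl fun p _ => hv.stringOp_virSplit ih p,
    Finset.sum_add_distrib, Finset.sum_add_distrib, Finset.sum_add_distrib]
  have h1 : ∑ p ∈ antidiagonal k,
      (if p.1 = 0 then removeSum (fun x t => if x = 0 then v g p.2 t else 0) s else 0) =
      removeSum (fun x t => if x = 0 then v g k t else 0) s := by
    rw [Finset.sum_eq_single (0, k)]
    · simp
    · intro h hh hne
      have hh' := Finset.HasAntidiagonal.mem_antidiagonal.1 hh
      rw [if_neg]
      intro h0
      exact hne (Prod.ext h0 (by simp; omega))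
    · intro h; simp at h
  have h2 : ∑ p ∈ antidiagonal k,
      (if p.2 = 0 then removeSum (fun x t => if x = 0 then v g p.1 t else 0) s else 0) =
      removeSum (fun x t => if x = 0 then v g k t else 0) s := by
    rw [Finset.sum_eq_single (k, 0)]
    · simp
    · intro h hh hne
      have hh' := Finset.HasAntidiagonal.mem_antidiagonal.1 hh
      rw [if_neg]
      intro h0
      exact hne (Prod.ext (by simp; omega) h0)
    · intro h; simp at h
  rw [h1, h2]
  cases k with
  | zero =>
    -- The value `1/8` is forced here: four times it equals half of the unit initial value in genus
    -- zero.
    have h4 : virInit g (0 + 1) s = if g = 1 ∧ s = 0 then 1 / 8 else 0 := by simp [virInit]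
    rw [h4]
    simp only [Finset.Nat.antidiagonal_zero, Finset.sum_singleton, raise, virQuad, true_and]
    split_ifs <;> push_cast <;> ring
  | succ k =>
    rw [virInit_add_two, sum_raise_antidiagonal (fun x y => virSplit v g (x, y) s)]
    have h3 : ∑ p ∈ antidiagonal (k + 1),
        (if g = 1 ∧ p.1 = 0 ∧ p.2 = 0 ∧ s = 0 then (1 : ℝ) else 0) = 0 := by
      refine Finset.sum_eq_zero fun p hp => if_neg ?_
      have hp' := Finset.HasAntidiagonal.mem_antidiagonal.1 hp
      omega
    rw [h3, virQuad]
    push_cast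
    ring

/-- By induction on `2g + card s`, the commutator of the string operator with the recursion shows
that the defect for head index `k` is `a` times the defect for `k+1`. Iterating, the defect is `a^j`
times one with head index `k+j`, which vanishes for dimensional reasons once `j` is large. -/
theorem string_eq (g k : ℕ) (s : Multiset ℕ) : stringOp a (v g k) s = stringRhs v g k s := by
  induction hn : 2 * g + s.card using Nat.strong_induction_on generalizing g k s with
  | _ n IH =>
  subst hn
  have ih : ∀ g' k' s', 2 * g' + s'.card < 2 * g + s.card →
      stringOp a (v g' k') s' = stringRhs v g' k' s' := fun g' k' s' h => IH _ h g' k' s' rfl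
  have ihr : ∀ x ∈ s, ∀ k', stringOp a (v g k') (s.erase x) = stringRhs v g k' (s.erase x) := by
    intro x hx k'
    refine ih _ _ _ ?_
    have := Multiset.card_erase_lt_of_mem hx
    omega
  have hrec : ∀ k, v g k = fun t =>
      a * v g (k + 1) t + removeSum (virMerge v g k) t + virQuad v g k t + virInit g k t :=
    fun k => funext fun t => hv.rec_eq g k t
  have step : ∀ k, stringOp a (v g k) s - stringRhs v g k s =
      a * (stringOp a (v g (k + 1)) s - stringRhs v g (k + 1) s) := by
    intro k
    have h1 : stringOp a (v g k) s = a * stringOp a (v g (k + 1)) s +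
        stringOp a (removeSum (virMerge v g k)) s + stringOp a (virQuad v g k) s +
        stringOp a (virInit g k) s := by
      conv_lhs => rw [hrec k]
      rw [stringOp_add, stringOp_add, stringOp_add, stringOp_mul]
    rw [h1, stringOp_removeSum]
    rcases k with _ | k
    · have e2 : removeSum (fun x => stringOp a (virMerge v g 0 x)) s =
          removeSum (raise (raise (v g))) s + lowerSum (virInit g 0) s := by
        rw [lowerSum, ← removeSum_add]
        refine removeSum_congr fun x hx => ?_
        rw [virMerge_zero]
        cases x with
        | zero => exact (stringOp_zero a _).trans (by simp [raise])
        | succ x =>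
          have e : raise (v g) (x + 1) = fun t => (2 * x + 3) * v g x t := rfl
          rw [e, stringOp_mul, ihr _ hx, stringRhs, mul_add]
          rfl
      have e3 : virQuad v g 0 = fun _ => 0 := rfl
      have e4 : virInit g 0 (1 ::ₘ s) = 0 := by rw [virInit_zero_cons]; simp
      rw [e2, e3, stringOp_zero, virMerge_zero, stringRhs, stringRhs]
      simp only [stringOp, raise, zero_add, e4]
      norm_num
      ring
    · have e2 : removeSum (fun x => stringOp a (virMerge v g (k + 1) x)) s =
          removeSum (raise (virMerge v g (k + 1))) s +
            (2 * k + 2) * removeSum (virMerge v g k) s +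
            (if k = 0 then 2 * virInit g 0 s else
              -removeSum (fun x t => if x = 0 then v g (k - 1) t else 0) s) := by
        have hm : ∀ x, virMerge v g (k + 1) x = fun t => (2 * x + 1) * v g (k + x) t :=
          fun x => funext fun t => virMerge_succ v g k x t
        cases k with
        | zero =>
          rw [if_pos rfl, removeSum_virInit, ← removeSum_mul, ← removeSum_add, ← removeSum_add]
          refine removeSum_congr fun x hx => ?_
          rw [hm, stringOp_mul, ihr _ hx, stringRhs, virMerge_zero, zero_add]
          cases x with
          | zero => simp [raise]
          | succ x =>
            simp only [raise, virMerge_succ, zero_add]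
            push_cast
            ring
        | succ j =>
          rw [if_neg (by omega), ← neg_one_mul, ← removeSum_mul, ← removeSum_mul,
            ← removeSum_add, ← removeSum_add]
          refine removeSum_congr fun x hx => ?_
          rw [hm, stringOp_mul, ihr _ hx, stringRhs, virMerge_succ,
            show j + 1 + x = (j + x) + 1 by ring, virInit_zero_cons, if_neg (by omega)]
          cases x with
          | zero => simp [raise]; ring
          | succ x =>
            rw [if_neg (by omega)]
            simp only [raise, virMerge_succ]
            rw [show j + 1 + x = j + (x + 1) by ring]
            push_cast
            ring
      have e3 : stringOp a (virQuad v g (k + 1)) s = (2 * k + 2) * virQuad v g k s +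
          (if k = 0 then 0 else (2 * k + 2) * virInit g k s +
            removeSum (fun x t => if x = 0 then v g (k - 1) t else 0) s) := by
        cases k with
        | zero => exact (stringOp_zero a s).trans (by simp [virQuad])
        | succ k =>
          rw [hv.stringOp_virQuad ih]
          simp
          ring
      have e4 : stringOp a (virInit g (k + 1)) s = 0 := by
        have hz : ∀ x t, virInit g (k + 1) (x ::ₘ t) = 0 := by intro x t; simp [virInit]
        simp [stringOp, hz, lowerSum, removeSum_raise_zero]
      have e6 := hv.rec_eq g k s
      have e7 : ∀ j t, virInit g 0 ((j + 1) ::ₘ t) = 0 := by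
        intro j t; rw [virInit_zero_cons]; simp
      rw [e2, e3, e4, stringRhs, stringRhs, e7, e7, virMerge_succ, virMerge_succ]
      simp only [raise, Nat.cast_add, Nat.cast_one, Nat.cast_zero, add_zero]
      have e8 : (if k = 0 then 2 * virInit g 0 s else
              -removeSum (fun x t => if x = 0 then v g (k - 1) t else 0) s) +
          (if k = 0 then 0 else (2 * k + 2) * virInit g k s +
            removeSum (fun x t => if x = 0 then v g (k - 1) t else 0) s) =
          (2 * k + 2) * virInit g k s := by
        split_ifs with hk
        · subst hk; simp
        · ring
      -- The commutator has reproduced `2k+2` times the right-hand side of the recursion for head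
      -- index `k`, so that recursion is used a second time.
      linear_combination (-(2 * (k : ℝ) + 2)) * e6 + e8
  have hzero : ∀ j, stringOp a (v g k) s - stringRhs v g k s =
      a ^ j * (stringOp a (v g (k + j)) s - stringRhs v g (k + j) s) := by
    intro j
    induction j with
    | zero => simp
    | succ j ihj => rw [ihj, step (k + j), pow_succ, add_assoc]; ring
  have hbig := hzero (3 * g + s.card + 2)
  have hl : ∀ j, 3 * g + s.card + 2 ≤ j → stringOp a (v g j) s = 0 := by
    intro j hj
    have h2 : lowerSum (v g j) s = removeSum (fun _ _ => 0) s := by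
      refine removeSum_congr fun x hx => ?_
      cases x with
      | zero => rfl
      | succ x =>
        simp only [raise]
        rw [hv.vanish, mul_zero]
        have h3 := Multiset.card_erase_add_one hx
        simp only [Multiset.card_cons, Multiset.sum_cons]
        omega
    rw [stringOp, hv.vanish _ _ _ (by simp only [Multiset.card_cons, Multiset.sum_cons]; omega),
      hv.vanish _ _ _ (by simp only [Multiset.card_cons, Multiset.sum_cons]; omega), h2]
    simp [removeSum]
  have hr : stringRhs v g (k + (3 * g + s.card + 2)) s = 0 := by
    rw [stringRhs, virInit_zero_cons, if_neg (by omega),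
      show k + (3 * g + s.card + 2) = (k + (3 * g + s.card + 1)) + 1 by ring, raise,
      hv.vanish _ _ _ (by omega)]
    simp
  rw [hr, hl (k + (3 * g + s.card + 2)) (by omega), sub_zero, mul_zero] at hbig
  exact sub_eq_zero.1 hbig

end IsVirasoro

end

end TopRec

namespace TopRec

noncomputable section

open Finset.HasAntidiagonal (antidiagonal)

/-! ### Numerical estimates -/

/-- The weight `(j+2)(j+1)²(2j)!` entering the genus recursion of the constants. -/
def genusWeight (j : ℕ) : ℝ := (j + 2) * (j + 1) ^ 2 * ((2 * j).factorial : ℝ)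

theorem genusWeight_pos (j : ℕ) : 0 < genusWeight j := by
  unfold genusWeight
  positivity

/-- The ratio is written so that each of its factors visibly increases with `j`. -/
theorem genusWeight_succ (j : ℕ) :
    genusWeight (j + 1) = genusWeight j * (2 * (j + 3) * (j + 2) * (2 - 1 / (j + 1))) := by
  unfold genusWeight
  have h : (2 * (j + 1)).factorial = (2 * j + 2) * ((2 * j + 1) * (2 * j).factorial) := by
    rw [show 2 * (j + 1) = (2 * j + 1) + 1 by ring, Nat.factorial_succ, Nat.factorial_succ]
  rw [h]
  have : (j : ℝ) + 1 ≠ 0 := by positivity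
  push_cast
  field_simp
  ring

/-- Log-convexity: since consecutive ratios increase, moving weight from one factor to the other can
only enlarge the product. The constant is the value of the weight at `1`. -/
theorem genusWeight_mul_le (i j : ℕ) :
    genusWeight (i + 1) * genusWeight (j + 1) ≤ 24 * genusWeight (i + j + 1) := by
  induction i with
  | zero =>
    have : genusWeight (0 + 1) = 24 := by norm_num [genusWeight, Nat.factorial]
    rw [this, zero_add]
  | succ i ih =>
    rw [genusWeight_succ (i + 1), show i + 1 + j + 1 = (i + j + 1) + 1 by ring,
      genusWeight_succ (i + j + 1)]
    have h0 : (2 : ℝ) - 1 / ((i + 1 : ℕ) + 1) ≤ 2 - 1 / ((i + j + 1 : ℕ) + 1) := by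
      push_cast
      gcongr
      linarith [Nat.cast_nonneg (α := ℝ) j]
    have h1 : (0 : ℝ) ≤ 2 - 1 / ((i + 1 : ℕ) + 1) := by
      have : (1 : ℝ) / ((i + 1 : ℕ) + 1) ≤ 1 := by
        rw [div_le_one (by positivity)]
        push_cast
        linarith [Nat.cast_nonneg (α := ℝ) i]
      linarith
    have hr : (2 * ((i + 1 : ℕ) + 3) * ((i + 1 : ℕ) + 2) * (2 - 1 / ((i + 1 : ℕ) + 1)) : ℝ) ≤
        2 * ((i + j + 1 : ℕ) + 3) * ((i + j + 1 : ℕ) + 2) * (2 - 1 / ((i + j + 1 : ℕ) + 1)) := by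
      have hij : ((i + 1 : ℕ) : ℝ) ≤ ((i + j + 1 : ℕ) : ℝ) := by
        exact_mod_cast (by omega : i + 1 ≤ i + j + 1)
      gcongr
    have hp := genusWeight_pos (i + j + 1)
    calc _ = genusWeight (i + 1) * genusWeight (j + 1) *
          (2 * ((i + 1 : ℕ) + 3) * ((i + 1 : ℕ) + 2) * (2 - 1 / ((i + 1 : ℕ) + 1))) := by ring
      _ ≤ 24 * genusWeight (i + j + 1) *
          (2 * ((i + j + 1 : ℕ) + 3) * ((i + j + 1 : ℕ) + 2) *
            (2 - 1 / ((i + j + 1 : ℕ) + 1))) := by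
          gcongr
      _ = _ := by ring

/-- The constant `24` is exactly what closes `genusConst_rec`. In an antidiagonal of length at least
four, measured in units of the largest weight, the two end terms contribute `4` and all interior
terms together at most `20`. -/
theorem sum_genusWeight_le (m : ℕ) :
    ∑ p ∈ antidiagonal m, genusWeight p.1 * genusWeight p.2 ≤
      24 * (m + 2) ^ 2 * ((2 * m + 1).factorial : ℝ) := by
  have h0 : genusWeight 0 = 2 := by norm_num [genusWeight]
  have hmain : ∀ m : ℕ, 24 * genusWeight m ≤ 24 * (m + 2) ^ 2 * ((2 * m + 1).factorial : ℝ) := by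
    intro m
    rw [Nat.factorial_succ, genusWeight]
    have : (0 : ℝ) < ((2 * m).factorial : ℝ) := by positivity
    push_cast
    have h2 : ((m : ℝ) + 2) * (m + 1) ^ 2 ≤ (m + 2) ^ 2 * (2 * m + 1) := by
      nlinarith [Nat.cast_nonneg (α := ℝ) m, sq_nonneg (m : ℝ)]
    nlinarith
  rcases m with _ | _ | m
  · norm_num [h0]
  · have h1 : genusWeight 1 = 24 := by norm_num [genusWeight, Nat.factorial]
    rw [Finset.Nat.antidiagonal_succ]
    norm_num [h0, h1, Nat.factorial]
  · refine le_trans ?_ (hmain (m + 2))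
    rw [Finset.Nat.sum_antidiagonal_succ, Finset.Nat.sum_antidiagonal_succ']
    have hs : ∑ p ∈ antidiagonal m, genusWeight (p.1 + 1) * genusWeight (p.2 + 1) ≤
        (m + 1) * (24 * genusWeight (m + 1)) := by
      have : ∀ p ∈ antidiagonal m, genusWeight (p.1 + 1) * genusWeight (p.2 + 1) ≤
          24 * genusWeight (m + 1) := by
        intro p hp
        have := genusWeight_mul_le p.1 p.2
        rwa [Finset.HasAntidiagonal.mem_antidiagonal.1 hp] at this
      refine (Finset.sum_le_card_nsmul _ _ _ this).trans ?_
      simp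
    have hg : (m + 1) * (24 * genusWeight (m + 1)) ≤ 20 * genusWeight (m + 2) := by
      rw [genusWeight_succ (m + 1)]
      have hp := genusWeight_pos (m + 1)
      have h1 : (1 : ℝ) / ((m + 1 : ℕ) + 1) ≤ 1 := by
        rw [div_le_one (by positivity)]
        push_cast
        linarith [Nat.cast_nonneg (α := ℝ) m]
      have h2 : (24 * (m + 1) : ℝ) ≤
          20 * (2 * ((m + 1 : ℕ) + 3) * ((m + 1 : ℕ) + 2) * (2 - 1 / ((m + 1 : ℕ) + 1))) := by
        have h3 : (2 * ((m + 1 : ℕ) + 3) * ((m + 1 : ℕ) + 2) * 1 : ℝ) ≤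
          2 * ((m + 1 : ℕ) + 3) * ((m + 1 : ℕ) + 2) * (2 - 1 / ((m + 1 : ℕ) + 1)) := by
          gcongr
          linarith
        refine le_trans ?_ (mul_le_mul_of_nonneg_left h3 (by norm_num))
        push_cast
        nlinarith [Nat.cast_nonneg (α := ℝ) m, sq_nonneg (m : ℝ)]
      nlinarith
    rw [h0]
    linarith

/-- A Beta integral: `a! b!/(a+b+1)! = ∫₀¹ x^a (1-x)^b dx`, and the binomial sum inserts `(x +
(1-x))^ℓ = 1`. The induction is Pascal's rule. -/
theorem sum_choose_factorial (ℓ e₁ e₂ : ℕ) :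
    ∑ L ∈ antidiagonal ℓ, (ℓ.choose L.1 : ℝ) * (((e₁ + L.1).factorial : ℝ) *
      ((e₂ + L.2).factorial : ℝ)) * ((e₁ + e₂ + 1).factorial : ℝ) =
      (e₁.factorial : ℝ) * e₂.factorial * ((e₁ + e₂ + ℓ + 1).factorial : ℝ) := by
  induction ℓ generalizing e₁ e₂ with
  | zero => simp
  | succ ℓ ih =>
    have h1 := ih e₁ (e₂ + 1)
    have h2 := ih (e₁ + 1) e₂
    rw [← Finset.sum_mul] at h1 h2 ⊢
    rw [Finset.sum_antidiagonal_choose_succ_mul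
      (fun i j => ((e₁ + i).factorial : ℝ) * ((e₂ + j).factorial : ℝ))]
    simp only [show ∀ i, e₂ + 1 + i = e₂ + (i + 1) by intro i; ring,
      show ∀ i, e₁ + 1 + i = e₁ + (i + 1) by intro i; ring] at h1 h2
    rw [show e₁ + (e₂ + 1) + 1 = (e₁ + e₂ + 1) + 1 by ring, Nat.factorial_succ (e₁ + e₂ + 1),
      Nat.factorial_succ e₂, show e₁ + (e₂ + 1) + ℓ + 1 = e₁ + e₂ + (ℓ + 1) + 1 by ring] at h1
    rw [show e₁ + (e₂ + 1) + 1 = (e₁ + e₂ + 1) + 1 by ring, Nat.factorial_succ (e₁ + e₂ + 1),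
      Nat.factorial_succ e₁, show e₁ + (e₂ + 1) + ℓ + 1 = e₁ + e₂ + (ℓ + 1) + 1 by ring] at h2
    push_cast at h1 h2
    have hne : ((e₁ : ℝ) + e₂ + 1 + 1) ≠ 0 := by positivity
    have hd : (∑ x ∈ antidiagonal ℓ, (ℓ.choose x.1 : ℝ) *
        (((e₁ + x.1).factorial : ℝ) * ((e₂ + (x.2 + 1)).factorial : ℝ)) +
        ∑ x ∈ antidiagonal ℓ, (ℓ.choose x.2 : ℝ) *
        (((e₁ + (x.1 + 1)).factorial : ℝ) * ((e₂ + x.2).factorial : ℝ))) *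
        ((e₁ + e₂ + 1).factorial : ℝ) * ((e₁ : ℝ) + e₂ + 1 + 1) =
        (e₁.factorial : ℝ) * e₂.factorial * ((e₁ + e₂ + (ℓ + 1) + 1).factorial : ℝ) *
          ((e₁ : ℝ) + e₂ + 1 + 1) := by
      have hc : ∑ x ∈ antidiagonal ℓ, (ℓ.choose x.2 : ℝ) *
        (((e₁ + (x.1 + 1)).factorial : ℝ) * ((e₂ + x.2).factorial : ℝ)) =
        ∑ x ∈ antidiagonal ℓ, (ℓ.choose x.1 : ℝ) *
        (((e₁ + (x.1 + 1)).factorial : ℝ) * ((e₂ + x.2).factorial : ℝ)) := by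
        refine Finset.sum_congr rfl fun x hx => ?_
        rw [← Finset.HasAntidiagonal.mem_antidiagonal.1 hx, Nat.choose_symm_add]
      rw [hc]
      linear_combination h1 + h2
    exact mul_right_cancel₀ hne hd

theorem sum_div_factorial (ℓ e₁ e₂ : ℕ) :
    ∑ L ∈ antidiagonal ℓ, ((e₁ + L.1).factorial : ℝ) * ((e₂ + L.2).factorial : ℝ) /
      ((L.1.factorial : ℝ) * L.2.factorial) =
      (e₁.factorial : ℝ) * e₂.factorial * ((e₁ + e₂ + ℓ + 1).factorial : ℝ) /
        (((e₁ + e₂ + 1).factorial : ℝ) * ℓ.factorial) := by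
  rw [eq_div_iff (by positivity), ← sum_choose_factorial, Finset.sum_mul]
  refine Finset.sum_congr rfl fun L hL => ?_
  have hL' := Finset.HasAntidiagonal.mem_antidiagonal.1 hL
  have h : (ℓ.choose L.1 : ℝ) * (L.1.factorial * L.2.factorial) = ℓ.factorial := by
    rw [← hL', ← mul_assoc, Nat.choose_symm_add]
    exact_mod_cast Nat.add_choose_mul_factorial_mul_factorial L.1 L.2
  rw [← h]
  have h1 : (L.1.factorial : ℝ) ≠ 0 := by positivity
  have h2 : (L.2.factorial : ℝ) ≠ 0 := by positivity
  field_simp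

/-- Every entry of `s` raises one of the two exponents by one, so distributing the entries again
inserts factors `x + (1-x) = 1` in the Beta integral. -/
theorem sum_antidiagonal_factorial (s : Multiset ℕ) (ℓ e₁ e₂ : ℕ) :
    (s.antidiagonal.map fun t => ∑ L ∈ antidiagonal ℓ,
      ((e₁ + t.1.card + L.1).factorial : ℝ) * ((e₂ + t.2.card + L.2).factorial : ℝ) /
      ((L.1.factorial : ℝ) * L.2.factorial)).sum =
      (e₁.factorial : ℝ) * e₂.factorial * ((e₁ + e₂ + s.card + ℓ + 1).factorial : ℝ) /
        (((e₁ + e₂ + 1).factorial : ℝ) * ℓ.factorial) := by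
  induction s using Multiset.induction generalizing e₁ e₂ with
  | empty => simp [sum_div_factorial]
  | cons y s ih =>
    rw [Multiset.antidiagonal_cons, Multiset.map_add, Multiset.sum_add, Multiset.map_map,
      Multiset.map_map]
    have h1 := ih e₁ (e₂ + 1)
    have h2 := ih (e₁ + 1) e₂
    simp only [Function.comp_apply, Prod.map_fst, Prod.map_snd, id_eq, Multiset.card_cons]
    simp only [show ∀ i, e₂ + 1 + i = e₂ + (i + 1) by intro i; ring] at h1
    simp only [show ∀ i, e₁ + 1 + i = e₁ + (i + 1) by intro i; ring] at h2
    rw [h1, h2, show e₁ + (e₂ + 1) + 1 = (e₁ + e₂ + 1) + 1 by ring,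
      Nat.factorial_succ (e₁ + e₂ + 1),
      Nat.factorial_succ e₂, Nat.factorial_succ e₁,
      show e₁ + (e₂ + 1) + s.card + ℓ + 1 = e₁ + e₂ + (s.card + 1) + ℓ + 1 by ring]
    push_cast
    field_simp
    ring

end

end TopRec

namespace TopRec

noncomputable section

open Finset.HasAntidiagonal (antidiagonal)

namespace IsVirasoro

/-! ### Upper bounds for solutions of the Virasoro recursion -/

variable {a : ℝ} {v : ℕ → ℕ → Multiset ℕ → ℝ}

theorem virInit_nonneg (g k : ℕ) (s : Multiset ℕ) : 0 ≤ virInit g k s := by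
  unfold virInit
  positivity

theorem nonneg (hv : IsVirasoro a v) (ha : 0 ≤ a) (g k : ℕ) (s : Multiset ℕ) : 0 ≤ v g k s := by
  induction hn : 2 * g + s.card using Nat.strong_induction_on generalizing g k s with
  | _ n IH =>
  subst hn
  have ih : ∀ g' k' s', 2 * g' + s'.card < 2 * g + s.card → 0 ≤ v g' k' s' :=
    fun g' k' s' h => IH _ h g' k' s' rfl
  -- The recursion also calls the amplitude with the same `g` and `s` and the next head index, so an
  -- inner induction descends from the range where the amplitudes vanish.
  have key : ∀ j k, 3 * g + s.card + 2 ≤ k + j → 0 ≤ v g k s := by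
    intro j
    induction j with
    | zero => intro k hk; rw [hv.vanish _ _ _ (by omega)]
    | succ j ihj =>
      intro k hk
      rw [hv.rec_eq]
      have h1 : 0 ≤ a * v g (k + 1) s := mul_nonneg ha (ihj _ (by omega))
      have h2 : 0 ≤ removeSum (virMerge v g k) s := by
        refine removeSum_nonneg fun x hx => ?_
        unfold virMerge
        split_ifs
        · exact le_rfl
        · have := Multiset.card_erase_lt_of_mem hx
          exact mul_nonneg (by positivity) (ih _ _ _ (by omega))
      have h3 : 0 ≤ virQuad v g k s := by
        rcases k with _ | _ | k
        · exact le_rfl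
        · exact le_rfl
        · refine mul_nonneg (by norm_num) (Finset.sum_nonneg fun p _ => ?_)
          refine add_nonneg ?_ (Finset.sum_nonneg fun h hh => conv_nonneg fun t₁ t₂ ht => ?_)
          · split_ifs
            · exact ih _ _ _ (by simp only [Multiset.card_cons]; omega)
            · exact le_rfl
          · have hh' := Finset.HasAntidiagonal.mem_antidiagonal.1 hh
            have hc : t₁.card + t₂.card = s.card := by rw [← ht, Multiset.card_add]
            by_cases h1 : h.1 = 0 ∧ t₁.card ≤ 1
            · rw [h1.1, hv.zero_of_card_le_one _ _ h1.2, zero_mul]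
            · by_cases h2 : h.2 = 0 ∧ t₂.card ≤ 1
              · rw [h2.1, hv.zero_of_card_le_one _ _ h2.2, mul_zero]
              · exact mul_nonneg (ih _ _ _ (by omega)) (ih _ _ _ (by omega))
      have h4 := virInit_nonneg g k s
      positivity
  exact key _ k le_add_self

/-- A zero in first position makes the recursion itself the string equation; a zero in the tail
calls for `string_eq`. As symmetry under exchange of the head with a tail entry is not known, the
hypotheses range over every choice of head in the multisets concerned. -/
theorem string_le (hv : IsVirasoro a v) (ha : 0 ≤ a) {g k : ℕ} {s : Multiset ℕ}
    (h0 : 0 ∈ k ::ₘ s) (hi : k = 0 → virInit g 0 s = 0) :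
    ∃ r, k ::ₘ s = 0 ::ₘ r ∧ ∀ (A : ℝ) (W : ℕ → ℝ),
      (∀ k' s', k' ::ₘ s' = 1 ::ₘ r → v g k' s' ≤ A) →
      (∀ x ∈ r, x ≠ 0 → ∀ k' s', k' ::ₘ s' = (x - 1) ::ₘ r.erase x → v g k' s' ≤ W x) →
      v g k s ≤ a * A + (r.map fun x => if x = 0 then 0 else (2 * x + 1) * W x).sum := by
  by_cases hk : k = 0
  · subst hk
    refine ⟨s, rfl, fun A W hA hW => ?_⟩
    rw [hv.rec_eq, hi rfl, virMerge_zero]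
    have h1 := mul_le_mul_of_nonneg_left (hA 1 s rfl) ha
    have h2 : removeSum (raise (v g)) s ≤
        (s.map fun x => if x = 0 then 0 else (2 * x + 1) * W x).sum := by
      refine removeSum_le fun x hx => ?_
      cases x with
      | zero => simp [raise]
      | succ x =>
        rw [if_neg (by omega), raise]
        have := hW (x + 1) hx (by omega) x _ rfl
        push_cast
        nlinarith [Nat.cast_nonneg (α := ℝ) x]
    simp only [virQuad, zero_add]
    linarith
  · have hs : 0 ∈ s := by
      rcases Multiset.mem_cons.1 h0 with h | h
      · exact absurd h.symm hk
      · exact h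
    obtain ⟨s', rfl⟩ := Multiset.exists_cons_of_mem hs
    refine ⟨k ::ₘ s', Multiset.cons_swap _ _ _, fun A W hA hW => ?_⟩
    have hstr := hv.string_eq g k s'
    rw [stringOp, stringRhs, virInit_zero_cons, if_neg (by tauto)] at hstr
    have h1 := mul_le_mul_of_nonneg_left (hA k (1 ::ₘ s') (Multiset.cons_swap _ _ _)) ha
    have h2 : lowerSum (v g k) s' ≤
        (s'.map fun x => if x = 0 then 0 else (2 * x + 1) * W x).sum := by
      refine removeSum_le fun x hx => ?_
      cases x with
      | zero => simp [raise]
      | succ x =>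
        rw [if_neg (by omega), raise]
        have := hW (x + 1) (Multiset.mem_cons_of_mem hx) (by omega) k (x ::ₘ s'.erase (x + 1))
          (by rw [Multiset.erase_cons_tail_of_mem hx]; exact Multiset.cons_swap _ _ _)
        push_cast
        nlinarith [Nat.cast_nonneg (α := ℝ) x]
    have h3 : raise (v g) k s' ≤ if k = 0 then 0 else (2 * k + 1) * W k := by
      cases k with
      | zero => simp [raise]
      | succ k =>
        rw [if_neg (by omega), raise]
        have := hW (k + 1) (Multiset.mem_cons_self _ _) (by omega) k s'
          (by rw [Multiset.erase_cons_head]; rfl)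
        push_cast
        nlinarith [Nat.cast_nonneg (α := ℝ) k]
    rw [Multiset.map_cons, Multiset.sum_cons]
    linarith

/-- Here `o` counts the ones, `m` the entries at least two, and `X` is the sum of the latter. Ones
are kept apart because lowering a one creates a new zero, which changes the bound. -/
theorem multiset_profile (r : Multiset ℕ) : ∃ o m X : ℕ, r.card = r.count 0 + o + m ∧
    r.sum = o + X ∧ 2 * m ≤ X ∧ (m = 0 → X = 0) ∧ ∀ W₁ W₂ : ℝ,
      (r.map fun x : ℕ => if x = 0 then 0 else (2 * (x : ℝ) + 1) * if x = 1 then W₁ else W₂).sum =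
        3 * o * W₁ + (2 * X + m) * W₂ := by
  induction r using Multiset.induction with
  | empty => exact ⟨0, 0, 0, by simp⟩
  | cons x r ih =>
    obtain ⟨o, m, X, h1, h2, h3, h4, h5⟩ := ih
    rcases x with _ | _ | x
    · refine ⟨o, m, X, ?_, ?_, h3, h4, fun W₁ W₂ => ?_⟩
      · simp; omega
      · simp [h2]
      · rw [Multiset.map_cons, Multiset.sum_cons, h5]; simp
    · refine ⟨o + 1, m, X, ?_, ?_, h3, h4, fun W₁ W₂ => ?_⟩
      · simp; omega
      · simp [h2]; omega
      · rw [Multiset.map_cons, Multiset.sum_cons, h5]; simp; ring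
    · refine ⟨o, m + 1, X + (x + 2), ?_, ?_, by omega, by omega, fun W₁ W₂ => ?_⟩
      · simp; omega
      · simp [h2]; omega
      · rw [Multiset.map_cons, Multiset.sum_cons, h5]; simp; ring

/-- The genus dependence of the stable bound. -/
def genusConst (g : ℕ) : ℝ := 1 / 54 * (9 / 4) ^ g * (g : ℝ) ^ 3

/-- The correction of the stable bound in the presence of `z` vanishing indices. -/
def zeroFactor (g z : ℕ) : ℝ := (1 + 1 / (g : ℝ)) ^ min z 2

/-- The bound for an amplitude of genus `g ≥ 1` with `n + 1` indices, `z` of which vanish, whose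
sum is `ℓ` below the dimension. -/
def stableBound (q : ℝ) (g z n ℓ : ℕ) : ℝ :=
  genusConst g * zeroFactor g z *
    (3 ^ (n + 1) * (q ^ ℓ / (ℓ.factorial : ℝ)) * ((2 * g - 2 + n + ℓ).factorial : ℝ))

theorem genusConst_nonneg (g : ℕ) : 0 ≤ genusConst g := by unfold genusConst; positivity

theorem zeroFactor_pos (g z : ℕ) : 0 < zeroFactor g z := by unfold zeroFactor; positivity

theorem zeroFactor_zero (g : ℕ) : zeroFactor g 0 = 1 := by simp [zeroFactor]

theorem zeroFactor_mono (g : ℕ) {z z' : ℕ} (h : z ≤ z') : zeroFactor g z ≤ zeroFactor g z' := by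
  unfold zeroFactor
  refine pow_le_pow_right₀ ?_ (by omega)
  have : (0 : ℝ) ≤ 1 / g := by positivity
  linarith

theorem stableBound_nonneg {q : ℝ} (hq : 0 ≤ q) (g z n ℓ : ℕ) : 0 ≤ stableBound q g z n ℓ := by
  have := genusConst_nonneg g
  have := (zeroFactor_pos g z).le
  unfold stableBound
  positivity

/-- The arithmetic behind the string equation step of the stable bound. -/
theorem stable_string_arith {g z o m X ℓ K : ℕ} (hg : 1 ≤ g) (hX : 2 * m ≤ X) (hm : m = 0 → X = 0)
    (hdim : o + X + ℓ + 2 = 3 * g + (z + o + m)) (hK : 2 * g + (z + o + m) + ℓ = K + 3) :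
    5 * ℓ * zeroFactor g z + (3 * o * zeroFactor g (z + 1) + (2 * X + m) * zeroFactor g z) ≤
      3 * (K + 1) * zeroFactor g (z + 1) := by
  have e1 : ((o : ℝ) + X + ℓ + 2) = 3 * g + (z + o + m) := by exact_mod_cast hdim
  have e2 : (2 * (g : ℝ) + (z + o + m) + ℓ) = K + 3 := by exact_mod_cast hK
  have hgr : (1 : ℝ) ≤ g := by exact_mod_cast hg
  -- By the dimension constraint the right-hand side equals `6g + 2z - 4 + 3(m+ℓ)`, and `m = ℓ = 0`
  -- is impossible for `g ≥ 1`.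
  have hQ : 6 * (g : ℝ) - 1 + 2 * z ≤ 2 * X + m + 5 * ℓ := by
    have : 1 ≤ m + ℓ := by omega
    have : (1 : ℝ) ≤ m + ℓ := by exact_mod_cast this
    linarith
  -- The deficit `2 - z` is why an extra factor `1 + 1/g` is needed for each of the first two zeros
  -- and for no later one.
  have hid : 3 * (K + 1 : ℝ) = 3 * o + (2 * X + m + 5 * ℓ) - 2 + z := by linarith
  have hw := zeroFactor_pos g z
  rcases Nat.lt_or_ge z 2 with hz | hz
  · have hzf : zeroFactor g (z + 1) = zeroFactor g z * (1 + 1 / g) := by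
      unfold zeroFactor
      rw [show min (z + 1) 2 = min z 2 + 1 by omega, pow_succ]
    rw [hzf, hid]
    set Q : ℝ := 2 * X + m + 5 * ℓ with hQdef
    have hmain : Q ≤ (Q - 2 + z) * (1 + 1 / (g : ℝ)) := by
      have hz' : z = 0 ∨ z = 1 := by omega
      have hg0 : (0 : ℝ) < g := by linarith
      have : (Q - 2 + z) * (1 + 1 / (g : ℝ)) - Q = ((z - 2) * g + (Q - 2 + z)) / g := by
        field_simp
        ring
      have h2 : 0 ≤ ((z - 2 : ℝ) * g + (Q - 2 + z)) / g := by
        refine div_nonneg ?_ hg0.le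
        rcases hz' with rfl | rfl
        · push_cast at hQ ⊢; linarith
        · push_cast at hQ ⊢; linarith
      linarith
    have h3 := mul_le_mul_of_nonneg_left hmain hw.le
    rw [hQdef] at h3 ⊢
    linarith
  · have hzf : zeroFactor g (z + 1) = zeroFactor g z := by
      unfold zeroFactor
      rw [show min (z + 1) 2 = min z 2 by omega]
    rw [hzf, hid]
    have hz2 : (2 : ℝ) ≤ z := by exact_mod_cast hz
    nlinarith

theorem stableBound_lower_entry (q : ℝ) {g n ℓ K : ℕ} (z : ℕ) (hg : 1 ≤ g)
    (hK : 2 * g + n + ℓ + 1 = K + 3) : stableBound q g z n ℓ =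
    zeroFactor g z * (genusConst g * 3 ^ (n + 1) * (q ^ ℓ / (ℓ.factorial : ℝ)) *
      (K.factorial : ℝ)) := by
  rw [stableBound, show 2 * g - 2 + n + ℓ = K by omega]
  ring

theorem stableBound_shift (q : ℝ) {g n ℓ K : ℕ} (z : ℕ) (hg : 1 ≤ g)
    (hK : 2 * g + n + (ℓ + 1) = K + 3) : 5 * q / 3 * stableBound q g z n ℓ =
    5 * (ℓ + 1 : ℕ) * zeroFactor g z * (genusConst g * 3 ^ n *
      (q ^ (ℓ + 1) / ((ℓ + 1).factorial : ℝ)) * (K.factorial : ℝ)) := by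
  rw [stableBound, show 2 * g - 2 + n + ℓ = K by omega, Nat.factorial_succ]
  have : (ℓ.factorial : ℝ) ≠ 0 := by positivity
  push_cast
  field_simp
  ring

theorem stableBound_top (q : ℝ) {g n ℓ K : ℕ} (z : ℕ) (hg : 1 ≤ g)
    (hK : 2 * g + n + ℓ = K + 3) : stableBound q g z n ℓ =
    3 * (K + 1) * zeroFactor g z * (genusConst g * 3 ^ n * (q ^ ℓ / (ℓ.factorial : ℝ)) *
      (K.factorial : ℝ)) := by
  rw [stableBound, show 2 * g - 2 + n + ℓ = K + 1 by omega, Nat.factorial_succ]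
  push_cast
  ring

/-- The stable bound as an induction hypothesis below the measure `M`. -/
def StableBelow (q : ℝ) (v : ℕ → ℕ → Multiset ℕ → ℝ) (M : ℕ) : Prop :=
  ∀ g k s ℓ, 2 * g + s.card + ℓ < M → 1 ≤ g → k + s.sum + ℓ + 2 = 3 * g + s.card →
    v g k s ≤ stableBound q g ((k ::ₘ s).count 0) s.card ℓ

/-- All terms of the string equation are expressed in the common unit `U`, which leaves the
inequality `stable_string_arith`. -/
theorem stable_string_step {q : ℝ} (hq : 0 ≤ q) (hv : IsVirasoro (5 * q / 3) v)
    {g k ℓ : ℕ} {s : Multiset ℕ} (ih : StableBelow q v (2 * g + s.card + ℓ)) (hg : 1 ≤ g)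
    (hdim : k + s.sum + ℓ + 2 = 3 * g + s.card) (h0 : 0 ∈ k ::ₘ s) :
    v g k s ≤ stableBound q g ((k ::ₘ s).count 0) s.card ℓ := by
  obtain ⟨r, hr, hle⟩ := hv.string_le (g := g) (k := k) (s := s) (by positivity) h0
    fun _ => by simp [virInit, show g ≠ 0 by omega]
  obtain ⟨o, m, X, h1, h2, h3, h4, h5⟩ := multiset_profile r
  have hcard : s.card = r.card := by
    simpa using congrArg Multiset.card hr
  have hsum : k + s.sum = r.sum := by
    simpa using congrArg Multiset.sum hr
  have hcount : (k ::ₘ s).count 0 = r.count 0 + 1 := by rw [hr, Multiset.count_cons_self]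
  obtain ⟨K, hK⟩ : ∃ K, 2 * g + s.card + ℓ = K + 3 := by
    refine ⟨2 * g + s.card + ℓ - 3, ?_⟩
    omega
  set z := r.count 0 with hz
  set U : ℝ := genusConst g * 3 ^ s.card * (q ^ ℓ / (ℓ.factorial : ℝ)) * (K.factorial : ℝ) with hU
  have hU0 : 0 ≤ U := by
    have := genusConst_nonneg g
    positivity
  have hmain := hle (if ℓ = 0 then 0 else stableBound q g z s.card (ℓ - 1))
    (fun x => (if x = 1 then zeroFactor g (z + 1) else zeroFactor g z) * U) ?_ ?_
  · have hA : 5 * q / 3 * (if ℓ = 0 then 0 else stableBound q g z s.card (ℓ - 1)) =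
        5 * ℓ * zeroFactor g z * U := by
      cases ℓ with
      | zero => simp
      | succ ℓ =>
        rw [if_neg (by omega), Nat.add_sub_cancel, stableBound_shift q z hg hK]
    have hsumW : (r.map fun x : ℕ => if x = 0 then 0 else (2 * (x : ℝ) + 1) *
        ((if x = 1 then zeroFactor g (z + 1) else zeroFactor g z) * U)).sum =
        (3 * o * zeroFactor g (z + 1) + (2 * X + m) * zeroFactor g z) * U := by
      rw [← h5, ← Multiset.sum_map_mul_right]
      congr 1
      refine Multiset.map_congr rfl fun x _ => ?_
      split_ifs <;> ring
    rw [hA, hsumW] at hmain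
    rw [hcount, stableBound_top q (z + 1) hg hK]
    refine hmain.trans ?_
    rw [← add_mul]
    refine mul_le_mul_of_nonneg_right ?_ hU0
    exact stable_string_arith hg h3 h4 (by omega) (by omega)
  · intro k' s' h
    have hc : s'.card = r.card := by simpa using congrArg Multiset.card h
    have hs : k' + s'.sum = 1 + r.sum := by simpa using congrArg Multiset.sum h
    split_ifs with hl
    · rw [hv.vanish _ _ _ (by omega)]
    · have := ih g k' s' (ℓ - 1) (by omega) hg (by omega)
      rwa [h, Multiset.count_cons_of_ne (by norm_num), hc, ← hcard] at this
  · intro x hx hx0 k' s' h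
    have hc := congrArg Multiset.card h
    have hs := congrArg Multiset.sum h
    have hce := Multiset.card_erase_add_one hx
    have hse := Multiset.sum_erase hx
    simp only [Multiset.card_cons, Multiset.sum_cons] at hc hs
    have := ih g k' s' ℓ (by omega) hg (by omega)
    rw [h, stableBound_lower_entry q (K := K) _ hg (by omega), show s'.card + 1 = s.card by omega]
      at this
    by_cases hx1 : x = 1
    · subst hx1
      rw [if_pos rfl]
      rwa [Multiset.count_cons_self, Multiset.count_erase_of_ne (by norm_num)] at this
    · rw [if_neg hx1]
      rwa [Multiset.count_cons_of_ne (by omega), Multiset.count_erase_of_ne (by omega)] at this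

end IsVirasoro

end

end TopRec

/-! ### The quadratic part and the bound in positive genus -/

namespace TopRec

noncomputable section

open Finset.HasAntidiagonal (antidiagonal)

namespace IsVirasoro

variable {v : ℕ → ℕ → Multiset ℕ → ℝ}

/-- The first term gives `c_g (g-1)/g`, and the convolution gives at most `c_g/g` by
`sum_genusWeight_le`, so the two add up to `c_g`. The factor `9/4` is `1/2` from the recursion,
times `3²` from the two extra indices, divided by the `2` in the weight `2(k+1)` of `virQuad_le`. -/
theorem genusConst_rec {g : ℕ} (hg : 2 ≤ g) :
    9 / 4 * (genusConst (g - 1) * zeroFactor (g - 1) 2 +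
      ∑ h ∈ antidiagonal g, if 1 ≤ h.1 ∧ 1 ≤ h.2 then
        genusConst h.1 * zeroFactor h.1 1 * (genusConst h.2 * zeroFactor h.2 1) *
        (((2 * h.1 - 2).factorial : ℝ) * (2 * h.2 - 2).factorial / (2 * g - 3).factorial) else 0) ≤
      genusConst g := by
  obtain ⟨m, rfl⟩ : ∃ m, g = m + 2 := ⟨g - 2, by omega⟩
  have h1 : genusConst (m + 2 - 1) * zeroFactor (m + 2 - 1) 2 =
      1 / 54 * (9 / 4) ^ (m + 1) * ((m + 1) * (m + 2) ^ 2) := by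
    unfold genusConst zeroFactor
    have : ((m : ℝ) + 1) ≠ 0 := by positivity
    simp only [show m + 2 - 1 = m + 1 by omega, min_self]
    push_cast
    field_simp
    ring
  have h2 : ∑ h ∈ antidiagonal (m + 2), (if 1 ≤ h.1 ∧ 1 ≤ h.2 then
        genusConst h.1 * zeroFactor h.1 1 * (genusConst h.2 * zeroFactor h.2 1) *
        (((2 * h.1 - 2).factorial : ℝ) * (2 * h.2 - 2).factorial /
          (2 * (m + 2) - 3).factorial) else 0) =
      (1 / 54) ^ 2 * (9 / 4) ^ (m + 2) / (2 * m + 1).factorial *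
        ∑ p ∈ antidiagonal m, genusWeight p.1 * genusWeight p.2 := by
    rw [Finset.Nat.sum_antidiagonal_succ, Finset.Nat.sum_antidiagonal_succ', Finset.mul_sum]
    rw [if_neg (by omega), if_neg (by omega), zero_add, zero_add]
    refine Finset.sum_congr rfl fun p hp => ?_
    have hp' := Finset.HasAntidiagonal.mem_antidiagonal.1 hp
    rw [if_pos (by omega), show 2 * (p.1 + 1) - 2 = 2 * p.1 by omega,
      show 2 * (p.2 + 1) - 2 = 2 * p.2 by omega, show 2 * (m + 2) - 3 = 2 * m + 1 by omega,
      ← hp', show p.1 + p.2 + 2 = (p.1 + 1) + (p.2 + 1) by ring, pow_add]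
    unfold genusConst zeroFactor genusWeight
    have e1 : ((p.1 : ℝ) + 1) ≠ 0 := by positivity
    have e2 : ((p.2 : ℝ) + 1) ≠ 0 := by positivity
    simp only [show min 1 2 = 1 by norm_num, pow_one]
    push_cast
    field_simp
    ring
  rw [h1, h2]
  have h3 := sum_genusWeight_le m
  have hf : (0 : ℝ) < (2 * m + 1).factorial := by positivity
  have h4 : (1 / 54 : ℝ) ^ 2 * (9 / 4) ^ (m + 2) / (2 * m + 1).factorial *
        ∑ p ∈ antidiagonal m, genusWeight p.1 * genusWeight p.2 ≤
      (1 / 54 : ℝ) ^ 2 * (9 / 4) ^ (m + 2) * (24 * (m + 2) ^ 2) := by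
    calc _ ≤ (1 / 54 : ℝ) ^ 2 * (9 / 4) ^ (m + 2) / (2 * m + 1).factorial *
        (24 * (m + 2) ^ 2 * ((2 * m + 1).factorial : ℝ)) := by gcongr
      _ = _ := by field_simp
  calc _ ≤ 9 / 4 * (1 / 54 * (9 / 4) ^ (m + 1) * ((m + 1) * (m + 2) ^ 2) +
        (1 / 54 : ℝ) ^ 2 * (9 / 4) ^ (m + 2) * (24 * (m + 2) ^ 2)) := by gcongr
    _ = 1 / 54 * (9 / 4) ^ (m + 2) * (m + 2) ^ 2 * (m + 2) := by ring
    _ = _ := by unfold genusConst; push_cast; ring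

/-- In genus zero the index sum is at most the number of indices minus three, which forces two zeros
in the tail. Hence genus zero drops out of the quadratic part when the tail has no zero. -/
theorem genus_zero_of_zero_notMem {a : ℝ} (hv : IsVirasoro a v) (k : ℕ) {s : Multiset ℕ}
    (h0 : s.count 0 ≤ 1) : v 0 k s = 0 := by
  obtain ⟨o, m, X, h1, h2, h3, h4, h5⟩ := multiset_profile s
  exact hv.vanish _ _ _ (by omega)

theorem sum_conv_le {q a : ℝ} (hq : 0 ≤ q) (ha : 0 ≤ a) (hv : IsVirasoro a v)
    {g k ℓ : ℕ} {s : Multiset ℕ} (ih : StableBelow q v (2 * g + s.card + ℓ))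
    (hdim : k + 2 + s.sum + ℓ + 2 = 3 * g + s.card) (h0 : s.count 0 = 0)
    {h : ℕ × ℕ} (hh : h.1 + h.2 = g) (h1 : 1 ≤ h.1) (h2 : 1 ≤ h.2) :
    ∑ p ∈ antidiagonal k, conv (v h.1 p.1) (v h.2 p.2) s ≤
      genusConst h.1 * zeroFactor h.1 1 * (genusConst h.2 * zeroFactor h.2 1) *
        (((2 * h.1 - 2).factorial : ℝ) * (2 * h.2 - 2).factorial / (2 * g - 3).factorial) *
        (9 * 3 ^ s.card * (q ^ ℓ / ℓ.factorial) * (2 * g + s.card + ℓ - 3).factorial) := by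
  set c : ℝ := genusConst h.1 * zeroFactor h.1 1 * (genusConst h.2 * zeroFactor h.2 1) *
    (9 * 3 ^ s.card * q ^ ℓ) with hc
  have hc0 : 0 ≤ c := by
    have := genusConst_nonneg h.1
    have := genusConst_nonneg h.2
    have := (zeroFactor_pos h.1 1).le
    have := (zeroFactor_pos h.2 1).le
    positivity
  have key : ∀ t ∈ s.antidiagonal, ∑ p ∈ antidiagonal k, v h.1 p.1 t.1 * v h.2 p.2 t.2 ≤
      c * ∑ L ∈ antidiagonal ℓ, ((2 * h.1 - 2 + t.1.card + L.1).factorial : ℝ) *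
        ((2 * h.2 - 2 + t.2.card + L.2).factorial : ℝ) /
        ((L.1.factorial : ℝ) * L.2.factorial) := by
    intro t ht
    have ht' := Multiset.mem_antidiagonal.1 ht
    have hcard : t.1.card + t.2.card = s.card := by rw [← ht', Multiset.card_add]
    have hsum : t.1.sum + t.2.sum = s.sum := by rw [← ht', Multiset.sum_add]
    have hcnt : t.1.count 0 + t.2.count 0 = 0 := by rw [← Multiset.count_add, ht', h0]
    let P : Finset (ℕ × ℕ) := (antidiagonal k).filter fun p =>
      p.1 + t.1.sum + 2 ≤ 3 * h.1 + t.1.card ∧ p.2 + t.2.sum + 2 ≤ 3 * h.2 + t.2.card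
    -- For a fixed splitting of genus and tail, the new indices are determined by the dimension
    -- deficits of the two factors. These add up to `ℓ`, so the sum over new indices is dominated by
    -- a sum over `antidiagonal ℓ`.
    let f : ℕ × ℕ → ℕ × ℕ := fun p =>
      (3 * h.1 + t.1.card - (p.1 + t.1.sum + 2), 3 * h.2 + t.2.card - (p.2 + t.2.sum + 2))
    let G : ℕ × ℕ → ℝ := fun L => c * (((2 * h.1 - 2 + t.1.card + L.1).factorial : ℝ) *
        ((2 * h.2 - 2 + t.2.card + L.2).factorial : ℝ) / ((L.1.factorial : ℝ) * L.2.factorial))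
    have hsub : ∑ p ∈ antidiagonal k, v h.1 p.1 t.1 * v h.2 p.2 t.2 =
        ∑ p ∈ P, v h.1 p.1 t.1 * v h.2 p.2 t.2 := by
      refine (Finset.sum_subset (Finset.filter_subset _ _) fun p hp hp' => ?_).symm
      rw [Finset.mem_filter, not_and_or] at hp'
      rcases not_and_or.1 (hp'.resolve_left (not_not.2 hp)) with h | h
      · rw [hv.vanish _ _ t.1 (by omega), zero_mul]
      · rw [hv.vanish _ _ t.2 (by omega), mul_zero]
    have hterm : ∀ p ∈ P, v h.1 p.1 t.1 * v h.2 p.2 t.2 ≤ G (f p) := by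
      intro p hp
      obtain ⟨hp1, hp2, hp3⟩ := Finset.mem_filter.1 hp
      have hp1' := Finset.HasAntidiagonal.mem_antidiagonal.1 hp1
      have hb : ∀ (g' k' : ℕ) (t' : Multiset ℕ) (l : ℕ),
          2 * g' + t'.card + l < 2 * g + s.card + ℓ → 1 ≤ g' → t'.count 0 = 0 →
          k' + t'.sum + l + 2 = 3 * g' + t'.card → v g' k' t' ≤ stableBound q g' 1 t'.card l := by
        intro g' k' t' l hl hg' ht0 hd
        refine (ih g' k' t' l hl hg' hd).trans ?_
        unfold stableBound
        have := genusConst_nonneg g'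
        have := zeroFactor_mono g' (z := (k' ::ₘ t').count 0) (z' := 1) (by
          rw [Multiset.count_cons, ht0]; split_ifs <;> omega)
        gcongr
      have b1 := hb h.1 p.1 t.1 (f p).1 (by simp only [f]; omega) h1 (by omega)
        (by simp only [f]; omega)
      have b2 := hb h.2 p.2 t.2 (f p).2 (by simp only [f]; omega) h2 (by omega)
        (by simp only [f]; omega)
      have hl : (f p).1 + (f p).2 = ℓ := by simp only [f]; omega
      refine (mul_le_mul b1 b2 (hv.nonneg ha _ _ _) (stableBound_nonneg hq _ _ _ _)).trans
        (le_of_eq ?_)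
      simp only [G, hc, stableBound]
      rw [← hl, ← hcard]
      field_simp
      ring
    have hinj : Set.InjOn f P := by
      intro p hp p' hp' hpp
      obtain ⟨hp1, hp2, hp3⟩ := Finset.mem_filter.1 (Finset.mem_coe.1 hp)
      obtain ⟨hq1, hq2, hq3⟩ := Finset.mem_filter.1 (Finset.mem_coe.1 hp')
      have e1 := congrArg Prod.fst hpp
      have e2 := congrArg Prod.snd hpp
      simp only [f] at e1 e2
      exact Prod.ext (by omega) (by omega)
    rw [hsub, Finset.mul_sum]
    calc ∑ p ∈ P, v h.1 p.1 t.1 * v h.2 p.2 t.2 ≤ ∑ p ∈ P, G (f p) := Finset.sum_le_sum hterm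
      _ = ∑ L ∈ P.image f, G L := (Finset.sum_image hinj).symm
      _ ≤ ∑ L ∈ antidiagonal ℓ, G L := by
        refine Finset.sum_le_sum_of_subset_of_nonneg ?_ fun L _ _ => by
          simp only [G]; positivity
        intro L hL
        obtain ⟨p, hp, rfl⟩ := Finset.mem_image.1 hL
        obtain ⟨hp1, hp2, hp3⟩ := Finset.mem_filter.1 hp
        have hp1' := Finset.HasAntidiagonal.mem_antidiagonal.1 hp1
        rw [Finset.HasAntidiagonal.mem_antidiagonal]
        simp only [f]
        omega
  have hswap : ∑ p ∈ antidiagonal k, conv (v h.1 p.1) (v h.2 p.2) s =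
      (s.antidiagonal.map fun t => ∑ p ∈ antidiagonal k, v h.1 p.1 t.1 * v h.2 p.2 t.2).sum := by
    simp only [conv]
    exact (Multiset.sum_map_sum).symm
  rw [hswap]
  refine (Multiset.sum_map_le_sum_map _ _ key).trans (le_of_eq ?_)
  rw [Multiset.sum_map_mul_left, sum_antidiagonal_factorial,
    show 2 * h.1 - 2 + (2 * h.2 - 2) + s.card + ℓ + 1 = 2 * g + s.card + ℓ - 3 by omega,
    show 2 * h.1 - 2 + (2 * h.2 - 2) + 1 = 2 * g - 3 by omega, hc]
  field_simp

theorem virQuad_le {q a : ℝ} (hq : 0 ≤ q) (ha : 0 ≤ a) (hv : IsVirasoro a v)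
    {g k ℓ : ℕ} {s : Multiset ℕ} (ih : StableBelow q v (2 * g + s.card + ℓ)) (hg : 1 ≤ g)
    (hdim : k + 2 + s.sum + ℓ + 2 = 3 * g + s.card) (h0 : s.count 0 = 0) :
    virQuad v g (k + 2) s ≤ 2 * (k + 1) * (genusConst g * 3 ^ s.card *
      (q ^ ℓ / (ℓ.factorial : ℝ)) * ((2 * g + s.card + ℓ - 3).factorial : ℝ)) := by
  set R : ℝ := 9 * 3 ^ s.card * (q ^ ℓ / ℓ.factorial) * (2 * g + s.card + ℓ - 3).factorial with hR
  have hR0 : 0 ≤ R := by positivity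
  have hzero : ∀ h ∈ antidiagonal g, ¬(1 ≤ h.1 ∧ 1 ≤ h.2) → ∀ p : ℕ × ℕ,
      conv (v h.1 p.1) (v h.2 p.2) s = 0 := by
    intro h hh hn p
    have : conv (v h.1 p.1) (v h.2 p.2) s = conv (fun _ => 0) (fun _ => 0) s := by
      refine conv_congr fun t₁ t₂ ht => ?_
      have hcnt : t₁.count 0 + t₂.count 0 = 0 := by rw [← Multiset.count_add, ht, h0]
      rcases not_and_or.1 hn with h1 | h1
      · rw [show h.1 = 0 by omega, hv.genus_zero_of_zero_notMem _ (by omega)]; simp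
      · rw [show h.2 = 0 by omega, hv.genus_zero_of_zero_notMem _ (by omega)]; simp
    rw [this]
    simp [conv]
  have hconv : ∑ p ∈ antidiagonal k, ∑ h ∈ antidiagonal g, conv (v h.1 p.1) (v h.2 p.2) s ≤
      (∑ h ∈ antidiagonal g, if 1 ≤ h.1 ∧ 1 ≤ h.2 then
        genusConst h.1 * zeroFactor h.1 1 * (genusConst h.2 * zeroFactor h.2 1) *
        (((2 * h.1 - 2).factorial : ℝ) * (2 * h.2 - 2).factorial /
          (2 * g - 3).factorial) else 0) * R := by
    rw [Finset.sum_comm, Finset.sum_mul]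
    refine Finset.sum_le_sum fun h hh => ?_
    split_ifs with hpos
    · exact hv.sum_conv_le hq ha ih hdim h0 (Finset.HasAntidiagonal.mem_antidiagonal.1 hh)
        hpos.1 hpos.2
    · rw [Finset.sum_eq_zero fun p _ => hzero h hh hpos p, zero_mul]
  rcases Nat.lt_or_ge g 2 with hg2 | hg2
  · have hg1 : g = 1 := by omega
    subst hg1
    have : virQuad v 1 (k + 2) s = 0 := by
      rw [virQuad, Finset.sum_eq_zero, mul_zero]
      intro p hp
      rw [virSplit, if_pos le_rfl, hv.genus_zero_of_zero_notMem _
        (by rw [Multiset.count_cons, h0]; split_ifs <;> omega), zero_add]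
      refine Finset.sum_eq_zero fun h hh => hzero h hh ?_ p
      have := Finset.HasAntidiagonal.mem_antidiagonal.1 hh
      omega
    rw [this]
    have := genusConst_nonneg 1
    positivity
  · have hlow : ∑ p ∈ antidiagonal k, v (g - 1) p.1 (p.2 ::ₘ s) ≤
        (k + 1) * (genusConst (g - 1) * zeroFactor (g - 1) 2 * R) := by
      have : ∀ p ∈ antidiagonal k, v (g - 1) p.1 (p.2 ::ₘ s) ≤
          genusConst (g - 1) * zeroFactor (g - 1) 2 * R := by
        intro p hp
        have hp' := Finset.HasAntidiagonal.mem_antidiagonal.1 hp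
        refine (ih (g - 1) p.1 (p.2 ::ₘ s) ℓ (by simp only [Multiset.card_cons]; omega) (by omega)
          (by simp only [Multiset.card_cons, Multiset.sum_cons]; omega)).trans ?_
        rw [stableBound, Multiset.card_cons,
          show 2 * (g - 1) - 2 + (s.card + 1) + ℓ = 2 * g + s.card + ℓ - 3 by omega]
        have e : (3 : ℝ) ^ (s.card + 1 + 1) * (q ^ ℓ / (ℓ.factorial : ℝ)) *
            ((2 * g + s.card + ℓ - 3).factorial : ℝ) = R := by rw [hR]; ring
        rw [e]
        have h1 := genusConst_nonneg (g - 1)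
        have h2 : zeroFactor (g - 1) ((p.1 ::ₘ p.2 ::ₘ s).count 0) ≤ zeroFactor (g - 1) 2 :=
          zeroFactor_mono _ (by
            rw [Multiset.count_cons, Multiset.count_cons, h0]; split_ifs <;> omega)
        gcongr
      refine (Finset.sum_le_card_nsmul _ _ _ this).trans ?_
      simp
    have hrec := genusConst_rec hg2
    set T : ℝ := ∑ h ∈ antidiagonal g, if 1 ≤ h.1 ∧ 1 ≤ h.2 then
        genusConst h.1 * zeroFactor h.1 1 * (genusConst h.2 * zeroFactor h.2 1) *
        (((2 * h.1 - 2).factorial : ℝ) * (2 * h.2 - 2).factorial /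
          (2 * g - 3).factorial) else 0 with hT
    have hT0 : 0 ≤ T := by
      refine Finset.sum_nonneg fun h _ => ?_
      split_ifs
      · have := genusConst_nonneg h.1
        have := genusConst_nonneg h.2
        have := (zeroFactor_pos h.1 1).le
        have := (zeroFactor_pos h.2 1).le
        positivity
      · exact le_rfl
    have hexp : virQuad v g (k + 2) s = 1 / 2 * (∑ p ∈ antidiagonal k, v (g - 1) p.1 (p.2 ::ₘ s) +
        ∑ p ∈ antidiagonal k, ∑ h ∈ antidiagonal g, conv (v h.1 p.1) (v h.2 p.2) s) := by
      rw [virQuad, ← Finset.sum_add_distrib]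
      refine congrArg _ (Finset.sum_congr rfl fun p _ => ?_)
      rw [virSplit, if_pos hg]
    rw [hexp]
    have hk : (0 : ℝ) ≤ k := Nat.cast_nonneg k
    -- The sum over new indices was already absorbed in the convolution bound, so a factor `k+1` is
    -- given away here to match the lower-genus term.
    have hTk : T * R ≤ (k + 1) * (T * R) := by
      have : 0 ≤ T * R := by positivity
      nlinarith
    calc _ ≤ 1 / 2 * ((k + 1) * (genusConst (g - 1) * zeroFactor (g - 1) 2 * R) +
          (k + 1) * (T * R)) := by linarith
      _ = 2 * (k + 1) * ((9 / 4 * (genusConst (g - 1) * zeroFactor (g - 1) 2 + T)) * (R / 9)) := by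
          ring
      _ ≤ 2 * (k + 1) * (genusConst g * (R / 9)) := by gcongr
      _ = _ := by rw [hR]; ring

theorem le_stableBound {q : ℝ} (hq : 0 ≤ q) (hv : IsVirasoro (5 * q / 3) v) {g k ℓ : ℕ}
    {s : Multiset ℕ} (hg : 1 ≤ g) (hdim : k + s.sum + ℓ + 2 = 3 * g + s.card) :
    v g k s ≤ stableBound q g ((k ::ₘ s).count 0) s.card ℓ := by
  induction hM : 2 * g + s.card + ℓ using Nat.strong_induction_on generalizing g k s ℓ with
  | _ M IH =>
  subst hM
  have ih : StableBelow q v (2 * g + s.card + ℓ) :=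
    fun g' k' s' ℓ' hlt hg' hd => IH _ hlt hg' hd rfl
  by_cases h0 : 0 ∈ k ::ₘ s
  · exact hv.stable_string_step hq ih hg hdim h0
  have hk : k ≠ 0 := fun h => h0 (by rw [h]; exact Multiset.mem_cons_self _ _)
  have hcs : s.count 0 = 0 :=
    Multiset.count_eq_zero.2 fun h => h0 (Multiset.mem_cons_of_mem h)
  rw [Multiset.count_eq_zero.2 h0]
  have hne : ∀ x ∈ s, x ≠ 0 := fun x hx h => h0 (Multiset.mem_cons_of_mem (h ▸ hx))
  -- The base case `F_{1;1}`, where both sides equal `1/8`. It fixes the constant `1/54` in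
  -- `genusConst`.
  by_cases hK0 : 2 * g + s.card + ℓ = 2
  · have hs : s = 0 := Multiset.card_eq_zero.1 (by omega)
    subst hs
    simp only [Multiset.card_zero, Multiset.sum_zero] at hdim hK0
    obtain ⟨rfl, rfl, rfl⟩ : g = 1 ∧ ℓ = 0 ∧ k = 1 := by omega
    rw [hv.rec_eq, hv.vanish _ (1 + 1) _ (by simp)]
    norm_num [virQuad, virInit, stableBound, genusConst, zeroFactor_zero]
  obtain ⟨K, hK⟩ : ∃ K, 2 * g + s.card + ℓ = K + 3 := ⟨2 * g + s.card + ℓ - 3, by omega⟩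
  have hinit : virInit g k s = 0 := by
    rw [virInit, if_neg (by omega), if_neg, add_zero]
    rintro ⟨rfl, rfl, rfl⟩
    simp at hdim hK0
    omega
  set U : ℝ := genusConst g * 3 ^ s.card * (q ^ ℓ / (ℓ.factorial : ℝ)) * (K.factorial : ℝ) with hU
  have hU0 : 0 ≤ U := by
    have := genusConst_nonneg g
    positivity
  have hA : 5 * q / 3 * v g (k + 1) s ≤ 5 * ℓ * U := by
    cases ℓ with
    | zero =>
      rw [hv.vanish _ _ _ (by omega)]
      simp
    | succ l =>
      have := ih g (k + 1) s l (by omega) hg (by omega)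
      rw [Multiset.count_cons_of_ne (by omega), hcs] at this
      have h2 := mul_le_mul_of_nonneg_left this (by positivity : 0 ≤ 5 * q / 3)
      rwa [stableBound_shift q 0 hg hK, zeroFactor_zero, mul_one] at h2
  have hB : removeSum (virMerge v g k) s ≤ (2 * s.sum + s.card) * U := by
    have : removeSum (virMerge v g k) s ≤ (s.map fun x : ℕ => (2 * (x : ℝ) + 1) * U).sum := by
      refine removeSum_le fun x hx => ?_
      have hce := Multiset.card_erase_add_one hx
      have hse := Multiset.sum_erase hx
      have := ih g (k + x - 1) (s.erase x) ℓ (by omega) hg (by omega)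
      rw [Multiset.count_cons_of_ne (by have := hne x hx; omega),
        Multiset.count_eq_zero.2 fun h => hne 0 (Multiset.mem_of_mem_erase h) rfl,
        stableBound_lower_entry q 0 (K := K) hg (by omega), hce, zeroFactor_zero, one_mul] at this
      rw [virMerge, if_neg (by omega)]
      gcongr
    refine this.trans (le_of_eq ?_)
    rw [Multiset.sum_map_mul_right]
    congr 1
    clear * -
    induction s using Multiset.induction with
    | empty => simp
    | cons x s ih => rw [Multiset.map_cons, Multiset.sum_cons, ih]; simp; ring
  rw [hv.rec_eq, hinit, add_zero, stableBound_top q 0 hg hK, zeroFactor_zero]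
  have e1 : ((k : ℝ) + s.sum + ℓ + 2) = 3 * g + s.card := by exact_mod_cast hdim
  have e2 : (2 * (g : ℝ) + s.card + ℓ) = K + 3 := by exact_mod_cast hK
  have hC : virQuad v g k s ≤ 2 * (k - 1) * U := by
    obtain ⟨k, rfl⟩ : ∃ j, k = j + 1 := ⟨k - 1, by omega⟩
    cases k with
    | zero => simp [virQuad]
    | succ k =>
      refine (hv.virQuad_le hq (by positivity) ih hg (by omega) hcs).trans (le_of_eq ?_)
      rw [hU, show 2 * g + s.card + ℓ - 3 = K by omega]
      push_cast
      ring
  -- The exact balance that dictates the shape of the majorant, including the normalisation `a =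
  -- 5q/3`.
  have : 5 * (ℓ : ℝ) + (2 * s.sum + s.card) + 2 * (k - 1) = 3 * (K + 1) := by linarith
  calc _ ≤ 5 * ℓ * U + (2 * s.sum + s.card) * U + 2 * (k - 1) * U := by linarith
    _ = (5 * (ℓ : ℝ) + (2 * s.sum + s.card) + 2 * (k - 1)) * U := by ring
    _ = 3 * (K + 1) * 1 * U := by rw [this]; ring

end IsVirasoro

end

end TopRec

/-! ### Genus zero and a bound uniform in the genus -/

namespace TopRec

noncomputable section

namespace IsVirasoro

variable {v : ℕ → ℕ → Multiset ℕ → ℝ}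

/-- A zero is always present, so only the string equation is used. A factor `5/6` for each zero
suffices: lowering a one gains it, entries at least two satisfy `2X + m ≤ 5X/2`, and `3 · 5/6 =
5/2`. -/
theorem genus_zero_le {q : ℝ} (hq : 0 ≤ q) (hv : IsVirasoro (5 * q / 3) v) {k ℓ : ℕ}
    {s : Multiset ℕ} (hdim : k + s.sum + ℓ + 2 = s.card) :
    v 0 k s ≤ (5 / 6) ^ ((k ::ₘ s).count 0) *
      (3 ^ (s.card + 1) * (q ^ ℓ / (ℓ.factorial : ℝ)) * ((k + s.sum + 2 * ℓ).factorial : ℝ)) := by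
  induction hM : s.card + ℓ using Nat.strong_induction_on generalizing k s ℓ with
  | _ M IH =>
  subst hM
  have ih : ∀ k' s' ℓ' d, s'.card + ℓ' < s.card + ℓ → k' + s'.sum + ℓ' + 2 = s'.card →
      k' + s'.sum + 2 * ℓ' = d → v 0 k' s' ≤ (5 / 6) ^ ((k' ::ₘ s').count 0) *
      (3 ^ (s'.card + 1) * (q ^ ℓ' / (ℓ'.factorial : ℝ)) * (d.factorial : ℝ)) := by
    intro k' s' ℓ' d hlt hd hd'
    subst hd'
    exact IH _ hlt hd rfl
  have h0 : 0 ∈ k ::ₘ s := by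
    by_contra h
    obtain ⟨o, m, X, h1, h2, h3, -⟩ := multiset_profile (k ::ₘ s)
    rw [Multiset.count_eq_zero.2 h, Multiset.card_cons] at h1
    rw [Multiset.sum_cons] at h2
    omega
  by_cases hbase : k + s.sum + 2 * ℓ = 0
  · obtain ⟨x, y, rfl⟩ := Multiset.card_eq_two.1 (show s.card = 2 by omega)
    have hsum : ({x, y} : Multiset ℕ).sum = x + y := by simp
    rw [hsum] at hbase
    obtain ⟨rfl, rfl, rfl, rfl⟩ : k = 0 ∧ x = 0 ∧ y = 0 ∧ ℓ = 0 := by omega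
    rw [hv.rec_eq, hv.vanish 0 (0 + 1) _ (by simp)]
    norm_num [removeSum, virMerge, virQuad, virInit, Multiset.insert_eq_cons]
  obtain ⟨r, hr, hle⟩ := hv.string_le (g := 0) (k := k) (s := s) (by positivity) h0 (by
    rintro rfl
    rw [virInit, if_neg, if_neg (by omega), add_zero]
    rintro ⟨-, -, rfl⟩
    simp at hdim hbase
    omega)
  obtain ⟨o, m, X, h1, h2, h3, h4, h5⟩ := multiset_profile r
  have hcard : s.card = r.card := by simpa using congrArg Multiset.card hr
  have hsum : k + s.sum = r.sum := by simpa using congrArg Multiset.sum hr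
  have hcount : (k ::ₘ s).count 0 = r.count 0 + 1 := by rw [hr, Multiset.count_cons_self]
  obtain ⟨K, hK⟩ : ∃ K, k + s.sum + 2 * ℓ = K + 1 := ⟨k + s.sum + 2 * ℓ - 1, by omega⟩
  set U : ℝ := (5 / 6) ^ (r.count 0) * (3 ^ s.card * (q ^ ℓ / (ℓ.factorial : ℝ)) *
    (K.factorial : ℝ)) with hU
  have hU0 : 0 ≤ U := by positivity
  have hmain := hle (if ℓ = 0 then 0 else (5 / 6) ^ (r.count 0) * (3 ^ (s.card + 1) *
      (q ^ (ℓ - 1) / ((ℓ - 1).factorial : ℝ)) * (K.factorial : ℝ)))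
    (fun x => (if x = 1 then 5 / 6 else 1) * U) ?_ ?_
  · have hA : 5 * q / 3 * (if ℓ = 0 then 0 else (5 / 6) ^ (r.count 0) * (3 ^ (s.card + 1) *
        (q ^ (ℓ - 1) / ((ℓ - 1).factorial : ℝ)) * (K.factorial : ℝ))) = 5 * ℓ * U := by
      cases ℓ with
      | zero => simp
      | succ l =>
        rw [if_neg (by omega), Nat.add_sub_cancel, hU, Nat.factorial_succ]
        have : (l.factorial : ℝ) ≠ 0 := by positivity
        push_cast
        field_simp
        ring
    have hsumW : (r.map fun x : ℕ => if x = 0 then 0 else (2 * (x : ℝ) + 1) *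
        ((if x = 1 then 5 / 6 else 1) * U)).sum = (3 * o * (5 / 6) + (2 * X + m) * 1) * U := by
      rw [← h5, ← Multiset.sum_map_mul_right]
      congr 1
      refine Multiset.map_congr rfl fun x _ => ?_
      split_ifs <;> ring
    rw [hA, hsumW, ← add_mul] at hmain
    have e1 : (o : ℝ) + X + 2 * ℓ = K + 1 := by
      exact_mod_cast (by omega : o + X + 2 * ℓ = K + 1)
    have e2 : 2 * (m : ℝ) ≤ X := by exact_mod_cast h3
    calc v 0 k s ≤ (5 * ℓ + (3 * o * (5 / 6) + (2 * X + m) * 1)) * U := hmain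
      _ ≤ (5 / 2 * (K + 1)) * U := by
        refine mul_le_mul_of_nonneg_right ?_ hU0
        linarith
      _ = _ := by
        rw [hcount, hK, hU, Nat.factorial_succ]
        push_cast
        ring
  · intro k' s' h
    have hc : s'.card = r.card := by simpa using congrArg Multiset.card h
    have hs : k' + s'.sum = 1 + r.sum := by simpa using congrArg Multiset.sum h
    split_ifs with hl
    · rw [hv.vanish _ _ _ (by omega)]
    · have := ih k' s' (ℓ - 1) K (by omega) (by omega) (by omega)
      rwa [h, Multiset.count_cons_of_ne (by norm_num), hc, ← hcard] at this
  · intro x hx hx0 k' s' h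
    have hc := congrArg Multiset.card h
    have hs := congrArg Multiset.sum h
    have hce := Multiset.card_erase_add_one hx
    have hse := Multiset.sum_erase hx
    simp only [Multiset.card_cons, Multiset.sum_cons] at hc hs
    have := ih k' s' ℓ K (by omega) (by omega) (by omega)
    rw [h, show s'.card + 1 = s.card by omega] at this
    by_cases hx1 : x = 1
    · subst hx1
      rw [if_pos rfl]
      rw [Multiset.count_cons_self, Multiset.count_erase_of_ne (by norm_num), pow_succ] at this
      rw [hU]
      linarith
    · rw [if_neg hx1, one_mul]
      rwa [Multiset.count_cons_of_ne (by omega), Multiset.count_erase_of_ne (by omega)] at this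

end IsVirasoro

/-- A lower bound for `binom(3g,g)` with its exact exponential rate `27/4`. The polynomial loss is
harmless because of `exists_quartic_mul_pow_le`. -/
theorem central_factorial_le (g : ℕ) :
    (27 / 4 : ℝ) ^ g * ((2 * g).factorial * g.factorial) ≤ 2 * (g + 1) * (3 * g).factorial := by
  induction g with
  | zero => norm_num
  | succ g ih =>
    rcases g with _ | g
    · norm_num [Nat.factorial]
    · generalize hh : g + 1 = h at ih ⊢
      have hh1 : (1 : ℝ) ≤ h := by exact_mod_cast (by omega : 1 ≤ h)
      have e1 : ((2 * (h + 1)).factorial : ℝ) = (2 * h + 2) * ((2 * h + 1) * (2 * h).factorial) := by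
        rw [show 2 * (h + 1) = (2 * h + 1) + 1 by ring, Nat.factorial_succ, Nat.factorial_succ]
        push_cast; ring
      have e2 : ((3 * (h + 1)).factorial : ℝ) =
          (3 * h + 3) * ((3 * h + 2) * ((3 * h + 1) * (3 * h).factorial)) := by
        rw [show 3 * (h + 1) = (3 * h + 2) + 1 by ring, Nat.factorial_succ, Nat.factorial_succ,
          Nat.factorial_succ]
        push_cast; ring
      have e3 : ((h + 1).factorial : ℝ) = (h + 1) * h.factorial := by
        rw [Nat.factorial_succ]; push_cast; ring
      have key : (27 / 4 : ℝ) * ((2 * h + 2) * (2 * h + 1) * (h + 1)) * (2 * (h + 1)) ≤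
          2 * (h + 2) * ((3 * h + 3) * (3 * h + 2) * (3 * h + 1)) := by
        nlinarith [mul_nonneg (sub_nonneg.2 hh1) (sq_nonneg (h : ℝ)), sq_nonneg (h : ℝ)]
      rw [e1, e2, e3]
      push_cast
      calc (27 / 4 : ℝ) ^ (h + 1) * ((2 * h + 2) * ((2 * h + 1) * (2 * h).factorial) *
            ((h + 1) * h.factorial))
          = (27 / 4 : ℝ) * ((2 * h + 2) * (2 * h + 1) * (h + 1)) *
            ((27 / 4) ^ h * ((2 * h).factorial * h.factorial)) := by ring
        _ ≤ (27 / 4 : ℝ) * ((2 * h + 2) * (2 * h + 1) * (h + 1)) *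
            (2 * (h + 1) * (3 * h).factorial) := by gcongr
        _ = (27 / 4 : ℝ) * ((2 * h + 2) * (2 * h + 1) * (h + 1)) * (2 * (h + 1)) *
            (3 * h).factorial := by ring
        _ ≤ 2 * (h + 2) * ((3 * h + 3) * (3 * h + 2) * (3 * h + 1)) * (3 * h).factorial := by
            gcongr
        _ = _ := by ring

theorem factorial_mul_shift_le (g b j : ℕ) :
    (b + j).factorial * (b + g).factorial ≤ b.factorial * (b + j + g).factorial := by
  induction j with
  | zero => simp
  | succ j ih =>
    rw [show b + (j + 1) = (b + j) + 1 by ring, show b + j + 1 + g = (b + j + g) + 1 by ring,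
      Nat.factorial_succ, Nat.factorial_succ (b + j + g)]
    calc (b + j + 1) * (b + j).factorial * (b + g).factorial
        = (b + j + 1) * ((b + j).factorial * (b + g).factorial) := by ring
      _ ≤ (b + j + g + 1) * (b.factorial * (b + j + g).factorial) :=
        Nat.mul_le_mul (by omega) ih
      _ = _ := by ring

/-- The quotient `M!/(M+g)!` decreases in `M`, so the worst case is `M = 2g-2`, where
`central_factorial_le` applies and `9/4 = (27/4)(1/3)`. -/
theorem genusConst_mul_factorial_le {g M : ℕ} (hg : 1 ≤ g) (hM : 2 * g - 2 ≤ M) :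
    IsVirasoro.genusConst g * (M.factorial : ℝ) ≤
      (g + 1) ^ 4 * ((1 / 3) ^ g / (g.factorial : ℝ)) * ((M + g).factorial : ℝ) := by
  obtain ⟨h, rfl⟩ : ∃ h, g = h + 1 := ⟨g - 1, by omega⟩
  obtain ⟨j, rfl⟩ : ∃ j, M = 2 * h + j := ⟨M - 2 * h, by omega⟩
  have h1 : ((2 * h + j).factorial : ℝ) * ((2 * h + (h + 1)).factorial : ℝ) ≤
      ((2 * h).factorial : ℝ) * ((2 * h + j + (h + 1)).factorial : ℝ) := by
    exact_mod_cast factorial_mul_shift_le (h + 1) (2 * h) j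
  have h2 := central_factorial_le (h + 1)
  have e1 : ((2 * (h + 1)).factorial : ℝ) = (2 * h + 2) * ((2 * h + 1) * (2 * h).factorial) := by
    rw [show 2 * (h + 1) = (2 * h + 1) + 1 by ring, Nat.factorial_succ, Nat.factorial_succ]
    push_cast; ring
  have e2 : ((3 * (h + 1)).factorial : ℝ) =
      (3 * h + 3) * ((3 * h + 2) * ((2 * h + (h + 1)).factorial)) := by
    rw [show 3 * (h + 1) = (2 * h + (h + 1)) + 1 + 1 by ring, Nat.factorial_succ,
      Nat.factorial_succ]
    push_cast; ring
  rw [e1, e2] at h2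
  set F : ℝ := ((2 * h + (h + 1)).factorial : ℝ) with hF
  set A : ℝ := ((2 * h + j).factorial : ℝ)
  set B : ℝ := ((2 * h + j + (h + 1)).factorial : ℝ)
  set D : ℝ := ((2 * h).factorial : ℝ)
  set G : ℝ := ((h + 1).factorial : ℝ)
  have hF0 : 0 < F := by positivity
  have hG0 : 0 < G := by positivity
  have hB0 : 0 < B := by positivity
  have hD0 : 0 < D := by positivity
  have hh0 : (0 : ℝ) ≤ h := Nat.cast_nonneg h
  have h3 : (27 / 4 : ℝ) ^ (h + 1) * (D * G) ≤ 6 * (h + 2) * F := by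
    have hpos : (0 : ℝ) < (2 * h + 2) * (2 * h + 1) := by positivity
    refine le_of_mul_le_mul_left (a := ((2 * h + 2) * (2 * h + 1) : ℝ)) ?_ hpos
    push_cast at h2
    have : (2 * ((h : ℝ) + 1 + 1) * ((3 * h + 3) * ((3 * h + 2) * F))) ≤
        (2 * h + 2) * (2 * h + 1) * (6 * (h + 2) * F) := by
      have : (2 * ((h : ℝ) + 1 + 1) * ((3 * h + 3) * (3 * h + 2))) ≤
        (2 * h + 2) * (2 * h + 1) * (6 * (h + 2)) := by nlinarith [mul_nonneg hh0 hh0]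
      nlinarith
    calc _ = (27 / 4 : ℝ) ^ (h + 1) * ((2 * h + 2) * ((2 * h + 1) * D) * G) := by ring
      _ ≤ _ := h2
      _ ≤ _ := this
  have h4 : A ≤ D * B / F := by rwa [le_div_iff₀ hF0]
  have hpow : (9 / 4 : ℝ) ^ (h + 1) = (27 / 4) ^ (h + 1) * (1 / 3) ^ (h + 1) := by
    rw [← mul_pow]; norm_num
  have h5 : (27 / 4 : ℝ) ^ (h + 1) * (D / F) ≤ 6 * (h + 2) / G := by
    rw [le_div_iff₀ hG0, mul_div_assoc', div_mul_eq_mul_div, div_le_iff₀ hF0]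
    linarith
  have hc : (0 : ℝ) ≤ 1 / 54 * (9 / 4) ^ (h + 1) * ((h + 1 : ℕ) : ℝ) ^ 3 := by positivity
  unfold IsVirasoro.genusConst
  calc _ ≤ 1 / 54 * (9 / 4 : ℝ) ^ (h + 1) * ((h + 1 : ℕ) : ℝ) ^ 3 * (D * B / F) := by gcongr
    _ = 1 / 54 * ((h + 1 : ℕ) : ℝ) ^ 3 * (1 / 3) ^ (h + 1) * B *
        ((27 / 4 : ℝ) ^ (h + 1) * (D / F)) := by rw [hpow]; ring
    _ ≤ 1 / 54 * ((h + 1 : ℕ) : ℝ) ^ 3 * (1 / 3) ^ (h + 1) * B * (6 * (h + 2) / G) := by gcongr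
    _ = (1 / 9 * ((h + 1) ^ 3 * (h + 2))) * ((1 / 3) ^ (h + 1) / G) * B := by push_cast; ring
    _ ≤ _ := by
      gcongr
      push_cast
      have : ((h : ℝ) + 1) ^ 3 ≤ (h + 1 + 1) ^ 3 := by gcongr; linarith
      have h6 : 0 ≤ ((h : ℝ) + 1) ^ 3 := by positivity
      nlinarith

/-- One term of the binomial expansion of `(q + (1-q))^(M+ℓ) = 1`. -/
theorem choose_mul_pow_le {q : ℝ} (h0 : 0 ≤ q) (h1 : q < 1) (M ℓ : ℕ) :
    ((M + ℓ).factorial : ℝ) * (q ^ ℓ / ℓ.factorial) ≤ M.factorial * ((1 - q)⁻¹) ^ M := by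
  have hq : 0 < 1 - q := by linarith
  have h := add_pow q (1 - q) (M + ℓ)
  rw [add_sub_cancel, one_pow] at h
  have hs : q ^ ℓ * (1 - q) ^ M * ((M + ℓ).choose ℓ : ℝ) ≤ 1 := by
    have := Finset.single_le_sum (f := fun m => q ^ m * (1 - q) ^ (M + ℓ - m) *
      ((M + ℓ).choose m : ℝ)) (fun i _ => by positivity)
      (Finset.mem_range.2 (by omega : ℓ < M + ℓ + 1))
    rw [← h] at this
    simpa using this
  have hc : ((M + ℓ).choose ℓ : ℝ) * M.factorial * ℓ.factorial = (M + ℓ).factorial := by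
    have := Nat.add_choose_mul_factorial_mul_factorial M ℓ
    exact_mod_cast this
  rw [inv_pow, ← div_eq_mul_inv, le_div_iff₀ (by positivity), ← hc]
  have hl : (ℓ.factorial : ℝ) ≠ 0 := by positivity
  calc _ = (M.factorial : ℝ) * (q ^ ℓ * (1 - q) ^ M * ((M + ℓ).choose ℓ : ℝ)) := by
        field_simp
    _ ≤ (M.factorial : ℝ) * 1 := by gcongr
    _ = _ := mul_one _

theorem exists_quartic_mul_pow_le {r : ℝ} (h0 : 0 < r) (h1 : r < 1) :
    ∃ K : ℝ, 0 ≤ K ∧ ∀ g : ℕ, ((g : ℝ) + 1) ^ 4 * r ^ g ≤ K := by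
  have ht := tendsto_pow_const_mul_const_pow_of_abs_lt_one 4
    (show |r| < 1 by rwa [abs_of_pos h0])
  obtain ⟨K, hK⟩ := ht.bddAbove_range
  have hb : ∀ g : ℕ, ((g : ℝ) + 1) ^ 4 * r ^ g ≤ K / r := by
    intro g
    have := hK ⟨g + 1, rfl⟩
    rw [le_div_iff₀ h0]
    refine le_of_eq_of_le ?_ this
    push_cast
    ring
  exact ⟨K / r, le_trans (by positivity) (hb 0), hb⟩

/-- Caps the parameter at `1/2`, so that `choose_mul_pow_le` applies to every `q`; the excess `2q`
is charged to all `N` powers. -/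
theorem pow_le_max_pow_mul {q : ℝ} (hq : 0 < q) {N ℓ : ℕ} (h : ℓ ≤ N) :
    q ^ ℓ ≤ max (2 * q) 1 ^ N * min q (1 / 2) ^ ℓ := by
  calc q ^ ℓ = max (2 * q) 1 ^ ℓ * min q (1 / 2) ^ ℓ := by
        rw [← mul_pow]
        congr 1
        rcases le_total q (1 / 2) with h | h
        · rw [max_eq_right (by linarith), min_eq_left h, one_mul]
        · rw [max_eq_left (by linarith), min_eq_right h]
          ring
    _ ≤ _ := by
        gcongr
        exact le_max_right _ _

/-- The growth of the amplitudes, compared with a reference parameter `q'`. -/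
theorem IsVirasoro.exists_bound {q' : ℝ} (hq' : 0 < q') : ∃ S : ℝ, 0 < S ∧
    ∀ (q : ℝ) (v : ℕ → ℕ → Multiset ℕ → ℝ), 0 < q → IsVirasoro (5 * q / 3) v →
    ∀ g k s ℓ, k + s.sum + ℓ + 2 = 3 * g + s.card →
    v g k s ≤ S * (q / q') ^ ℓ *
      (3 * (max (2 * q') 1 / (1 - min q' (1 / 2)))) ^ (k + s.sum + ℓ) * (1 / 81) ^ g *
      (((k + s.sum + ℓ).factorial : ℝ) / (g.factorial : ℝ)) := by
  set r := min q' (1 / 2) with hr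
  set L := max (2 * q') 1 with hL
  have hr0 : 0 < r := lt_min hq' (by norm_num)
  have hr1 : r ≤ 1 / 2 := min_le_right _ _
  have hr2 : 0 < 1 - r := by linarith
  have hL0 : 0 < L := lt_max_of_lt_right one_pos
  obtain ⟨K, hK0, hK⟩ := exists_quartic_mul_pow_le hr2 (by linarith)
  -- The `27` comes from `3ⁿ = 27 · 3^N` in genus zero; `108` is `27` times the bound `4` on
  -- `zeroFactor`.
  refine ⟨108 * K + 27, by positivity, fun q v hq hv g k s ℓ hdim => ?_⟩
  obtain ⟨N, hN⟩ : ∃ N, N = k + s.sum + ℓ := ⟨_, rfl⟩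
  rw [← hN]
  have hR : 0 < (q / q') ^ ℓ := by positivity
  have hqR : q ^ ℓ ≤ (q / q') ^ ℓ * (L ^ N * r ^ ℓ) := by
    calc q ^ ℓ = (q / q') ^ ℓ * q' ^ ℓ := by rw [← mul_pow, div_mul_cancel₀ _ hq'.ne']
      _ ≤ _ := by
        gcongr
        exact pow_le_max_pow_mul hq' (by omega)
  generalize (q / q') ^ ℓ = R at hR hqR ⊢
  rcases Nat.eq_zero_or_pos g with rfl | hg
  · have h := hv.genus_zero_le hq.le (show k + s.sum + ℓ + 2 = s.card by omega)
    rw [show k + s.sum + 2 * ℓ = N + ℓ by omega, show s.card + 1 = N + 3 by omega] at h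
    calc v 0 k s ≤ _ := h
      _ ≤ 1 * (3 ^ (N + 3) * (R * (L ^ N * r ^ ℓ) / (ℓ.factorial : ℝ)) * ((N + ℓ).factorial : ℝ)) := by
        gcongr
        exact pow_le_one₀ (by norm_num) (by norm_num)
      _ = 27 * R * (3 * L) ^ N * (((N + ℓ).factorial : ℝ) * (r ^ ℓ / ℓ.factorial)) := by
        rw [mul_pow]; ring
      _ ≤ 27 * R * (3 * L) ^ N * (N.factorial * ((1 - r)⁻¹) ^ N) := by
        exact mul_le_mul_of_nonneg_left (choose_mul_pow_le hr0.le (by linarith) _ _)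
          (by positivity)
      _ = 27 * (R * (3 * (L / (1 - r))) ^ N * N.factorial) := by
        rw [mul_pow 3 (L / (1 - r)), div_pow, mul_pow, inv_pow]; ring
      _ ≤ (108 * K + 27) * (R * (3 * (L / (1 - r))) ^ N * N.factorial) := by
        gcongr
        linarith
      _ = _ := by norm_num; ring
  · have h := hv.le_stableBound hq.le hg hdim
    obtain ⟨M, hM⟩ : ∃ M, M = 2 * g - 2 + s.card := ⟨_, rfl⟩
    have hMN : M + g = N := by omega
    have h3 : (3 : ℝ) ^ (s.card + 1) = 27 * 3 ^ N * (1 / 27) ^ g := by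
      have : s.card + 1 + 3 * g = N + 3 := by omega
      have : (3 : ℝ) ^ (s.card + 1) * 27 ^ g = 27 * 3 ^ N := by
        rw [show (27 : ℝ) = 3 ^ 3 by norm_num, ← pow_mul, ← pow_add, this]; ring
      rw [← this, mul_assoc, ← mul_pow]
      norm_num
    have hz : IsVirasoro.zeroFactor g ((k ::ₘ s).count 0) ≤ 4 := by
      have h1 : (1 : ℝ) ≤ g := by exact_mod_cast hg
      have h2 : 1 / (g : ℝ) ≤ 1 := by rw [div_le_one (by linarith)]; exact h1
      have h3 : 0 ≤ 1 / (g : ℝ) := by positivity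
      calc (1 + 1 / (g : ℝ)) ^ (min ((k ::ₘ s).count 0) 2) ≤ (1 + 1 / (g : ℝ)) ^ 2 :=
            pow_le_pow_right₀ (by linarith) (min_le_right _ _)
        _ ≤ 2 ^ 2 := by gcongr; linarith
        _ = 4 := by norm_num
    have hgc := IsVirasoro.genusConst_nonneg g
    -- Passing from `M` to `N = M + g` frees the factor `(1-r)^g` that absorbs `(g+1)^4`.
    have hpow : ((1 - r)⁻¹) ^ M = ((1 - r)⁻¹) ^ N * (1 - r) ^ g := by
      rw [← hMN, pow_add, mul_assoc, ← mul_pow, inv_mul_cancel₀ hr2.ne', one_pow, mul_one]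
    have hgf := genusConst_mul_factorial_le hg (show 2 * g - 2 ≤ M by omega)
    rw [hMN] at hgf
    have h4 : ((M + ℓ).factorial : ℝ) * (r ^ ℓ / ℓ.factorial) ≤
        M.factorial * ((1 - r)⁻¹) ^ M := choose_mul_pow_le hr0.le (by linarith) M ℓ
    unfold IsVirasoro.stableBound at h
    rw [← hM, h3] at h
    calc v g k s ≤ _ := h
      _ ≤ IsVirasoro.genusConst g * 4 * (27 * 3 ^ N * (1 / 27) ^ g *
          (R * (L ^ N * r ^ ℓ) / (ℓ.factorial : ℝ)) * ((M + ℓ).factorial : ℝ)) := by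
        gcongr
      _ = 108 * R * (3 * L) ^ N * (1 / 27) ^ g * IsVirasoro.genusConst g *
          (((M + ℓ).factorial : ℝ) * (r ^ ℓ / ℓ.factorial)) := by
        rw [mul_pow]; ring
      _ ≤ 108 * R * (3 * L) ^ N * (1 / 27) ^ g * IsVirasoro.genusConst g *
          (M.factorial * ((1 - r)⁻¹) ^ M) := mul_le_mul_of_nonneg_left h4 (by positivity)
      _ = 108 * R * (3 * L) ^ N * (1 / 27) ^ g * ((1 - r)⁻¹) ^ M *
          (IsVirasoro.genusConst g * M.factorial) := by ring
      _ ≤ 108 * R * (3 * L) ^ N * (1 / 27) ^ g * ((1 - r)⁻¹) ^ M *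
          ((g + 1) ^ 4 * ((1 / 3) ^ g / (g.factorial : ℝ)) * (N.factorial : ℝ)) :=
        mul_le_mul_of_nonneg_left hgf (by positivity)
      _ = 108 * (((g : ℝ) + 1) ^ 4 * (1 - r) ^ g) * (R * (3 * (L / (1 - r))) ^ N * (1 / 81) ^ g *
          (N.factorial / g.factorial)) := by
        rw [hpow, show (1 / 81 : ℝ) ^ g = (1 / 27) ^ g * (1 / 3) ^ g by rw [← mul_pow]; norm_num,
          mul_pow 3 (L / (1 - r)), div_pow, mul_pow, inv_pow]
        ring
      _ ≤ (108 * K + 27) * (R * (3 * (L / (1 - r))) ^ N * (1 / 81) ^ g *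
          (N.factorial / g.factorial)) := by
        gcongr
        linarith [hK g]
      _ = _ := by ring

end

end TopRec

namespace TopRec

noncomputable section

open scoped Nat

/-! ### The coefficients of the Painlevé I curve -/

section painleveI

variable (u : ℝ)

theorem ofPowerSeries_monomial (n : ℕ) (c : ℝ) :
    HahnSeries.ofPowerSeries ℤ ℝ (PowerSeries.monomial n c) = HahnSeries.single (n : ℤ) c := by
  rw [← mul_one c, ← smul_eq_mul, map_smul, ← PowerSeries.X_pow_eq, PowerSeries.smul_eq_C_mul,
    map_mul, HahnSeries.ofPowerSeries_C,
    HahnSeries.ofPowerSeries_X_pow, HahnSeries.C_apply, HahnSeries.single_mul_single, zero_add,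
    smul_eq_mul]

theorem residue_mul_single (f : LaurentSeries ℝ) (d : ℤ) (c : ℝ) :
    residue (f * HahnSeries.single d c) = f.coeff (-1 - d) * c := by
  rw [residue, ← HahnSeries.coeff_mul_single_add, sub_add_cancel]

/-- Here `(y(z) - y(-z)) x'(z) = 4z²(z² - 3u)`, so `θ` is `1/(6u z²)` times the geometric series in
`z²/(3u)`. -/
theorem theta_painleveI (hu : 0 < u) : (painleveI u).theta =
    HahnSeries.ofPowerSeries ℤ ℝ (PowerSeries.mk fun n =>
      if Even n then 1 / (6 * u) * (1 / (3 * u)) ^ (n / 2) else 0) * HahnSeries.single (-2) 1 := by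
  set G : PowerSeries ℝ := PowerSeries.mk fun n =>
      if Even n then 1 / (6 * u) * (1 / (3 * u)) ^ (n / 2) else 0 with hG
  have hD : ((painleveI u).y - PowerSeries.evalNegHom (painleveI u).y) *
      PowerSeries.derivative ℝ (painleveI u).x =
      (PowerSeries.C 4 * PowerSeries.X ^ 2 - PowerSeries.C (12 * u)) * PowerSeries.X ^ 2 := by
    have h1 : PowerSeries.evalNegHom (PowerSeries.C (3 * u)) = PowerSeries.C (3 * u) := by
      ext n
      rw [PowerSeries.evalNegHom, PowerSeries.coeff_rescale, PowerSeries.coeff_C]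
      split_ifs with h <;> simp [h]
    have h2 : PowerSeries.derivative ℝ (painleveI u).x = 2 * PowerSeries.X := by
      rw [LocalSpectralCurve.x, map_add, PowerSeries.derivative_C, PowerSeries.derivative_pow]
      simp
    have h4 : (PowerSeries.C 4 : PowerSeries ℝ) = 4 := map_ofNat _ 4
    have h12 : (PowerSeries.C (12 * u) : PowerSeries ℝ) = 4 * PowerSeries.C (3 * u) := by
      rw [show 12 * u = 4 * (3 * u) by ring, map_mul, h4]
    have hy : (painleveI u).y = PowerSeries.X ^ 3 - PowerSeries.C (3 * u) * PowerSeries.X := rfl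
    rw [h2, hy, map_sub, map_mul PowerSeries.evalNegHom, map_pow, PowerSeries.evalNegHom_X, h1, h4, h12]
    ring
  have hGD : G * (PowerSeries.C 4 * PowerSeries.X ^ 2 - PowerSeries.C (12 * u)) =
      PowerSeries.C (-2) := by
    ext n
    rw [mul_sub, map_sub, mul_left_comm, PowerSeries.coeff_C_mul, PowerSeries.coeff_mul_X_pow',
      PowerSeries.coeff_mul_C, PowerSeries.coeff_C, hG]
    rcases n with _ | _ | n
    · simp; field_simp; norm_num
    · simp
    · have : (n + 1 + 1) / 2 = n / 2 + 1 := by omega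
      simp only [PowerSeries.coeff_mk, show n + 1 + 1 - 2 = n by omega, this]
      have hp : (Even (n + 1 + 1)) ↔ Even n := by simp [Nat.even_add_one]
      simp only [hp]
      rw [if_neg (by omega : n + 1 + 1 ≠ 0), if_pos (by omega : 2 ≤ n + 1 + 1)]
      split_ifs
      · rw [pow_succ]
        generalize (1 / (3 * u)) ^ (n / 2) = w
        field_simp
        ring
      · simp
  have hX : HahnSeries.ofPowerSeries ℤ ℝ (PowerSeries.X ^ 2) * HahnSeries.single (-2) 1 = 1 := by
    rw [HahnSeries.ofPowerSeries_X_pow, HahnSeries.single_mul_single]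
    norm_num
  have h2 : HahnSeries.ofPowerSeries ℤ ℝ (PowerSeries.C (-2)) = -2 := by
    rw [map_neg, map_neg, map_ofNat, map_ofNat]
  have hkey : HahnSeries.ofPowerSeries ℤ ℝ G * HahnSeries.single (-2) 1 *
      HahnSeries.ofPowerSeries ℤ ℝ (((painleveI u).y - PowerSeries.evalNegHom (painleveI u).y) *
      PowerSeries.derivative ℝ (painleveI u).x) = -2 := by
    rw [hD, map_mul _ _ (PowerSeries.X ^ 2), mul_mul_mul_comm, mul_comm (HahnSeries.single (-2) 1),
      hX, mul_one, ← map_mul, hGD, h2]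
  rw [LocalSpectralCurve.theta, div_eq_iff, hkey]
  intro h0
  rw [h0, mul_zero, ← h2] at hkey
  have := congrArg (fun f => HahnSeries.coeff f 0) hkey
  rw [HahnSeries.ofPowerSeries_C] at this
  simp at this

theorem theta_coeff_painleveI (hu : 0 < u) (m : ℕ) :
    (painleveI u).theta.coeff (2 * (m : ℤ) - 2) = 1 / (6 * u) * (1 / (3 * u)) ^ m := by
  have : (2 * (m : ℤ) - 2) = ((2 * m : ℕ) : ℤ) + (-2) := by push_cast; ring
  rw [theta_painleveI u hu, this, HahnSeries.coeff_mul_single_add, mul_one,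
    HahnSeries.ofPowerSeries_apply_coeff]
  simp

theorem theta_coeff_painleveI_of_lt (hu : 0 < u) {j : ℤ} (hj : j < -2) :
    (painleveI u).theta.coeff j = 0 := by
  have : j = (j + 2) + (-2) := by ring
  rw [theta_painleveI u hu, this, HahnSeries.coeff_mul_single_add, mul_one,
    PowerSeries.coeff_coe, if_pos (by omega)]

/-- In the expansion of `1/(z-w)²` the coefficient of `w^(2i)` is `(2i+1) z^(-2i-2)`, and
integration in `w` cancels `2i+1`. -/
theorem xi_painleveI (i : ℕ) : (painleveI u).xi i =
    HahnSeries.single (-(2 * (i : ℤ) + 2)) (((2 * i + 1)‼ : ℕ) : ℝ) := by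
  set z : LaurentSeries ℝ := HahnSeries.single (1 : ℤ) (1 : ℝ) with hz
  have hz0 : z ≠ 0 := by simp [hz]
  have hom : (painleveI u).omega02 = PowerSeries.mk (fun n => z⁻¹ ^ (n + 1)) ^ 2 := by
    have h0 : (PowerSeries.mk fun n => HahnSeries.ofPowerSeries ℤ ℝ
        (PowerSeries.mk fun m => (painleveI u).reg m n)) = 0 := by
      ext n : 1
      have : (PowerSeries.mk fun m => (painleveI u).reg m n) = 0 := by ext; simp [painleveI]
      rw [PowerSeries.coeff_mk, this]
      simp
    have h1 : PowerSeries.mk (fun n => z⁻¹ ^ (n + 1)) * (PowerSeries.C z - PowerSeries.X) = 1 := by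
      ext n : 1
      rw [mul_sub, map_sub, PowerSeries.coeff_mul_C]
      cases n with
      | zero => simp [hz0]
      | succ n =>
        rw [PowerSeries.coeff_succ_mul_X, PowerSeries.coeff_mk, PowerSeries.coeff_mk, pow_succ,
          inv_mul_cancel_right₀ hz0]
        simp [PowerSeries.coeff_one]
    rw [LocalSpectralCurve.omega02, h0, add_zero, eq_comm, PowerSeries.eq_inv_iff_mul_eq_one,
      ← mul_pow, h1, one_pow]
    simp
  have hc : PowerSeries.coeff (2 * i) (painleveI u).omega02 =
      ((2 * i + 1 : ℕ) : LaurentSeries ℝ) * z⁻¹ ^ (2 * i + 2) := by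
    rw [hom, sq, PowerSeries.coeff_mul]
    rw [Finset.sum_congr rfl (g := fun _ => z⁻¹ ^ (2 * i + 2))]
    · simp
    · intro p hp
      rw [PowerSeries.coeff_mk, PowerSeries.coeff_mk, ← pow_add]
      congr 1
      have := Finset.HasAntidiagonal.mem_antidiagonal.1 hp
      omega
  have hne : ((2 * i + 1 : ℕ) : LaurentSeries ℝ) ≠ 0 := by
    rw [← HahnSeries.single_zero_natCast]
    simp only [ne_eq, HahnSeries.single_eq_zero_iff]
    positivity
  have hp : PowerSeries.coeff (2 * i + 1) (primitive (painleveI u).omega02) = z⁻¹ ^ (2 * i + 2) := by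
    rw [primitive, PowerSeries.coeff_mk, if_neg (by omega), Nat.add_sub_cancel, hc,
      mul_div_cancel_left₀ _ hne]
  have hidx : (-1 : ℤ) = ((2 * i + 1 : ℕ) : ℤ) + (-(2 * (i : ℤ) + 2)) := by push_cast; ring
  rw [LocalSpectralCurve.xi, residue, hidx, HahnSeries.coeff_mul_single_add,
    HahnSeries.ofPowerSeries_apply_coeff, hp, hz, HahnSeries.inv_single, HahnSeries.single_pow,
    ← HahnSeries.single_zero_natCast, HahnSeries.single_mul_single]
  congr 1
  · simp
  · simp

theorem derivative_e (j : ℕ) : PowerSeries.derivative ℝ (LocalSpectralCurve.e j) =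
    PowerSeries.monomial (2 * j) ((2 * j + 1) / ((2 * j + 1)‼ : ℝ)) := by
  ext n
  rw [PowerSeries.coeff_derivative, LocalSpectralCurve.e, PowerSeries.coeff_monomial,
    PowerSeries.coeff_monomial]
  by_cases h : n = 2 * j
  · subst h
    simp
    ring
  · rw [if_neg (by omega), if_neg h, zero_mul]

theorem monomial_mul (m n : ℕ) (a b : ℝ) : PowerSeries.monomial m a * PowerSeries.monomial n b =
    PowerSeries.monomial (m + n) (a * b) := by
  rw [PowerSeries.monomial_mul_monomial]

theorem A_painleveI (hu : 0 < u) (i j k : ℕ) : (painleveI u).A i j k =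
    if i = 0 ∧ j = 0 ∧ k = 0 then 1 / (6 * u) else 0 := by
  rw [LocalSpectralCurve.A, derivative_e, derivative_e, LocalSpectralCurve.e, monomial_mul,
    monomial_mul, ofPowerSeries_monomial, residue_mul_single]
  split_ifs with h
  · obtain ⟨rfl, rfl, rfl⟩ := h
    have := theta_coeff_painleveI u hu 0
    simp at this
    norm_num [this]
  · rw [theta_coeff_painleveI_of_lt u hu (by push_cast; omega), zero_mul]

theorem B_painleveI (hu : 0 < u) (i j k : ℕ) : (painleveI u).B i j k =
    if i + j ≤ k + 1 then 1 / (6 * u) * (1 / (3 * u)) ^ (k + 1 - (i + j)) *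
      ((2 * j + 1) * (2 * k + 1)‼ / ((2 * i + 1)‼ * (2 * j + 1)‼)) else 0 := by
  rw [LocalSpectralCurve.B, derivative_e, LocalSpectralCurve.e, monomial_mul,
    ofPowerSeries_monomial, xi_painleveI, mul_assoc, HahnSeries.single_mul_single,
    residue_mul_single]
  split_ifs with h
  · have := theta_coeff_painleveI u hu (k + 1 - (i + j))
    rw [show (-1 - (((2 * i + 1 + 2 * j : ℕ) : ℤ) + -(2 * (k : ℤ) + 2))) =
      2 * ((k + 1 - (i + j) : ℕ) : ℤ) - 2 by rw [Nat.cast_sub h]; push_cast; ring, this]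
    ring
  · rw [theta_coeff_painleveI_of_lt u hu (by push_cast; omega), zero_mul]

theorem C_painleveI (hu : 0 < u) (i j k : ℕ) : (painleveI u).C i j k =
    if i ≤ j + k + 2 then 1 / (6 * u) * (1 / (3 * u)) ^ (j + k + 2 - i) *
      ((2 * j + 1)‼ * (2 * k + 1)‼ / (2 * i + 1)‼) else 0 := by
  rw [LocalSpectralCurve.C, LocalSpectralCurve.e,
    ofPowerSeries_monomial, xi_painleveI, xi_painleveI, mul_assoc, mul_assoc,
    HahnSeries.single_mul_single, HahnSeries.single_mul_single, residue_mul_single]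
  split_ifs with h
  · have := theta_coeff_painleveI u hu (j + k + 2 - i)
    rw [show (-1 - (((2 * i + 1 : ℕ) : ℤ) + (-(2 * (j : ℤ) + 2) + -(2 * (k : ℤ) + 2)))) =
      2 * ((j + k + 2 - i : ℕ) : ℤ) - 2 by rw [Nat.cast_sub h]; push_cast; ring, this]
    ring
  · rw [theta_coeff_painleveI_of_lt u hu (by push_cast; omega), zero_mul]

theorem D_painleveI (hu : 0 < u) (i : ℕ) : (painleveI u).D i =
    if i = 0 then 1 / (6 * u) * (1 / (3 * u)) / 8 else if i = 1 then 1 / (6 * u) / 24 else 0 := by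
  have h0 := theta_coeff_painleveI u hu 0
  have h1 := theta_coeff_painleveI u hu 1
  have hp : (painleveI u).phiCoeff 0 0 = 0 := rfl
  rw [LocalSpectralCurve.D, hp, LocalSpectralCurve.thetaCoeff, LocalSpectralCurve.thetaCoeff, h1,
    h0]
  rcases i with _ | _ | i <;> simp

end painleveI

end

end TopRec

namespace TopRec

noncomputable section

open Finset.HasAntidiagonal (antidiagonal)

/-! ### The amplitudes as functions of a multiset -/

theorem sum_get_eraseIdx (ψ : ℕ → Multiset ℕ → ℝ) (L : List ℕ) :
    ∑ m : Fin L.length, ψ (L.get m) (L.eraseIdx m : Multiset ℕ) = removeSum ψ L := by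
  induction L generalizing ψ with
  | nil => simp
  | cons a L ih =>
    rw [← Multiset.cons_coe, removeSum_cons, ← ih]
    exact Fin.sum_univ_succ (n := L.length) _

theorem sum_powerset_conv {ι : Type*} [DecidableEq ι] (φ ψ : Multiset ℕ → ℝ) (f : ι → ℕ)
    (T : Finset ι) : ∑ I ∈ T.powerset, φ (I.val.map f) * ψ ((T \ I).val.map f) =
      conv φ ψ (T.val.map f) := by
  induction T using Finset.induction_on generalizing φ ψ with
  | empty => simp
  | insert x T hx ih =>
    rw [Finset.sum_powerset_insert hx, Finset.insert_val_of_notMem hx, Multiset.map_cons, conv_cons,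
      ← ih, ← ih, add_comm]
    congr 1
    · refine Finset.sum_congr rfl fun I hI => ?_
      have hxI : x ∉ I := fun h => hx (Finset.mem_powerset.1 hI h)
      rw [Finset.insert_val_of_notMem hxI, Multiset.map_cons, Finset.insert_sdiff_insert,
        Finset.sdiff_insert_of_notMem hx]
    · refine Finset.sum_congr rfl fun I hI => ?_
      have hxI : x ∉ I := fun h => hx (Finset.mem_powerset.1 hI h)
      rw [Finset.insert_sdiff_of_notMem _ hxI, Finset.insert_val_of_notMem (by simp [hx]),
        Multiset.map_cons]

theorem coe_sublistAt (L : List ℕ) (I : Finset (Fin L.length)) :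
    (sublistAt L I : Multiset ℕ) = I.val.map L.get := by
  rw [sublistAt, ← Multiset.map_coe, ← Multiset.filter_coe]
  congr 1
  have : I = Finset.univ.filter (· ∈ I) := by ext; simp
  conv_rhs => rw [this]
  rfl

theorem sum_sublistAt (φ ψ : Multiset ℕ → ℝ) (L : List ℕ) :
    ∑ I : Finset (Fin L.length), φ (sublistAt L I) * ψ (sublistAt L Iᶜ) = conv φ ψ L := by
  have h := sum_powerset_conv φ ψ L.get Finset.univ
  rw [Finset.powerset_univ] at h
  have hL : (Finset.univ : Finset (Fin L.length)).val.map L.get = (L : Multiset ℕ) := by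
    rw [← coe_sublistAt]
    congr 1
    simp [sublistAt]
  rw [hL] at h
  rw [← h]
  refine Finset.sum_congr rfl fun I _ => ?_
  rw [coe_sublistAt, coe_sublistAt, Finset.compl_eq_univ_sdiff]

/-- The amplitude with distinguished index `k` and the others collected in a multiset. -/
def airyM (S : LocalSpectralCurve) (g k : ℕ) (s : Multiset ℕ) : ℝ :=
  airyAmplitude S g (k :: s.toList)

theorem airyAmplitude_unstable (S : LocalSpectralCurve) (a : ℕ) {L : List ℕ} (hL : L.length ≤ 1) :
    airyAmplitude S 0 (a :: L) = 0 := by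
  rw [airyAmplitude, if_pos ⟨rfl, hL⟩]

theorem airyM_unstable (S : LocalSpectralCurve) (a : ℕ) {s : Multiset ℕ} (hs : s.card ≤ 1) :
    airyM S 0 a s = 0 :=
  airyAmplitude_unstable S a (by simpa using hs)

theorem virSplit_unstable {v : ℕ → ℕ → Multiset ℕ → ℝ}
    (hv : ∀ k s, Multiset.card s ≤ 1 → v 0 k s = 0) {g : ℕ} {s : Multiset ℕ}
    (h : 2 * g + s.card ≤ 2) (p : ℕ × ℕ) : virSplit v g p s = 0 := by
  have h1 : (if 1 ≤ g then v (g - 1) p.1 (p.2 ::ₘ s) else 0) = 0 := by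
    split_ifs with hg
    · obtain rfl : g = 1 := by omega
      exact hv _ _ (by rw [Multiset.card_cons]; omega)
    · rfl
  rw [virSplit, h1, zero_add]
  refine Finset.sum_eq_zero fun q hq => ?_
  have hq := Finset.HasAntidiagonal.mem_antidiagonal.1 hq
  rw [conv_congr (φ' := fun _ => 0) (ψ' := fun _ => 0)]
  · simp [conv]
  · intro t₁ t₂ ht
    have hc := congrArg Multiset.card ht
    rw [Multiset.card_add] at hc
    by_cases h1 : q.1 = 0 ∧ t₁.card ≤ 1
    · rw [h1.1, hv _ _ h1.2]; simp
    · rw [show q.2 = 0 by omega, hv _ t₂ (by omega)]; simp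

/-- The right-hand side of the recursion of the amplitudes, without initial values. -/
def airyStep (S : LocalSpectralCurve) (g k : ℕ) (s : Multiset ℕ) : ℝ :=
  removeSum (fun x t => ∑ᶠ μ : ℕ, S.B k x μ * airyM S g μ t) s +
    1 / 2 * ∑ᶠ p : ℕ × ℕ, S.C k p.1 p.2 * virSplit (airyM S) g p s

/-- In the unstable and initial cases every term on the right contains a vanishing amplitude. The
initial values can therefore be added to the recursion for all `(g, n)` instead of replacing it. -/
theorem airyStep_unstable (S : LocalSpectralCurve) {g : ℕ} (k : ℕ) {s : Multiset ℕ}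
    (h : 2 * g + s.card ≤ 2) : airyStep S g k s = 0 := by
  have h1 : removeSum (fun x t => ∑ᶠ μ : ℕ, S.B k x μ * airyM S g μ t) s = 0 := by
    rw [removeSum_congr (χ := fun _ _ => 0)]
    · simp [removeSum]
    · intro x hx
      have := Multiset.card_erase_add_one hx
      obtain rfl : g = 0 := by omega
      simp [airyM_unstable S _ (show (s.erase x).card ≤ 1 by omega)]
  rw [airyStep, h1]
  simp [virSplit_unstable (v := airyM S) (fun k s hs => airyM_unstable S k hs) h]

theorem airyAmplitude_cons_of_lt (S : LocalSpectralCurve) {g a : ℕ} {L : List ℕ}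
    (h : 2 < 2 * g + L.length)
    (ih : ∀ g' a' L', 2 * g' + L'.length < 2 * g + L.length →
      airyAmplitude S g' (a' :: L') = airyM S g' a' L') :
    airyAmplitude S g (a :: L) = airyStep S g a L := by
  rw [airyAmplitude, if_neg (by omega), if_neg (by omega), if_neg (by omega), airyStep]
  congr 1
  · rw [← sum_get_eraseIdx]
    refine Finset.sum_congr rfl fun m _ => finsum_congr fun μ => ?_
    have := m.isLt
    rw [ih _ _ _ (by simp only [List.length_eraseIdx, this, if_true]; omega)]
  · congr 1
    refine finsum_congr fun p => ?_
    rw [virSplit]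
    congr 2
    · split_ifs with hg
      · rw [ih _ _ _ (by rw [List.length_cons]; omega), Multiset.cons_coe]
      · rfl
    · rw [Finset.Nat.sum_antidiagonal_eq_sum_range_succ
        (fun i j => conv (airyM S i p.1) (airyM S j p.2) L), ← Fin.sum_univ_eq_sum_range
        (fun i => conv (airyM S i p.1) (airyM S (g - i) p.2) L)]
      refine Finset.sum_congr rfl fun i _ => ?_
      rw [← sum_sublistAt]
      refine Finset.sum_congr rfl fun I _ => ?_
      have h1 := i.isLt
      have h2 := Finset.card_add_card_compl I
      rw [Fintype.card_fin] at h2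
      have h3 := length_sublistAt L I
      have h4 := length_sublistAt L Iᶜ
      split_ifs with hI
      · rw [ih _ _ _ (by omega), ih _ _ _ (by omega)]
      -- The splittings left out in the definition have a genus-zero factor with a single index, so
      -- restoring them adds zero.
      · by_cases hi : (i : ℕ) = 0 ∧ I.card = 0
        · rw [hi.1, airyM_unstable S p.1 (by rw [Multiset.coe_card]; omega), zero_mul]
        · rw [show g - (i : ℕ) = 0 by omega,
            airyM_unstable S p.2 (by rw [Multiset.coe_card]; omega), mul_zero]

/-- The initial values of the amplitudes of the Painlevé I curve. -/
def painleveInit (u : ℝ) (g k : ℕ) (s : Multiset ℕ) : ℝ :=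
  (if g = 0 ∧ k = 0 ∧ s = 0 ::ₘ 0 ::ₘ 0 then 1 / (6 * u) else 0) +
    (if g = 1 ∧ s = 0 then (painleveI u).D k else 0)

theorem airyAmplitude_painleveI_cons {u : ℝ} (hu : 0 < u) (g a : ℕ) (L : List ℕ)
    (ih : ∀ g' a' L', 2 * g' + L'.length < 2 * g + L.length →
      airyAmplitude (painleveI u) g' (a' :: L') = airyM (painleveI u) g' a' L') :
    airyAmplitude (painleveI u) g (a :: L) =
      airyStep (painleveI u) g a L + painleveInit u g a L := by
  by_cases h : 2 < 2 * g + L.length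
  · rw [airyAmplitude_cons_of_lt _ h ih, painleveInit, if_neg, if_neg, add_zero, add_zero]
    · rintro ⟨rfl, h0⟩
      have := congrArg Multiset.card h0
      simp at this
      simp [this] at h
    · rintro ⟨rfl, -, h0⟩
      have := congrArg Multiset.card h0
      simp at this
      omega
  · rw [airyStep_unstable _ _ (by rw [Multiset.coe_card]; omega), zero_add, painleveInit]
    rcases g with _ | _ | g
    · rw [if_neg (by omega : ¬ (0 = 1 ∧ (L : Multiset ℕ) = 0)), add_zero]
      rcases L with _ | ⟨x, _ | ⟨y, _ | ⟨z, L⟩⟩⟩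
      · rw [airyAmplitude_unstable _ _ (by simp), if_neg]
        rintro ⟨-, -, h0⟩
        simpa using congrArg Multiset.card h0
      · rw [airyAmplitude_unstable _ _ (by simp), if_neg]
        rintro ⟨-, -, h0⟩
        simpa using congrArg Multiset.card h0
      · rw [airyAmplitude, if_neg (by simp), if_pos (by simp), A_painleveI u hu]
        refine if_congr ?_ rfl rfl
        have hxy : ((([x, y] : List ℕ) : Multiset ℕ) = 0 ::ₘ 0 ::ₘ 0) ↔ x = 0 ∧ y = 0 := by
          constructor
          · intro h0
            have := Multiset.sum_eq_zero_iff.1 (show Multiset.sum ([x, y] : List ℕ) = 0 by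
              rw [h0]; rfl)
            exact ⟨this x (by simp), this y (by simp)⟩
          · rintro ⟨rfl, rfl⟩
            rfl
        rw [hxy]
        simp
      · simp at h
    · obtain rfl : L = [] := List.length_eq_zero_iff.1 (by omega)
      rw [airyAmplitude, if_neg (by simp), if_neg (by simp), if_pos (by simp)]
      simp
    · omega

/-- The right-hand side of the recursion sees the tail only as a multiset, which gives symmetry in
all indices but the first. -/
theorem airyAmplitude_eq_airyM {u : ℝ} (hu : 0 < u) (g a : ℕ) (L : List ℕ) :
    airyAmplitude (painleveI u) g (a :: L) = airyM (painleveI u) g a L := by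
  induction hM : 2 * g + L.length using Nat.strong_induction_on generalizing g a L with
  | _ M IH =>
  subst hM
  have ih : ∀ g' a' L', 2 * g' + L'.length < 2 * g + L.length →
      airyAmplitude (painleveI u) g' (a' :: L') = airyM (painleveI u) g' a' L' :=
    fun g' a' L' h => IH _ h g' a' L' rfl
  rw [airyM, airyAmplitude_painleveI_cons hu g a L ih, airyAmplitude_painleveI_cons hu g a _
    fun g' a' L' h => ih g' a' L' (by simpa using h), Multiset.coe_toList]

theorem airyM_rec {u : ℝ} (hu : 0 < u) (g k : ℕ) (s : Multiset ℕ) :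
    airyM (painleveI u) g k s = airyStep (painleveI u) g k s + painleveInit u g k s := by
  rw [airyM, airyAmplitude_painleveI_cons hu g k _ fun g' a' L' _ =>
    airyAmplitude_eq_airyM hu g' a' L', Multiset.coe_toList]

end

end TopRec

namespace TopRec

noncomputable section

open Finset.HasAntidiagonal (antidiagonal)

/-! ### The normalised amplitudes of the Painlevé I curve -/

theorem virSplit_eq_zero {v : ℕ → ℕ → Multiset ℕ → ℝ} {g : ℕ} {s : Multiset ℕ}
    (h0 : ∀ k s, Multiset.card s ≤ 1 → v 0 k s = 0)
    (hv : ∀ g' k t, 2 * g' + Multiset.card t < 2 * g + s.card →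
      3 * g' + Multiset.card t < k + t.sum + 2 → v g' k t = 0)
    {p : ℕ × ℕ} (hp : 3 * g + s.card < p.1 + p.2 + s.sum + 4) : virSplit v g p s = 0 := by
  have h1 : (if 1 ≤ g then v (g - 1) p.1 (p.2 ::ₘ s) else 0) = 0 := by
    split_ifs with hg
    · refine hv _ _ _ ?_ ?_ <;> simp only [Multiset.card_cons, Multiset.sum_cons] <;> omega
    · rfl
  rw [virSplit, h1, zero_add]
  refine Finset.sum_eq_zero fun q hq => ?_
  have hq := Finset.HasAntidiagonal.mem_antidiagonal.1 hq
  rw [conv_congr (φ' := fun _ => 0) (ψ' := fun _ => 0)]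
  · simp [conv]
  · intro t₁ t₂ ht
    have hc := congrArg Multiset.card ht
    have hs := congrArg Multiset.sum ht
    rw [Multiset.card_add] at hc
    rw [Multiset.sum_add] at hs
    rw [mul_zero, mul_eq_zero]
    by_cases h1 : q.1 = 0 ∧ t₁.card ≤ 1
    · rw [h1.1]
      exact Or.inl (h0 _ _ h1.2)
    by_cases h2 : q.2 = 0 ∧ t₂.card ≤ 1
    · rw [h2.1]
      exact Or.inr (h0 _ _ h2.2)
    by_cases h3 : 3 * q.1 + t₁.card < p.1 + t₁.sum + 2
    · exact Or.inl (hv _ _ _ (by omega) h3)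
    · exact Or.inr (hv _ _ _ (by omega) (by omega))

/-- A nonzero `B` forces `μ ≥ k + x - 1`, and a nonzero `C` forces the new indices to sum to at
least `k - 2`, so exceeding the dimension is inherited by the terms on the right. This also makes
all sums over new indices finite. -/
theorem airyM_eq_zero {u : ℝ} (hu : 0 < u) (g k : ℕ) (s : Multiset ℕ) (h : 3 * g + s.card < k + s.sum + 2) :
    airyM (painleveI u) g k s = 0 := by
  induction hM : 2 * g + s.card using Nat.strong_induction_on generalizing g k s with
  | _ M IH =>
  subst hM
  have ih : ∀ g' k t, 2 * g' + Multiset.card t < 2 * g + s.card →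
      3 * g' + Multiset.card t < k + t.sum + 2 → airyM (painleveI u) g' k t = 0 :=
    fun g' k t hlt hd => IH _ hlt g' k t hd rfl
  have h1 : removeSum (fun x t => ∑ᶠ μ : ℕ, (painleveI u).B k x μ * airyM (painleveI u) g μ t) s =
      0 := by
    rw [removeSum_congr (χ := fun _ _ => 0)]
    · simp [removeSum]
    · intro x hx
      have hc := Multiset.card_erase_add_one hx
      have hs := Multiset.sum_erase hx
      refine finsum_eq_zero_of_forall_eq_zero fun μ => ?_
      rw [B_painleveI u hu]
      split_ifs with hμ
      · rw [ih _ _ _ (by omega) (by omega), mul_zero]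
      · rw [zero_mul]
  have h2 : ∑ᶠ p : ℕ × ℕ, (painleveI u).C k p.1 p.2 * virSplit (airyM (painleveI u)) g p s = 0 := by
    refine finsum_eq_zero_of_forall_eq_zero fun p => ?_
    rw [C_painleveI u hu]
    split_ifs with hp
    · rw [virSplit_eq_zero (fun _ _ => airyM_unstable _ _) ih (by omega), mul_zero]
    · rw [zero_mul]
  rw [airyM_rec hu, airyStep, h1, h2, painleveInit, if_neg, zero_add, zero_add, mul_zero, zero_add]
  · split_ifs with h3
    · obtain ⟨rfl, rfl⟩ := h3
      simp only [Multiset.card_zero, Multiset.sum_zero] at h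
      rw [D_painleveI u hu, if_neg (by omega), if_neg (by omega)]
    · rfl
  · rintro ⟨rfl, rfl, rfl⟩
    simp at h

theorem virSplit_airyM_eq_zero {u : ℝ} (hu : 0 < u) {g : ℕ} {s : Multiset ℕ} {p : ℕ × ℕ}
    (hp : 3 * g + s.card < p.1 + p.2 + s.sum + 4) :
    virSplit (airyM (painleveI u)) g p s = 0 :=
  virSplit_eq_zero (fun _ _ => airyM_unstable _ _) (fun g' k t _ => airyM_eq_zero hu g' k t) hp

theorem finite_support_B {u : ℝ} (hu : 0 < u) (k x g : ℕ) (s : Multiset ℕ) (c : ℝ) : (Function.support fun μ : ℕ =>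
    c * (painleveI u).B k x μ * airyM (painleveI u) g μ s).Finite := by
  refine (Set.finite_le_nat (3 * g + s.card)).subset fun μ hμ => ?_
  by_contra hlt
  refine hμ ?_
  simp only
  rw [airyM_eq_zero hu, mul_zero]
  simp only [Set.mem_ofPred_eq] at hlt
  omega

theorem finite_support_C {u : ℝ} (hu : 0 < u) (k g : ℕ) (s : Multiset ℕ) (c : ℝ) :
    (Function.support fun p : ℕ × ℕ =>
      c * (painleveI u).C k p.1 p.2 * virSplit (airyM (painleveI u)) g p s).Finite := by
  refine ((Set.finite_le_nat (3 * g + s.card)).prod (Set.finite_le_nat (3 * g + s.card))).subset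
    fun p hp => ?_
  by_contra hlt
  refine hp ?_
  simp only
  rw [virSplit_airyM_eq_zero hu, mul_zero]
  simp only [Set.mem_prod, Set.mem_ofPred_eq] at hlt
  omega

/-- After multiplication by `(2k+1)!!` the dependence on `k` is a truncated power of `1/(3u)`; the
subtraction cancels all but the leading one. -/
theorem B_sub {u : ℝ} (hu : 0 < u) (k x μ : ℕ) : ((2 * k + 1).doubleFactorial : ℝ) * (painleveI u).B k x μ -
    1 / (3 * u) * ((2 * (k + 1) + 1).doubleFactorial : ℝ) * (painleveI u).B (k + 1) x μ =
    if k + x = μ + 1 then 1 / (6 * u) * ((2 * x + 1) * ((2 * μ + 1).doubleFactorial : ℝ) /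
      ((2 * x + 1).doubleFactorial : ℝ)) else 0 := by
  have h1 : ((2 * k + 1).doubleFactorial : ℝ) ≠ 0 := by positivity
  have h2 : ((2 * (k + 1) + 1).doubleFactorial : ℝ) ≠ 0 := by positivity
  have h3 : ((2 * x + 1).doubleFactorial : ℝ) ≠ 0 := by positivity
  rw [B_painleveI u hu, B_painleveI u hu]
  rcases lt_trichotomy (k + x) (μ + 1) with h | h | h
  · rw [if_pos (by omega), if_pos (by omega), if_neg (by omega),
      show μ + 1 - (k + x) = μ + 1 - (k + 1 + x) + 1 by omega, pow_succ]
    generalize (1 / (3 * u)) ^ (μ + 1 - (k + 1 + x)) = w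
    field_simp
    ring
  · rw [if_pos (by omega), if_neg (by omega), if_pos h,
      show μ + 1 - (k + x) = 0 by omega, pow_zero]
    field_simp
    ring
  · rw [if_neg (by omega), if_neg (by omega), if_neg (by omega)]
    ring

theorem C_sub {u : ℝ} (hu : 0 < u) (k i j : ℕ) : ((2 * k + 1).doubleFactorial : ℝ) * (painleveI u).C k i j -
    1 / (3 * u) * ((2 * (k + 1) + 1).doubleFactorial : ℝ) * (painleveI u).C (k + 1) i j =
    if k = i + j + 2 then 1 / (6 * u) * (((2 * i + 1).doubleFactorial : ℝ) *
      ((2 * j + 1).doubleFactorial : ℝ)) else 0 := by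
  have h1 : ((2 * k + 1).doubleFactorial : ℝ) ≠ 0 := by positivity
  have h2 : ((2 * (k + 1) + 1).doubleFactorial : ℝ) ≠ 0 := by positivity
  rw [C_painleveI u hu, C_painleveI u hu]
  rcases lt_trichotomy k (i + j + 2) with h | h | h
  · rw [if_pos (by omega), if_pos (by omega), if_neg (by omega),
      show i + j + 2 - k = i + j + 2 - (k + 1) + 1 by omega, pow_succ]
    generalize (1 / (3 * u)) ^ (i + j + 2 - (k + 1)) = w
    field_simp
    ring
  · rw [if_pos (by omega), if_neg (by omega), if_pos h,
      show i + j + 2 - k = 0 by omega, pow_zero]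
    field_simp
    ring
  · rw [if_neg (by omega), if_neg (by omega), if_neg (by omega)]
    ring

/-- The product of the odd double factorials `(2x+1)!!` over the entries of a multiset. -/
def oddProd (s : Multiset ℕ) : ℝ :=
  (s.map fun x : ℕ => ((2 * x + 1).doubleFactorial : ℝ)).prod

theorem oddProd_cons (x : ℕ) (s : Multiset ℕ) :
    oddProd (x ::ₘ s) = ((2 * x + 1).doubleFactorial : ℝ) * oddProd s := by
  rw [oddProd, Multiset.map_cons, Multiset.prod_cons, oddProd]

theorem oddProd_add (s t : Multiset ℕ) : oddProd (s + t) = oddProd s * oddProd t := by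
  rw [oddProd, Multiset.map_add, Multiset.prod_add, oddProd, oddProd]

theorem oddProd_pos (s : Multiset ℕ) : 0 < oddProd s := by
  induction s using Multiset.induction with
  | empty => simp [oddProd]
  | cons x s ih => rw [oddProd_cons]; positivity

/-- The normalised amplitudes, which satisfy the Virasoro recursion. -/
def normAmp (u : ℝ) (g k : ℕ) (s : Multiset ℕ) : ℝ :=
  airyM (painleveI u) g k s * oddProd (k ::ₘ s) * ((6 * u) ^ (2 * g + s.card) / (6 * u))

theorem removeSum_sub (ψ χ : ℕ → Multiset ℕ → ℝ) (s : Multiset ℕ) :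
    removeSum (fun x t => ψ x t - χ x t) s = removeSum ψ s - removeSum χ s := by
  simp [removeSum, Multiset.sum_map_sub]

theorem finsum_B_sub {u : ℝ} (hu : 0 < u) (g k x : ℕ) (s : Multiset ℕ) :
    ((2 * k + 1).doubleFactorial : ℝ) *
        ∑ᶠ μ : ℕ, (painleveI u).B k x μ * airyM (painleveI u) g μ s -
      1 / (3 * u) * ((2 * (k + 1) + 1).doubleFactorial : ℝ) *
        ∑ᶠ μ : ℕ, (painleveI u).B (k + 1) x μ * airyM (painleveI u) g μ s =
    if k + x = 0 then 0 else 1 / (6 * u) * ((2 * x + 1) *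
      ((2 * (k + x - 1) + 1).doubleFactorial : ℝ) / ((2 * x + 1).doubleFactorial : ℝ)) *
      airyM (painleveI u) g (k + x - 1) s := by
  rw [mul_finsum, mul_finsum]
  · simp only [← mul_assoc]
    rw [← finsum_sub_distrib (finite_support_B hu k x g s _) (finite_support_B hu (k + 1) x g s _)]
    simp only [← sub_mul, B_sub hu]
    split_ifs with h
    · refine finsum_eq_zero_of_forall_eq_zero fun μ => ?_
      rw [if_neg (by omega), zero_mul]
    · rw [finsum_eq_single _ (k + x - 1) fun μ hμ => by rw [if_neg (by omega), zero_mul],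
        if_pos (by omega)]

theorem finsum_C_sub {u : ℝ} (hu : 0 < u) (g k : ℕ) (s : Multiset ℕ) :
    ((2 * k + 1).doubleFactorial : ℝ) * ∑ᶠ p : ℕ × ℕ,
        (painleveI u).C k p.1 p.2 * virSplit (airyM (painleveI u)) g p s -
      1 / (3 * u) * ((2 * (k + 1) + 1).doubleFactorial : ℝ) * ∑ᶠ p : ℕ × ℕ,
        (painleveI u).C (k + 1) p.1 p.2 * virSplit (airyM (painleveI u)) g p s =
    if k < 2 then 0 else ∑ p ∈ antidiagonal (k - 2), 1 / (6 * u) *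
      (((2 * p.1 + 1).doubleFactorial : ℝ) * ((2 * p.2 + 1).doubleFactorial : ℝ)) *
      virSplit (airyM (painleveI u)) g p s := by
  rw [mul_finsum, mul_finsum]
  · simp only [← mul_assoc]
    rw [← finsum_sub_distrib (finite_support_C hu k g s _) (finite_support_C hu (k + 1) g s _)]
    simp only [← sub_mul, C_sub hu]
    split_ifs with h
    · refine finsum_eq_zero_of_forall_eq_zero fun p => ?_
      rw [if_neg (by omega), zero_mul]
    · rw [finsum_eq_finsetSum_of_support_subset (s := antidiagonal (k - 2))]
      · refine Finset.sum_congr rfl fun p hp => ?_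
        have := Finset.HasAntidiagonal.mem_antidiagonal.1 hp
        rw [if_pos (by omega)]
        ring
      · intro p hp
        by_contra hne
        rw [Finset.mem_coe, Finset.HasAntidiagonal.mem_antidiagonal] at hne
        refine hp ?_
        simp only
        rw [if_neg (by omega), zero_mul]

theorem airyStep_sub {u : ℝ} (hu : 0 < u) (g k : ℕ) (s : Multiset ℕ) :
    ((2 * k + 1).doubleFactorial : ℝ) * airyStep (painleveI u) g k s -
      1 / (3 * u) * ((2 * (k + 1) + 1).doubleFactorial : ℝ) *
        airyStep (painleveI u) g (k + 1) s =
    removeSum (fun x t => if k + x = 0 then 0 else 1 / (6 * u) * ((2 * x + 1) *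
      ((2 * (k + x - 1) + 1).doubleFactorial : ℝ) / ((2 * x + 1).doubleFactorial : ℝ)) *
      airyM (painleveI u) g (k + x - 1) t) s +
    1 / 2 * (if k < 2 then 0 else ∑ p ∈ antidiagonal (k - 2), 1 / (6 * u) *
      (((2 * p.1 + 1).doubleFactorial : ℝ) * ((2 * p.2 + 1).doubleFactorial : ℝ)) *
      virSplit (airyM (painleveI u)) g p s) := by
  rw [← finsum_C_sub hu]
  simp only [← finsum_B_sub hu]
  rw [removeSum_sub, removeSum_mul, removeSum_mul, airyStep, airyStep]
  ring

/-- At `k = 0` the two values of `D` cancel because `θ₁ = θ₀/(3u)`; at `k = 1` the factor `3!!`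
turns `1/24` into `1/8`. -/
theorem painleveInit_sub {u : ℝ} (hu : 0 < u) (g k : ℕ) (s : Multiset ℕ) :
    (((2 * k + 1).doubleFactorial : ℝ) * painleveInit u g k s -
      1 / (3 * u) * ((2 * (k + 1) + 1).doubleFactorial : ℝ) * painleveInit u g (k + 1) s) *
        (oddProd s * ((6 * u) ^ (2 * g + s.card) / (6 * u))) = virInit g k s := by
  rw [painleveInit, painleveInit, virInit, if_neg (by omega : ¬ (g = 0 ∧ k + 1 = 0 ∧ _))]
  by_cases h1 : g = 0 ∧ k = 0 ∧ s = 0 ::ₘ 0 ::ₘ 0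
  · obtain ⟨rfl, rfl, rfl⟩ := h1
    simp [oddProd]
    field_simp
  rw [if_neg h1, if_neg h1]
  by_cases h2 : g = 1 ∧ s = 0
  · obtain ⟨rfl, rfl⟩ := h2
    rw [if_pos ⟨rfl, rfl⟩, if_pos ⟨rfl, rfl⟩, D_painleveI u hu, D_painleveI u hu]
    rcases k with _ | _ | k
    · simp [oddProd, Nat.doubleFactorial]
      field_simp
      norm_num
    · simp [oddProd, Nat.doubleFactorial]
      field_simp
      norm_num
    · simp
  · rw [if_neg h2, if_neg h2, if_neg (by tauto)]
    ring

theorem virSplit_normAmp {u : ℝ} (hu : 0 < u) (g : ℕ) (p : ℕ × ℕ) (s : Multiset ℕ) :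
    virSplit (normAmp u) g p s = 1 / (6 * u) *
      (((2 * p.1 + 1).doubleFactorial : ℝ) * ((2 * p.2 + 1).doubleFactorial : ℝ)) *
      virSplit (airyM (painleveI u)) g p s *
        (oddProd s * ((6 * u) ^ (2 * g + s.card) / (6 * u))) := by
  rw [virSplit, virSplit, mul_add, add_mul, Finset.mul_sum, Finset.sum_mul]
  congr 1
  · split_ifs with hg
    · rw [normAmp, oddProd_cons, oddProd_cons, Multiset.card_cons,
        show 2 * g + s.card = 2 * (g - 1) + (s.card + 1) + 1 by omega]
      generalize 2 * (g - 1) + (s.card + 1) = N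
      rw [pow_succ]
      field_simp
    · simp
  · refine Finset.sum_congr rfl fun h hh => ?_
    have hh := Finset.HasAntidiagonal.mem_antidiagonal.1 hh
    rw [mul_assoc, mul_comm (conv _ _ s), ← mul_assoc, ← conv_mul_left]
    refine conv_congr fun t₁ t₂ ht => ?_
    rw [normAmp, normAmp, ← ht, ← hh, oddProd_cons, oddProd_cons, oddProd_add, Multiset.card_add,
      show 2 * (h.1 + h.2) + (t₁.card + t₂.card) = (2 * h.1 + t₁.card) + (2 * h.2 + t₂.card) by ring]
    generalize 2 * h.1 + t₁.card = N₁
    generalize 2 * h.2 + t₂.card = N₂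
    rw [pow_add]
    field_simp

theorem isVirasoro_normAmp {u : ℝ} (hu : 0 < u) : IsVirasoro (1 / (3 * u)) (normAmp u) where
  vanish g k s h := by rw [normAmp, airyM_eq_zero hu g k s h]; simp
  rec_eq g k s := by
    set K : ℝ := oddProd s * ((6 * u) ^ (2 * g + s.card) / (6 * u)) with hK
    have h1 : ∀ k, normAmp u g k s =
        ((2 * k + 1).doubleFactorial : ℝ) * airyM (painleveI u) g k s * K := by
      intro k
      rw [normAmp, oddProd_cons, hK]
      ring
    have h2 : removeSum (virMerge (normAmp u) g k) s = removeSum (fun x t =>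
        if k + x = 0 then 0 else 1 / (6 * u) * ((2 * x + 1) *
        ((2 * (k + x - 1) + 1).doubleFactorial : ℝ) / ((2 * x + 1).doubleFactorial : ℝ)) *
        airyM (painleveI u) g (k + x - 1) t) s * K := by
      rw [mul_comm, ← removeSum_mul]
      refine removeSum_congr fun x hx => ?_
      have e1 : oddProd s = ((2 * x + 1).doubleFactorial : ℝ) * oddProd (s.erase x) := by
        rw [← oddProd_cons, Multiset.cons_erase hx]
      have e2 := Multiset.card_erase_add_one hx
      have h3 : ((2 * x + 1).doubleFactorial : ℝ) ≠ 0 := by positivity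
      rw [virMerge]
      split_ifs with h0
      · simp
      · rw [normAmp, hK, oddProd_cons, e1, ← e2, ← add_assoc, pow_succ]
        field_simp
    have h3 : virQuad (normAmp u) g k s = 1 / 2 * (if k < 2 then 0 else
        ∑ p ∈ antidiagonal (k - 2), 1 / (6 * u) *
        (((2 * p.1 + 1).doubleFactorial : ℝ) * ((2 * p.2 + 1).doubleFactorial : ℝ)) *
        virSplit (airyM (painleveI u)) g p s) * K := by
      rcases k with _ | _ | k
      · simp [virQuad]
      · simp [virQuad]
      · rw [virQuad, if_neg (by omega), show k + 1 + 1 - 2 = k by omega, mul_assoc, Finset.sum_mul]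
        simp only [virSplit_normAmp hu, hK]
    rw [h2, h3, ← painleveInit_sub hu, ← hK, h1, h1, airyM_rec hu, airyM_rec hu]
    linear_combination K * airyStep_sub hu g k s

end

end TopRec

namespace TopRec

noncomputable section

/-! ### The growth of the amplitudes -/

theorem growthP_pos {u : ℝ} (hu : 0 < u) : 0 < growthP u := by
  unfold growthP
  split_ifs with h
  · positivity
  · exact div_pos (by norm_num) (by linarith)

theorem growthP_eq {u : ℝ} (hu : 0 < u) : growthP u =
    max (2 * (1 / (5 * u))) 1 / (1 - min (1 / (5 * u)) (1 / 2)) / (2 * u) := by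
  unfold growthP
  split_ifs with h
  · have h1 : 1 / 2 ≤ 1 / (5 * u) := by
      rw [div_le_div_iff₀ (by norm_num) (by positivity)]
      linarith
    rw [max_eq_left (by linarith), min_eq_right h1]
    field_simp
    norm_num
  · have h1 : 1 / (5 * u) ≤ 1 / 2 := by
      rw [div_le_div_iff₀ (by positivity) (by norm_num)]
      linarith
    have h2 : 10 * u - 2 ≠ 0 := by intro h3; linarith
    have h3 : 5 * u - 1 ≠ 0 := by intro h3; linarith
    rw [max_eq_right (by linarith), min_eq_left h1, show 10 * u - 2 = 2 * (5 * u - 1) by ring,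
      show 1 - 1 / (5 * u) = (5 * u - 1) / (5 * u) by field_simp]
    field_simp

/-- The growth of the amplitudes with at least one index. -/
theorem exists_airyM_bound : ∃ T : ℝ → ℝ, (∀ u, 0 < u → 0 < T u) ∧
    ∀ u v : ℝ, 0 < u → 0 < v → ∀ g k s, k + s.sum + 2 ≤ 3 * g + Multiset.card s →
    airyM (painleveI u) g k s * oddProd (k ::ₘ s) ≤ v ^ (k + s.sum) *
      (T (u / v) / v * (2 * u / 27) ^ g * (growthP (u / v) / v ^ 2) ^ (3 * g + s.card - 2) *
        (((3 * g + s.card - 2).factorial : ℝ) / (g.factorial : ℝ))) := by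
  have hex : ∀ q' : ℝ, ∃ S : ℝ, 0 < q' → 0 < S ∧
    ∀ (q : ℝ) (v : ℕ → ℕ → Multiset ℕ → ℝ), 0 < q → IsVirasoro (5 * q / 3) v →
    ∀ g k s ℓ, k + s.sum + ℓ + 2 = 3 * g + s.card →
    v g k s ≤ S * (q / q') ^ ℓ *
      (3 * (max (2 * q') 1 / (1 - min q' (1 / 2)))) ^ (k + s.sum + ℓ) * (1 / 81) ^ g *
      (((k + s.sum + ℓ).factorial : ℝ) / (g.factorial : ℝ)) := by
    intro q'
    by_cases h : 0 < q'
    · obtain ⟨S, hS⟩ := IsVirasoro.exists_bound h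
      exact ⟨S, fun _ => hS⟩
    · exact ⟨0, fun h' => absurd h' h⟩
  choose S hS using hex
  -- The normalisation has exponent `2g-2+n = N - g + 1` of `6u`. Here `N` powers go into `P`, `g`
  -- powers turn `1/81` into `2u/27`, and the last one is this denominator. The reference parameter
  -- is taken at `u/v`, so that `q/q' = 1/v`.
  refine ⟨fun u => S (1 / (5 * u)) / (6 * u), fun u hu =>
    div_pos (hS _ (by positivity)).1 (by positivity), fun u v hu hv g k s hdim => ?_⟩
  have huv : 0 < u / v := by positivity
  obtain ⟨ℓ, hℓ⟩ : ∃ ℓ, k + s.sum + ℓ + 2 = 3 * g + s.card :=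
    ⟨3 * g + s.card - 2 - (k + s.sum), by omega⟩
  have hb := (hS (1 / (5 * (u / v))) (by positivity)).2 (1 / (5 * u)) (normAmp u) (by positivity)
    (by rw [show 5 * (1 / (5 * u)) / 3 = 1 / (3 * u) by field_simp]; exact isVirasoro_normAmp hu)
    g k s ℓ hℓ
  have hP := growthP_eq huv
  beta_reduce
  generalize S (1 / (5 * (u / v))) = S₀ at hb ⊢
  set p : ℝ := max (2 * (1 / (5 * (u / v)))) 1 / (1 - min (1 / (5 * (u / v))) (1 / 2)) with hp
  obtain ⟨d, hd⟩ : ∃ d, d = k + s.sum := ⟨_, rfl⟩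
  rw [show 3 * g + s.card - 2 = d + ℓ by omega]
  rw [← hd] at hb ⊢
  have hamp : airyM (painleveI u) g k s * oddProd (k ::ₘ s) * (6 * u) ^ (d + ℓ) * (6 * u) =
      normAmp u g k s * (6 * u) ^ g := by
    rw [normAmp, mul_assoc _ _ ((6 * u) ^ g), div_mul_eq_mul_div, ← pow_add,
      show 2 * g + s.card + g = d + ℓ + 2 by omega]
    generalize d + ℓ = e
    rw [pow_add]
    field_simp
  have hc : 0 < (6 * u) ^ (d + ℓ) * (6 * u) := by positivity
  refine le_of_mul_le_mul_right ?_ hc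
  rw [← mul_assoc, hamp]
  have hq : 1 / (5 * u) / (1 / (5 * (u / v))) = 1 / v := by field_simp
  rw [hq] at hb
  refine (mul_le_mul_of_nonneg_right hb (by positivity)).trans (le_of_eq ?_)
  have h81 : (2 * u / 27 : ℝ) ^ g = (1 / 81) ^ g * (6 * u) ^ g := by
    rw [← mul_pow]; congr 1; ring
  have hPv : growthP (u / v) / v ^ 2 * (6 * u) = 3 * p * (1 / v) := by
    rw [hP]; field_simp; ring
  have hkey : v ^ d * ((growthP (u / v) / v ^ 2) ^ (d + ℓ) * (6 * u) ^ (d + ℓ)) =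
      (1 / v) ^ ℓ * (3 * p) ^ (d + ℓ) := by
    rw [← mul_pow, hPv, mul_pow, pow_add (1 / v), one_div, inv_pow, inv_pow]
    field_simp
  rw [h81]
  have hS6 : S₀ / (6 * (u / v)) / v * (6 * u) = S₀ := by field_simp
  calc _ = S₀ * ((1 / v) ^ ℓ * (3 * p) ^ (d + ℓ)) * ((1 / 81) ^ g * (6 * u) ^ g) *
        (((d + ℓ).factorial : ℝ) / g.factorial) := by ring
    _ = (S₀ / (6 * (u / v)) / v * (6 * u)) * (v ^ d * ((growthP (u / v) / v ^ 2) ^ (d + ℓ) *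
        (6 * u) ^ (d + ℓ))) * ((1 / 81) ^ g * (6 * u) ^ g) *
        (((d + ℓ).factorial : ℝ) / g.factorial) := by rw [hS6, hkey]
    _ = _ := by ring

/-- The primitive of `y dx` is `(2/5) z⁵ - 2u z³`, whose two monomials pick out the indices `2` and
`1`. -/
theorem freeEnergy_painleveI {u : ℝ} (hu : 0 < u) (g : ℕ) : freeEnergy (painleveI u) g =
    1 / (2 - 2 * (g : ℝ)) * (2 / 5 * (airyM (painleveI u) g 2 0 * oddProd {2}) -
      2 * u * (airyM (painleveI u) g 1 0 * oddProd {1})) := by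
  have hprim : HahnSeries.ofPowerSeries ℤ ℝ (primitive ((painleveI u).y *
      PowerSeries.derivative ℝ (painleveI u).x)) =
      HahnSeries.single 5 (2 / 5) - HahnSeries.single 3 (2 * u) := by
    have h1 : (painleveI u).y * PowerSeries.derivative ℝ (painleveI u).x =
        PowerSeries.monomial 4 2 - PowerSeries.monomial 2 (6 * u) := by
      have h2 : PowerSeries.derivative ℝ (painleveI u).x = 2 * PowerSeries.X := by
        rw [LocalSpectralCurve.x, map_add, PowerSeries.derivative_C, PowerSeries.derivative_pow]
        simp
      have hy : (painleveI u).y = PowerSeries.monomial 3 1 - PowerSeries.monomial 1 (3 * u) := by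
        rw [painleveI, PowerSeries.X_pow_eq, ← PowerSeries.smul_eq_C_mul, PowerSeries.X_eq,
          ← map_smul, smul_eq_mul, mul_one]
      have hx : (2 * PowerSeries.X : PowerSeries ℝ) = PowerSeries.monomial 1 2 := by
        rw [← map_ofNat (PowerSeries.C (R := ℝ)) 2, ← PowerSeries.smul_eq_C_mul, PowerSeries.X_eq,
          ← map_smul, smul_eq_mul, mul_one]
      rw [h2, hx, hy, sub_mul, monomial_mul, monomial_mul]
      congr 2 <;> ring
    have h3 : primitive ((painleveI u).y * PowerSeries.derivative ℝ (painleveI u).x) =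
        PowerSeries.monomial 5 (2 / 5) - PowerSeries.monomial 3 (2 * u) := by
      ext n
      rw [primitive, PowerSeries.coeff_mk, h1, map_sub, map_sub, PowerSeries.coeff_monomial,
        PowerSeries.coeff_monomial, PowerSeries.coeff_monomial, PowerSeries.coeff_monomial]
      rcases n with _ | n
      · simp
      · rw [if_neg (by omega), Nat.add_sub_cancel]
        by_cases h4 : n = 4
        · subst h4; norm_num
        · by_cases h5 : n = 2
          · subst h5
            norm_num
            ring
          · rw [if_neg h4, if_neg h5, if_neg (by omega), if_neg (by omega)]
            simp
    rw [h3, map_sub, ofPowerSeries_monomial, ofPowerSeries_monomial]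
    rfl
  have hom : ∀ j : ℕ, (omega1 (painleveI u) g).coeff (-(2 * (j : ℤ) + 2)) =
      airyM (painleveI u) g j 0 * oddProd {j} := by
    intro j
    have hterm : ∀ k, airyAmplitude (painleveI u) g [k] = airyM (painleveI u) g k 0 := by
      intro k
      rw [airyM, Multiset.toList_zero]
    rw [omega1, finsum_eq_finsetSum_of_support_subset (s := Finset.range (3 * g + j + 1)),
      HahnSeries.coeff_sum, Finset.sum_eq_single j]
    · rw [HahnSeries.coeff_smul, xi_painleveI, HahnSeries.coeff_single_same, hterm, oddProd,
        Multiset.map_singleton, Multiset.prod_singleton, smul_eq_mul]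
    · intro k _ hk
      rw [HahnSeries.coeff_smul, xi_painleveI, HahnSeries.coeff_single_of_ne (by omega), smul_zero]
    · intro hj
      simp at hj
    · intro k hk
      by_contra hlt
      simp at hlt
      refine hk ?_
      simp only
      rw [hterm, airyM_eq_zero hu _ _ _ (by simp; omega)]
      exact zero_smul ℝ ((painleveI u).xi k)
  rw [freeEnergy, hprim, mul_comm _ (omega1 _ _), mul_sub]
  have hres : ∀ f h : LaurentSeries ℝ, residue (f - h) = residue f - residue h := fun f h => rfl
  rw [hres, residue_mul_single, residue_mul_single]
  rw [show (-1 - 5 : ℤ) = -(2 * ((2 : ℕ) : ℤ) + 2) by norm_num,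
    show (-1 - 3 : ℤ) = -(2 * ((1 : ℕ) : ℤ) + 2) by norm_num, hom, hom]
  ring

end

end TopRec

/-! ### Free energies, counting of indices and the theorem -/

namespace TopRec

noncomputable section

theorem amplitude_painleveI_succ {u : ℝ} (hu : 0 < u) (g : ℕ) {n : ℕ} (k : Fin (n + 1) → ℕ) :
    ∃ s : Multiset ℕ, s.card = n ∧ ∑ i, k i = k 0 + s.sum ∧
      amplitude (painleveI u) g k * ∏ i, ((2 * k i + 1).doubleFactorial : ℝ) =
        airyM (painleveI u) g (k 0) s * oddProd (k 0 ::ₘ s) := by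
  refine ⟨(List.ofFn fun i : Fin n => k i.succ : List ℕ), by simp, ?_, ?_⟩
  · rw [Fin.sum_univ_succ, Multiset.sum_coe, List.sum_ofFn]
  · rw [amplitude, if_neg (Nat.succ_ne_zero n), List.ofFn_succ, airyAmplitude_eq_airyM hu,
      oddProd_cons, oddProd, Multiset.map_coe, Multiset.prod_coe, List.map_ofFn, List.prod_ofFn,
      Fin.prod_univ_succ]
    rfl

theorem amplitude_painleveI_eq_zero {u : ℝ} (hu : 0 < u) {g n : ℕ} (hgn : 2 < 2 * g + n)
    (k : Fin n → ℕ) (hk : 3 * g + n - 3 < ∑ i, k i) :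
    amplitude (painleveI u) g k * ∏ i, ((2 * k i + 1).doubleFactorial : ℝ) = 0 := by
  rcases n with _ | n
  · simp at hk
  · obtain ⟨s, h1, h2, h3⟩ := amplitude_painleveI_succ hu g k
    rw [h3, airyM_eq_zero hu _ _ _ (by omega), zero_mul]

theorem airyM_nonneg {u : ℝ} (hu : 0 < u) (g k : ℕ) (s : Multiset ℕ) :
    0 ≤ airyM (painleveI u) g k s := by
  have h := (isVirasoro_normAmp hu).nonneg (by positivity) g k s
  have ho := oddProd_pos (k ::ₘ s)
  have hp : 0 < (6 * u) ^ (2 * g + s.card) / (6 * u) := by positivity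
  rw [normAmp] at h
  exact nonneg_of_mul_nonneg_left (nonneg_of_mul_nonneg_left h hp) ho

/-- As `2 - 2g < 0` and amplitudes are nonnegative, the index `2` only lowers the value. For the
index `1`, `3g - 2 ≤ 2(2g - 2)` when `g ≥ 2`. -/
theorem freeEnergy_painleveI_le {u : ℝ} (hu : 0 < u) {g : ℕ} (hg : 2 ≤ g) {R : ℝ}
    (hR : airyM (painleveI u) g 1 0 * oddProd {1} ≤ (3 * g - 2) * R) (hR0 : 0 ≤ R) :
    freeEnergy (painleveI u) g ≤ 4 * u * R := by
  have h2 := mul_nonneg (airyM_nonneg hu g 2 0) (oddProd_pos {2}).le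
  have hg' : (2 : ℝ) ≤ g := by exact_mod_cast hg
  rw [freeEnergy_painleveI hu,
    show (2 : ℝ) - 2 * g = -(2 * g - 2) by ring, one_div, inv_neg, ← one_div, neg_mul, ← mul_neg,
    one_div_mul_eq_div, div_le_iff₀ (by linarith)]
  have h3 : 2 * u * (airyM (painleveI u) g 1 0 * oddProd {1}) ≤ 2 * u * ((3 * g - 2) * R) := by
    gcongr
  have h4 : (3 * (g : ℝ) - 2) * (u * R) ≤ (2 * (2 * g - 2)) * (u * R) := by
    gcongr
    linarith
  nlinarith

/-- The growth of the amplitudes, with a scaling parameter `v`. -/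
theorem exists_amplitude_bound : ∃ S : ℝ → ℝ, (∀ u, 0 < u → 0 < S u) ∧
    ∀ u v : ℝ, 0 < u → 0 < v → ∀ g n : ℕ, 2 < 2 * g + n → ∀ k : Fin n → ℕ,
    amplitude (painleveI u) g k * ∏ i, ((2 * k i + 1).doubleFactorial : ℝ) ≤ v ^ (∑ i, k i) *
      (S (u / v) / v * (2 * u / 27) ^ g * (growthP (u / v) / v ^ 2) ^ (3 * g + n - 3) *
        (((3 * g + n - 3).factorial : ℝ) / (g.factorial : ℝ))) := by
  obtain ⟨T, hT0, hT⟩ := exists_airyM_bound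
  -- The summand `1` serves `n ≥ 1`. The other serves `n = 0`, where the bound on `F_{g;1}` carries
  -- one power of `P` too many.
  refine ⟨fun u => T u * (1 + 4 * u * growthP u), fun u hu => ?_, ?_⟩
  · have h1 := hT0 u hu
    have h2 := growthP_pos hu
    positivity
  intro u v hu hv g n hgn k
  have huv : 0 < u / v := by positivity
  have hP := growthP_pos huv
  have hTp := hT0 _ huv
  have hE : 0 ≤ 4 * (u / v) * growthP (u / v) := by positivity
  rcases n with _ | n
  · obtain ⟨m, hm⟩ : ∃ m, 3 * g = m + 3 := ⟨3 * g - 3, by omega⟩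
    have hm' : 3 * (g : ℝ) - 2 = m + 1 := by
      have : 3 * (g : ℝ) = m + 3 := by exact_mod_cast hm
      linarith
    have h := hT u v hu hv g 1 0 (by simp; omega)
    simp only [Multiset.sum_zero, Multiset.card_zero, add_zero, Multiset.cons_zero,
      pow_one] at h
    rw [show 3 * g - 2 = m + 1 by omega, Nat.factorial_succ] at h
    rw [amplitude, if_pos rfl, Finset.univ_eq_empty, Finset.prod_empty, Finset.sum_empty, mul_one,
      pow_zero, one_mul, show 3 * g + 0 - 3 = m by omega]
    set R : ℝ := v * (T (u / v) / v * (2 * u / 27) ^ g * (growthP (u / v) / v ^ 2) ^ (m + 1) *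
      ((m.factorial : ℝ) / (g.factorial : ℝ))) with hR
    have hF := freeEnergy_painleveI_le hu (show 2 ≤ g by omega) (R := R)
      (h.trans (le_of_eq (by rw [hR, hm']; push_cast; ring))) (by positivity)
    refine hF.trans ?_
    have e : 4 * u * R = 4 * (u / v) * growthP (u / v) * (T (u / v) / v * (2 * u / 27) ^ g *
        (growthP (u / v) / v ^ 2) ^ m * ((m.factorial : ℝ) / (g.factorial : ℝ))) := by
      rw [hR, pow_succ]
      field_simp
    rw [e]
    have h0 : 0 ≤ T (u / v) / v * (2 * u / 27) ^ g *
        (growthP (u / v) / v ^ 2) ^ m * ((m.factorial : ℝ) / (g.factorial : ℝ)) := by positivity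
    calc _ ≤ (1 + 4 * (u / v) * growthP (u / v)) * (T (u / v) / v * (2 * u / 27) ^ g *
        (growthP (u / v) / v ^ 2) ^ m * ((m.factorial : ℝ) / (g.factorial : ℝ))) := by
          gcongr
          linarith
      _ = _ := by ring
  · by_cases hk : 3 * g + (n + 1) - 3 < ∑ i, k i
    · rw [amplitude_painleveI_eq_zero hu hgn k hk]
      positivity
    obtain ⟨s, h1, h2, h3⟩ := amplitude_painleveI_succ hu g k
    have h := hT u v hu hv g (k 0) s (by omega)
    rw [h3, h2, show 3 * g + (n + 1) - 3 = 3 * g + s.card - 2 by omega]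
    refine h.trans ?_
    gcongr
    exact le_mul_of_one_le_right hTp.le (by linarith)

theorem exists_finset_sum_le (n N : ℕ) : ∃ D : Finset (Fin n → ℕ),
    (∀ k : Fin n → ℕ, ∑ i, k i ≤ N → k ∈ D) ∧ D.card ≤ (N + n).choose n := by
  classical
  refine ⟨((Finset.univ : Finset (Fin (n + 1))).finsuppAntidiag N).image fun f i => f i.succ,
    fun k hk => ?_, Finset.card_image_le.trans ?_⟩
  -- Stars and bars: the extra coordinate is the slack `N - ∑ kᵢ`.
  · refine Finset.mem_image.2 ⟨Finsupp.equivFunOnFinite.symm (Fin.cons (N - ∑ i, k i) k), ?_, ?_⟩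
    · rw [Finset.mem_finsuppAntidiag]
      refine ⟨?_, Finset.subset_univ _⟩
      rw [Fin.sum_univ_succ]
      simp
      omega
    · ext i
      simp
  · rw [Finset.card_finsuppAntidiag_nat_eq_choose, Finset.card_univ, Fintype.card_fin,
      show n + 1 + N - 1 = N + n by omega, Nat.choose_symm_add]

end

end TopRec

theorem mainTheorem7 :
    ∃ S : ℝ → ℝ,
      (∀ u : ℝ, 0 < u → 0 < S u) ∧
      (∀ u : ℝ, 0 < u → ∀ g n : ℕ, 2 < 2 * g + n → ∀ k : Fin n → ℕ,
        TopRec.amplitude (TopRec.painleveI u) g k *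
            ∏ i, (Nat.doubleFactorial (2 * k i + 1) : ℝ) ≤
          S u * (2 * u / 27) ^ g * TopRec.growthP u ^ (3 * g + n - 3) *
            ((Nat.factorial (3 * g + n - 3) : ℝ) / (Nat.factorial g : ℝ))) ∧
      (∀ u v : ℝ, 0 < u → 0 < v → ∀ g n : ℕ, 2 < 2 * g + n →
        Summable (fun k : Fin n → ℕ =>
          (v ^ (∑ i, k i))⁻¹ * TopRec.amplitude (TopRec.painleveI u) g k *
            ∏ i, (Nat.doubleFactorial (2 * k i + 1) : ℝ)) ∧
        ∑' k : Fin n → ℕ,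
          (v ^ (∑ i, k i))⁻¹ * TopRec.amplitude (TopRec.painleveI u) g k *
            ∏ i, (Nat.doubleFactorial (2 * k i + 1) : ℝ) ≤
          S (u / v) / v * (2 * u / 27) ^ g *
            (TopRec.growthP (u / v) / v ^ 2) ^ (3 * g + n - 3) *
            ((Nat.factorial (3 * g + 2 * n - 3) : ℝ) /
              ((Nat.factorial g : ℝ) * (Nat.factorial n : ℝ)))) := by
  obtain ⟨S, hS0, hS⟩ := TopRec.exists_amplitude_bound
  refine ⟨S, hS0, fun u hu g n hgn k => ?_, fun u v hu hv g n hgn => ?_⟩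
  -- The first bound is the case `v = 1`.
  · simpa using hS u 1 hu one_pos g n hgn k
  obtain ⟨N, hN⟩ : ∃ N, 3 * g + n = N + 3 := ⟨3 * g + n - 3, by omega⟩
  obtain ⟨D, hD, hcard⟩ := TopRec.exists_finset_sum_le n N
  have huv : 0 < u / v := by positivity
  have hP := TopRec.growthP_pos huv
  have hSp := hS0 _ huv
  have hzero : ∀ k ∉ D, (v ^ (∑ i, k i))⁻¹ * TopRec.amplitude (TopRec.painleveI u) g k *
      ∏ i, (Nat.doubleFactorial (2 * k i + 1) : ℝ) = 0 := by
    intro k hk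
    rw [mul_assoc, TopRec.amplitude_painleveI_eq_zero hu hgn k, mul_zero]
    by_contra hle
    exact hk (hD k (by omega))
  refine ⟨summable_of_ne_finset_zero hzero, ?_⟩
  rw [tsum_eq_sum hzero, show 3 * g + n - 3 = N by omega, show 3 * g + 2 * n - 3 = N + n by omega]
  set R : ℝ := S (u / v) / v * (2 * u / 27) ^ g * (TopRec.growthP (u / v) / v ^ 2) ^ N *
    ((N.factorial : ℝ) / (g.factorial : ℝ)) with hR
  have hbound : ∀ k ∈ D, (v ^ (∑ i, k i))⁻¹ * TopRec.amplitude (TopRec.painleveI u) g k *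
      ∏ i, (Nat.doubleFactorial (2 * k i + 1) : ℝ) ≤ R := by
    intro k _
    have h := hS u v hu hv g n hgn k
    rw [show 3 * g + n - 3 = N by omega] at h
    rw [mul_assoc, inv_mul_le_iff₀ (by positivity)]
    exact h
  have hR0 : 0 ≤ R := by positivity
  have hc : ((N + n).choose n : ℝ) * N.factorial * n.factorial = (N + n).factorial := by
    have := Nat.add_choose_mul_factorial_mul_factorial N n
    exact_mod_cast this
  -- Each term is at most `R`, and `binom(N+n,n) N! = (N+n)!/n!` produces the factorials of the
  -- second bound.
  calc _ ≤ D.card • R := Finset.sum_le_card_nsmul _ _ _ hbound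
    _ = (D.card : ℝ) * R := nsmul_eq_mul _ _
    _ ≤ ((N + n).choose n : ℝ) * R := by
      gcongr
    _ = _ := by
      rw [← hc, hR]
      have : (n.factorial : ℝ) ≠ 0 := by positivity
      field_simp
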